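/- **Notation and definitions.** $\widehat{\mathbb C}=\mathbb C\cup\{\infty\}$, $\mathbb C^*=\mathbb C\setminus\{0\}$, $\exp_1(z)=e^{2\pi i z}$. A transcendental meromorphic function $f:\mathbb C\to\widehat{\mathbb C}$ is *projectable* via $\exp_1$ if there is a function $g$, its *exponential projection*, with $g\circ\exp_1=\exp_1\circ f$ whenever defined. For a function $h$ that is meromorphic on an open set $U\subset\widehat{\mathbb C}$ with countable complement (here $h=f$ on $\mathbb C$; $h=\Phi$ on $\mathbb C^*$; $h=g$ on $\exp_1(\mathbb C\setminus f^{-1}(\infty))$), let $\mathcal D(h)$ be the set of all points of $\widehat{\mathbb C}$ to which $h$ extends meromorphically, let $h$ also denote the extension to $\mathcal D(h)$, and let $\mathcal E(h)=\widehat{\mathbb C}\setminus\mathcal D(h)$ be the set of essential singularities; preimages under $h$ are taken in $\mathcal D(h)$. The set $\mathcal{CV}(h)$ of critical values consists of the images $h(c)$ of the points $c\in\mathcal D(h)$ at which the derivative of $h$ in local coordinates of $\widehat{\mathbb C}$ vanishes (so multiple poles count as critical points). The set $\mathcal{AV}(h)$ of asymptotic values consists of the $v\in\widehat{\mathbb C}$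 for which there is a path $\gamma:[0,1)\to\mathcal D(h)$ with $\gamma(t)\to \hat w$ for some $\hat w\in\mathcal E(h)$ and $h(\gamma(t))\to v$ as $t\to1$. The set of singular values is $\mathcal S(h)=\overline{\mathcal{CV}(h)\cup\mathcal{AV}(h)}$, with closure in $\widehat{\mathbb C}$, and $h$ is of *finite type* if $\mathcal S(h)$ is finite. Finally, $f$ is *simply pseudoperiodic* if the set of all $\tau\in\mathbb C$ for which $f(z+\tau)-f(z)$ is constant is $\tau_1\mathbb Z$ for some $\tau_1\neq0$; it is *doubly pseudoperiodic* if, besides $f(z+1)=f(z)+\ell$, one has $f(z+\tau)=f(z)+\eta_\tau$ for some $\tau$ with $\operatorname{Im}\tau>0$ and some $\eta_\tau\in\mathbb C$. **Theorem B (Projections of finite type).** Let $f$ be a projectable function via $\exp_1$, written as $f(z)=\ell z+\Phi(e^{2\pi i z})$ with $\ell\in\mathbb Z$ and $\Phi$ meromorphic in $\mathbb C^*$, let $g$ be its exponential projection, and let $\widetilde S_0=\{z\in\mathbb C:-\tfrac{|\ell|}{2}<\operatorname{Re}z\le\tfrac{|\ell|}{2}\}$. Then $g$ is of finite type if and only if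 one of the following holds: (i) $\ell\ne0$, the set $\mathcal S(f)\cap\widetilde S_0$ is finite and, in addition, $\eta_\tau\in\mathbb Q$ whenever $f(z+\tau)=f(z)+\eta_\tau$ for all $z$, with $\operatorname{Im}\tau>0$ and $\eta_\tau\in\mathbb C$ (the case that $f$ is doubly pseudoperiodic); (ii) $\ell=0$ and the set $\exp_1\big(\mathcal S(\Phi)\setminus\{\infty\}\big)$ is finite. Furthermore, $\mathcal S(g)\cap\mathbb C^*=\exp_1\big(\mathcal S(f)\setminus\{\infty\}\big)$ whenever $\ell\neq0$ (in particular in case (i)), $\mathcal S(g)\cap\mathbb C^*=\exp_1\big(\mathcal S(\Phi)\setminus\{\infty\}\big)$ in case (ii), and $\{0,\infty\}\subset\mathcal{AV}(g)$ always (in particular in both cases). Additionally, $0$ (resp. $\infty$) belongs to $\mathcal{CV}(g)$ if and only if $f$ is simply pseudoperiodic, $|\ell|\ge2$, and the point of $\{0,\infty\}$ at which $w\mapsto w^\ell$ takes the value $0$ (resp. $\infty$), that is, $0$ (resp. $\infty$) if $\ell>0$ and $\infty$ (resp. $0$) if $\ell<0$, is outside of $\mathcal E(\Phi)\cup\Phi^{-1}(\infty)$.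 -/

import Mathlib

open Set Filter Topology

noncomputable section

/-- The Riemann sphere, as the one-point compactification of the complex plane. -/
abbrev RSphere : Type := OnePoint ℂ

namespace RSphere

/-- The point `∞` of the sphere. -/
def inf : RSphere := OnePoint.infty

/-- The point `0` of the sphere. -/
def zero : RSphere := ((0 : ℂ) : RSphere)

/-- The involution `w ↦ 1 / w` of the sphere, exchanging `0` and `∞`. -/
def recip (p : RSphere) : RSphere :=
  p.elim zero (fun z => if z = 0 then inf else ((z⁻¹ : ℂ) : RSphere))

/-- The coordinate `w ↦ w` on the sphere without `∞` (the value at `∞` is irrelevant). -/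
def toPlane (p : RSphere) : ℂ := p.elim 0 id

open Classical in
/-- The coordinate used near `p`: `w` if `p` is finite, `1 / w` if `p = ∞`. -/
def coord (p q : RSphere) : ℂ := if p = inf then toPlane (recip q) else toPlane q

open Classical in
/-- The local parametrization inverse to `coord p`. -/
def param (p : RSphere) (z : ℂ) : RSphere := if p = inf then recip (z : RSphere) else (z : RSphere)

/-- The expression of `F` in the local coordinates at `p` and at `F p`. -/
def localRep (F : RSphere → RSphere) (p : RSphere) : ℂ → ℂ :=
  fun z => coord (F p) (F (param p z))

/-- `F` is holomorphic near `p`, as a map of the sphere to itself (so poles are allowed). -/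
def IsMeroAt (F : RSphere → RSphere) (p : RSphere) : Prop :=
  ContinuousAt F p ∧ AnalyticAt ℂ (localRep F p) (coord p p)

/-! A meromorphic function on an open dense set `U` of the sphere is given by a pair `(U, F)`;
the values of `F` outside `U` are irrelevant in all of the following notions. -/

/-- The domain of definition: all points near which `F` restricted to `U` has a
meromorphic extension. -/
def dom (U : Set RSphere) (F : RSphere → RSphere) : Set RSphere :=
  {p | ∃ G : RSphere → RSphere, IsMeroAt G p ∧ ∀ᶠ q in 𝓝 p, q ∈ U → G q = F q}

/-- The set of essential singularities: the complement of the domain of definition. -/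
def ess (U : Set RSphere) (F : RSphere → RSphere) : Set RSphere := (dom U F)ᶜ

/-- The maximal extension of `F` restricted to `U`, by limits along `U`. -/
def ext (U : Set RSphere) (F : RSphere → RSphere) : RSphere → RSphere := extendFrom U F

/-- The preimage of the value `v` in the domain of definition. -/
def fiber (U : Set RSphere) (F : RSphere → RSphere) (v : RSphere) : Set RSphere :=
  {p | p ∈ dom U F ∧ ext U F p = v}

/-- Critical points: the derivative in local coordinates vanishes (multiple poles included). -/
def critPts (U : Set RSphere) (F : RSphere → RSphere) : Set RSphere :=
  {c | c ∈ dom U F ∧ deriv (localRep (ext U F) c) (coord c c) = 0}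

/-- Critical values. -/
def critVals (U : Set RSphere) (F : RSphere → RSphere) : Set RSphere := ext U F '' critPts U F

/-- Asymptotic values: limits of the function along a path `γ : [0,1) → dom` that tends to an
essential singularity. -/
def asympVals (U : Set RSphere) (F : RSphere → RSphere) : Set RSphere :=
  {v | ∃ γ : ℝ → RSphere, ContinuousOn γ (Ico 0 1) ∧ (∀ t ∈ Ico (0 : ℝ) 1, γ t ∈ dom U F) ∧
    (∃ e ∈ ess U F, Tendsto γ (𝓝[<] 1) (𝓝 e)) ∧
    Tendsto (fun t => ext U F (γ t)) (𝓝[<] 1) (𝓝 v)}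

/-- Singular values: the closure, in the sphere, of the critical and asymptotic values. -/
def singVals (U : Set RSphere) (F : RSphere → RSphere) : Set RSphere :=
  closure (critVals U F ∪ asympVals U F)

/-- The finite points of the sphere. -/
def plane : Set RSphere := {p | p ≠ inf}

/-- The punctured plane `ℂ*`. -/
def punctured : Set RSphere := {p | p ≠ zero ∧ p ≠ inf}

/-- A function on the plane, seen on the sphere (the value at `∞` is irrelevant). -/
def onSphere (f : ℂ → RSphere) : RSphere → RSphere := fun p => p.elim inf f

/-- `f` is a meromorphic function on the plane (not identically `∞`). -/
def IsMeromorphicOnPlane (f : ℂ → RSphere) : Prop :=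
  (∀ z : ℂ, IsMeroAt (onSphere f) (z : RSphere)) ∧ ∃ z, f z ≠ inf

/-- `f` is a rational function. -/
def IsRationalOnPlane (f : ℂ → RSphere) : Prop :=
  ∃ P Q : Polynomial ℂ, Q ≠ 0 ∧
    ∀ z : ℂ, Q.eval z ≠ 0 → f z = ((P.eval z / Q.eval z : ℂ) : RSphere)

/-- `f` is a transcendental meromorphic function on the plane. -/
def IsTranscendentalMeromorphic (f : ℂ → RSphere) : Prop :=
  IsMeromorphicOnPlane f ∧ ¬ IsRationalOnPlane f

/-- The exponential of period `1`, `z ↦ exp (2 π i z)`. -/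
def exp₁ (z : ℂ) : ℂ := Complex.exp (2 * Real.pi * Complex.I * z)

/-- The image under `exp₁` of the finite points of a subset of the sphere. -/
def exp₁Image (A : Set RSphere) : Set RSphere :=
  {p | ∃ u : ℂ, (u : RSphere) ∈ A ∧ p = (exp₁ u : RSphere)}

/-- The set of all `exp₁ z` with `f z` finite, where the relation `g ∘ exp₁ = exp₁ ∘ f` gives
the values of `g`. -/
def projDom (f : ℂ → RSphere) : Set RSphere :=
  {p | ∃ z : ℂ, f z ≠ inf ∧ p = (exp₁ z : RSphere)}

/-- `f` is projectable via `exp₁`, with exponential projection `g`: a transcendental meromorphic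
function with `g ∘ exp₁ = exp₁ ∘ f` whenever defined. The values of `g` outside `projDom f` are
irrelevant: the projection is the meromorphic function given by the pair `(projDom f, g)`. -/
def IsProjectableWith (f : ℂ → RSphere) (g : RSphere → RSphere) : Prop :=
  IsTranscendentalMeromorphic f ∧
    ∀ z u : ℂ, f z = (u : RSphere) → g (exp₁ z : RSphere) = (exp₁ u : RSphere)

/-- `f (z + τ) = f z + η` for all `z` (with `∞ + η = ∞`). -/
def HasPseudoperiod (f : ℂ → RSphere) (τ η : ℂ) : Prop :=
  ∀ z : ℂ, f (z + τ) = OnePoint.map (fun u => u + η) (f z)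

/-- `f` is simply pseudoperiodic: the translations `τ` with `f (z + τ) = f z + η` for some
constant `η` are exactly the integer multiples of some `τ₁ ≠ 0`. -/
def IsSimplyPseudoperiodic (f : ℂ → RSphere) : Prop :=
  ∃ τ₁ : ℂ, τ₁ ≠ 0 ∧ {τ : ℂ | ∃ η, HasPseudoperiod f τ η} = {τ : ℂ | ∃ m : ℤ, τ = m * τ₁}

/-- The strip `- |ℓ| / 2 < Re z ≤ |ℓ| / 2`, as a subset of the sphere. -/
def strip (ℓ : ℤ) : Set RSphere :=
  {p | ∃ z : ℂ, p = (z : RSphere) ∧ -(|(ℓ : ℝ)| / 2) < z.re ∧ z.re ≤ |(ℓ : ℝ)| / 2}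

/-- Non-periodic case: `ℓ ≠ 0`, `f` has finitely many singular values in the strip, and
`η` is rational whenever `f (z + τ) = f z + η` with `Im τ > 0`. -/
def CaseNonperiodic (f : ℂ → RSphere) (ℓ : ℤ) : Prop :=
  ℓ ≠ 0 ∧ (singVals plane (onSphere f) ∩ strip ℓ).Finite ∧
    ∀ τ η : ℂ, 0 < τ.im → HasPseudoperiod f τ η → ∃ q : ℚ, η = (q : ℂ)

/-- Periodic case: `ℓ = 0`, and the singular values of `Φ` have finite image under `exp₁`. -/
def CasePeriodic (Φ : RSphere → RSphere) (ℓ : ℤ) : Prop :=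
  ℓ = 0 ∧ (exp₁Image (singVals punctured Φ)).Finite

/-- The zero on the sphere of `w ↦ w ^ ℓ`, for `ℓ ≠ 0`. -/
def zeroEnd (ℓ : ℤ) : RSphere := if 0 < ℓ then zero else inf

/-- The pole on the sphere of `w ↦ w ^ ℓ`, for `ℓ ≠ 0`. -/
def poleEnd (ℓ : ℤ) : RSphere := if 0 < ℓ then inf else zero

end RSphere

end

namespace RSphere

/-! ### The sphere and its charts -/

/-! On the punctured plane the projection is explicit: `g w = w ^ ℓ * exp₁ (Φ w)` wherever `Φ` is
finite (`proj_coe`). Everything is read off this formula.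

Domain of `g`. Where `Φ` extends with a finite value, `g` extends meromorphically. Conversely, if
`g` is meromorphic at `p`, so is `exp₁ ∘ Φ`, and a function whose exponential is meromorphic at an
isolated singularity extends analytically there (`exists_analyticAt_of_meromorphicAt_exp`). Hence
the essential singularities of `g` are exactly the poles and the essential singularities of `Φ`
(`mem_dom_iff`).

The values `0` and `∞`. On its domain inside the punctured plane `g` omits both. At a puncture where
`Φ` is finite, `g` is a nonvanishing factor times a power with exponent `ℓ` or `-ℓ`, which settles
when `0` and `∞` are critical values. Such a finite value also forces `f` to be simply
pseudoperiodic: all pseudoperiods are then real periods of the nonconstant function `Φ ∘ exp₁`, and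
these form a discrete group. An isolated essential singularity of `g` must exist, for otherwise `Φ ∘
exp₁` would be bounded and entire, and `f` affine. Near it `g` is holomorphic without zeros, and an
Iversen-type path construction for `g` and for `1 / g` yields the asymptotic values `∞` and `0`.

Values in `ℂ*`. The relation `g ∘ exp₁ = exp₁ ∘ f` matches finite critical points of `f` with those
of `g`, as `exp₁` has no critical points. A path of `g` with limit `exp₁ u` lifts to a path tending
to `∞` on which `f → u`. Conversely, for `ℓ ≠ 0`, let `ζ → ∞` and `f ∘ ζ → u`: in `ℂ*` the path
`exp₁ ∘ ζ` can accumulate only at poles of `Φ`, which are isolated, so it converges on the sphere,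
and the limit is an essential singularity of `g`. For `ℓ = 0` the same comparison is made with `Φ`,
since then `g = exp₁ ∘ Φ`.

Closures and finiteness. For `ℓ ≠ 0` the singular values of `f` are invariant under translation by
multiples of `ℓ`, so modulo `1` only finitely many translates matter; hence closure commutes with
`exp₁`, and the strip contains finitely many singular values exactly when their image is finite. For
`ℓ = 0` a finite image is already closed in `ℂ*`. If `f` is doubly pseudoperiodic, it has a finite
critical value `u` (otherwise `1 / f'` is an elliptic function without poles, hence constant); all
`u + n * η` are critical values, and finiteness modulo `1` makes `η` rational. -/

theorem coe_ne_inf (z : ℂ) : (z : RSphere) ≠ inf := OnePoint.coe_ne_infty z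

theorem inf_ne_coe (z : ℂ) : inf ≠ (z : RSphere) := OnePoint.infty_ne_coe z

theorem coe_inj {z w : ℂ} : (z : RSphere) = (w : RSphere) ↔ z = w := OnePoint.coe_eq_coe

theorem exists_coe_of_ne_inf {p : RSphere} (hp : p ≠ inf) : ∃ z : ℂ, p = (z : RSphere) := by
  obtain ⟨z, hz⟩ := OnePoint.ne_infty_iff_exists.1 hp
  exact ⟨z, hz.symm⟩

theorem eq_inf_or_coe (p : RSphere) : p = inf ∨ ∃ z : ℂ, p = (z : RSphere) := by
  by_cases hp : p = inf
  · exact Or.inl hp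
  · exact Or.inr (exists_coe_of_ne_inf hp)

theorem map_coe (h : ℂ → ℂ) (z : ℂ) : OnePoint.map h (z : RSphere) = (h z : RSphere) := rfl

theorem map_inf (h : ℂ → ℂ) : OnePoint.map h inf = inf := rfl

@[simp] theorem toPlane_coe (z : ℂ) : toPlane (z : RSphere) = z := rfl

@[simp] theorem toPlane_inf : toPlane inf = 0 := rfl

@[simp] theorem recip_inf : recip inf = zero := rfl

theorem recip_coe (z : ℂ) :
    recip (z : RSphere) = if z = 0 then inf else ((z⁻¹ : ℂ) : RSphere) := rfl

theorem recip_coe_of_ne {z : ℂ} (hz : z ≠ 0) : recip (z : RSphere) = ((z⁻¹ : ℂ) : RSphere) := by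
  rw [recip_coe, if_neg hz]

@[simp] theorem recip_coe_zero : recip ((0 : ℂ) : RSphere) = inf := by
  rw [recip_coe, if_pos rfl]

@[simp] theorem recip_zero : recip zero = inf := recip_coe_zero

@[simp] theorem recip_recip (p : RSphere) : recip (recip p) = p := by
  rcases eq_inf_or_coe p with rfl | ⟨z, rfl⟩
  · simp
  · by_cases hz : z = 0
    · subst hz
      simp [zero]
    · rw [recip_coe_of_ne hz, recip_coe_of_ne (inv_ne_zero hz), inv_inv]

theorem toPlane_recip_coe (z : ℂ) : toPlane (recip (z : RSphere)) = z⁻¹ := by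
  by_cases hz : z = 0
  · subst hz
    simp
  · rw [recip_coe_of_ne hz, toPlane_coe]

@[simp] theorem onSphere_coe (f : ℂ → RSphere) (z : ℂ) : onSphere f (z : RSphere) = f z := rfl

theorem coord_coe (a : ℂ) : coord (a : RSphere) = toPlane := by
  funext q
  rw [coord, if_neg (coe_ne_inf a)]

theorem coord_inf : coord inf = fun q => toPlane (recip q) := by
  funext q
  rw [coord, if_pos rfl]

theorem param_coe (a : ℂ) : param (a : RSphere) = ((↑) : ℂ → RSphere) := by
  funext q
  rw [param, if_neg (coe_ne_inf a)]

theorem param_inf : param inf = fun z : ℂ => recip (z : RSphere) := by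
  funext q
  rw [param, if_pos rfl]

@[simp] theorem coord_coe_self (a : ℂ) : coord (a : RSphere) (a : RSphere) = a := by
  rw [coord_coe, toPlane_coe]

@[simp] theorem coord_inf_self : coord inf inf = 0 := by
  rw [coord_inf]
  simp [zero]

theorem param_coord_self (p : RSphere) : param p (coord p p) = p := by
  rcases eq_inf_or_coe p with rfl | ⟨z, rfl⟩
  · rw [coord_inf_self, param_inf]
    simp
  · rw [coord_coe_self, param_coe]

theorem coord_param (p : RSphere) (z : ℂ) : coord p (param p z) = z := by
  rcases eq_inf_or_coe p with rfl | ⟨a, rfl⟩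
  · rw [coord_inf, param_inf]
    simp
  · rw [coord_coe, param_coe, toPlane_coe]

theorem map_coe_nhdsNE_zero :
    map (fun z : ℂ => recip (z : RSphere)) (𝓝[≠] (0 : ℂ)) = 𝓝[≠] inf := by
  have h1 : 𝓝[≠] inf = map ((↑) : ℂ → RSphere) (coclosedCompact ℂ) := OnePoint.nhdsNE_infty_eq
  rw [h1, coclosedCompact_eq_cocompact, ← Metric.cobounded_eq_cocompact,
    ← Filter.inv_nhdsNE_zero, ← Filter.map_inv, map_map]
  refine Filter.map_congr ?_
  filter_upwards [self_mem_nhdsWithin] with z hz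
  exact recip_coe_of_ne hz

theorem nhds_inf_eq : 𝓝 inf = map (fun z : ℂ => recip (z : RSphere)) (𝓝 0) := by
  rw [← nhdsNE_sup_pure, ← nhdsNE_sup_pure (0 : ℂ), map_sup, map_coe_nhdsNE_zero, map_pure]
  simp

theorem nhds_eq (p : RSphere) : 𝓝 p = map (param p) (𝓝 (coord p p)) := by
  rcases eq_inf_or_coe p with rfl | ⟨a, rfl⟩
  · rw [coord_inf_self, param_inf, nhds_inf_eq]
  · rw [coord_coe_self, param_coe]
    exact OnePoint.nhds_coe_eq a

theorem nhdsNE_eq (p : RSphere) : 𝓝[≠] p = map (param p) (𝓝[≠] (coord p p)) := by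
  rcases eq_inf_or_coe p with rfl | ⟨a, rfl⟩
  · rw [coord_inf_self, param_inf, map_coe_nhdsNE_zero]
  · rw [coord_coe_self, param_coe, OnePoint.nhdsWithin_coe]
    congr 2
    ext z
    simp

theorem eventually_nhds_iff {p : RSphere} {P : RSphere → Prop} :
    (∀ᶠ q in 𝓝 p, P q) ↔ ∀ᶠ z in 𝓝 (coord p p), P (param p z) := by
  rw [nhds_eq, eventually_map]

theorem eventually_nhdsNE_iff {p : RSphere} {P : RSphere → Prop} :
    (∀ᶠ q in 𝓝[≠] p, P q) ↔ ∀ᶠ z in 𝓝[≠] (coord p p), P (param p z) := by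
  rw [nhdsNE_eq, eventually_map]

theorem tendsto_param (p : RSphere) : Tendsto (param p) (𝓝 (coord p p)) (𝓝 p) := by
  rw [nhds_eq p]
  exact tendsto_map

theorem tendsto_coord (p : RSphere) : Tendsto (coord p) (𝓝 p) (𝓝 (coord p p)) := by
  rw [nhds_eq p, tendsto_map'_iff]
  have : coord p ∘ param p = id := funext (coord_param p)
  rw [this]
  exact tendsto_id

theorem eventually_param_coord (p : RSphere) : ∀ᶠ q in 𝓝 p, param p (coord p q) = q := by
  rw [eventually_nhds_iff]
  exact Eventually.of_forall fun z => by rw [coord_param]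

theorem continuous_recip : Continuous recip := by
  refine continuous_iff_continuousAt.2 fun p => ?_
  rcases eq_inf_or_coe p with rfl | ⟨a, rfl⟩
  · rw [ContinuousAt, nhds_inf_eq, tendsto_map'_iff]
    have : recip ∘ (fun z : ℂ => recip (z : RSphere)) = ((↑) : ℂ → RSphere) :=
      funext fun z => recip_recip _
    rw [this, recip_inf]
    exact OnePoint.continuous_coe.tendsto 0
  · by_cases ha : a = 0
    · subst ha
      rw [OnePoint.continuousAt_coe, ContinuousAt]
      change Tendsto _ _ (𝓝 (recip ((0 : ℂ) : RSphere)))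
      rw [recip_coe_zero, nhds_inf_eq]
      exact tendsto_map
    · rw [OnePoint.continuousAt_coe]
      have h1 : ContinuousAt (fun z : ℂ => ((z⁻¹ : ℂ) : RSphere)) a :=
        OnePoint.continuous_coe.continuousAt.comp (continuousAt_inv₀ ha)
      refine h1.congr ?_
      filter_upwards [isOpen_ne.mem_nhds ha] with z hz
      exact (recip_coe_of_ne hz).symm

theorem continuous_param (p : RSphere) : Continuous (param p) := by
  rcases eq_inf_or_coe p with rfl | ⟨a, rfl⟩
  · rw [param_inf]
    exact continuous_recip.comp OnePoint.continuous_coe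
  · rw [param_coe]
    exact OnePoint.continuous_coe

theorem continuousAt_toPlane (a : ℂ) : ContinuousAt toPlane (a : RSphere) := by
  have := tendsto_coord (a : RSphere)
  rwa [coord_coe_self, coord_coe] at this

theorem eventually_ne_inf (a : ℂ) : ∀ᶠ q in 𝓝 (a : RSphere), q ≠ inf :=
  isOpen_ne.mem_nhds (coe_ne_inf a)

theorem coe_toPlane {p : RSphere} (hp : p ≠ inf) : ((toPlane p : ℂ) : RSphere) = p := by
  obtain ⟨z, rfl⟩ := exists_coe_of_ne_inf hp
  rfl

/-! ### Local representations of maps of the sphere -/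

/-- Off `p`, the map `F` is given near `p`, in the chart at `p`, by the function `φ`, which is
analytic at `p`. -/
def FinRep (F : RSphere → RSphere) (p : RSphere) (φ : ℂ → ℂ) : Prop :=
  AnalyticAt ℂ φ (coord p p) ∧ ∀ᶠ z in 𝓝[≠] (coord p p), F (param p z) = (φ z : RSphere)

/-- Off `p`, the map `F` is given near `p`, in the chart at `p`, by `1 / φ`, where `φ` is
analytic at `p` and vanishes there. -/
def PoleRep (F : RSphere → RSphere) (p : RSphere) (φ : ℂ → ℂ) : Prop :=
  AnalyticAt ℂ φ (coord p p) ∧ φ (coord p p) = 0 ∧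
    ∀ᶠ z in 𝓝[≠] (coord p p), F (param p z) = recip (φ z : RSphere)

theorem FinRep.continuousAt {F : RSphere → RSphere} {p : RSphere} {φ : ℂ → ℂ}
    (h : FinRep F p φ) :
    Tendsto F (𝓝[≠] p) (𝓝 (φ (coord p p) : RSphere)) := by
  rw [nhdsNE_eq, tendsto_map'_iff]
  have h1 : Tendsto (fun z => (φ z : RSphere)) (𝓝[≠] coord p p) (𝓝 (φ (coord p p) : RSphere)) :=
    ((OnePoint.continuous_coe.tendsto _).comp h.1.continuousAt.tendsto).mono_left nhdsWithin_le_nhds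
  exact h1.congr' (h.2.mono fun z hz => hz.symm)

theorem PoleRep.continuousAt {F : RSphere → RSphere} {p : RSphere} {φ : ℂ → ℂ}
    (h : PoleRep F p φ) : Tendsto F (𝓝[≠] p) (𝓝 inf) := by
  rw [nhdsNE_eq, tendsto_map'_iff]
  have h1 : Tendsto (fun z => recip (φ z : RSphere)) (𝓝[≠] coord p p)
      (𝓝 (recip (φ (coord p p) : RSphere))) :=
    (((continuous_recip.comp OnePoint.continuous_coe).tendsto _).comp
      h.1.continuousAt.tendsto).mono_left nhdsWithin_le_nhds
  rw [h.2.1, recip_coe_zero] at h1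
  exact h1.congr' (h.2.2.mono fun z hz => hz.symm)

theorem isMeroAt_of_coe {F : RSphere → RSphere} {p : RSphere} {φ : ℂ → ℂ}
    (ha : AnalyticAt ℂ φ (coord p p))
    (h : ∀ᶠ z in 𝓝 (coord p p), F (param p z) = (φ z : RSphere)) : IsMeroAt F p := by
  have hp : F p = (φ (coord p p) : RSphere) := by
    have := h.self_of_nhds
    rwa [param_coord_self] at this
  refine ⟨?_, ?_⟩
  · rw [ContinuousAt, nhds_eq p, tendsto_map'_iff, hp]
    exact ((OnePoint.continuous_coe.tendsto _).comp ha.continuousAt.tendsto).congr'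
      (h.mono fun z hz => hz.symm)
  · refine ha.congr (h.mono fun z hz => ?_)
    rw [localRep, hz, hp, coord_coe, toPlane_coe]

theorem isMeroAt_of_recip {F : RSphere → RSphere} {p : RSphere} {φ : ℂ → ℂ}
    (ha : AnalyticAt ℂ φ (coord p p)) (h0 : φ (coord p p) = 0)
    (h : ∀ᶠ z in 𝓝 (coord p p), F (param p z) = recip (φ z : RSphere)) : IsMeroAt F p := by
  have hp : F p = inf := by
    have := h.self_of_nhds
    rwa [param_coord_self, h0, recip_coe_zero] at this
  refine ⟨?_, ?_⟩
  · rw [ContinuousAt, nhds_eq p, tendsto_map'_iff]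
    have h1 := (((continuous_recip.comp OnePoint.continuous_coe).tendsto _).comp
      ha.continuousAt.tendsto)
    rw [Function.comp_apply, h0, recip_coe_zero] at h1
    rw [hp]
    exact h1.congr' (h.mono fun z hz => hz.symm)
  · refine ha.congr (h.mono fun z hz => ?_)
    simp only [localRep, hz, hp, coord_inf, recip_recip, toPlane_coe]

/-- The expression of a meromorphic map near a point. -/
theorem IsMeroAt.exists_rep {F : RSphere → RSphere} {p : RSphere} (h : IsMeroAt F p) :
    ∃ φ : ℂ → ℂ, AnalyticAt ℂ φ (coord p p) ∧
      ((∀ᶠ z in 𝓝 (coord p p), F (param p z) = (φ z : RSphere)) ∨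
        (φ (coord p p) = 0 ∧ ∀ᶠ z in 𝓝 (coord p p), F (param p z) = recip (φ z : RSphere))) := by
  refine ⟨localRep F p, h.2, ?_⟩
  have hc : Tendsto (fun z => F (param p z)) (𝓝 (coord p p)) (𝓝 (F p)) :=
    h.1.tendsto.comp (tendsto_param p)
  rcases eq_inf_or_coe (F p) with hp | ⟨a, hp⟩
  · right
    refine ⟨by rw [localRep, param_coord_self, hp, coord_inf_self], ?_⟩
    have := hc.eventually (eventually_param_coord (F p))
    refine this.mono fun z hz => ?_
    rw [localRep]
    conv_lhs => rw [← hz]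
    rw [hp, param_inf]
  · left
    have := hc.eventually (eventually_param_coord (F p))
    refine this.mono fun z hz => ?_
    rw [localRep]
    conv_lhs => rw [← hz]
    rw [hp, param_coe]

theorem exists_isMeroAt_coe {p : RSphere} {φ : ℂ → ℂ} (ha : AnalyticAt ℂ φ (coord p p)) :
    IsMeroAt (fun q => (φ (coord p q) : RSphere)) p :=
  isMeroAt_of_coe ha (Eventually.of_forall fun z => by rw [coord_param])

theorem exists_isMeroAt_recip {p : RSphere} {φ : ℂ → ℂ} (ha : AnalyticAt ℂ φ (coord p p))
    (h0 : φ (coord p p) = 0) : IsMeroAt (fun q => recip (φ (coord p q) : RSphere)) p :=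
  isMeroAt_of_recip ha h0 (Eventually.of_forall fun z => by rw [coord_param])

/-- A full neighbourhood of `p`, except possibly `p` itself, is contained in `U`. -/
def NearlyContains (U : Set RSphere) (p : RSphere) : Prop := ∀ᶠ q in 𝓝[≠] p, q ∈ U

theorem NearlyContains.param {U : Set RSphere} {p : RSphere} (hU : NearlyContains U p) :
    ∀ᶠ z in 𝓝[≠] (coord p p), param p z ∈ U := eventually_nhdsNE_iff.1 hU

/-! ### Domain, extension and critical points in charts -/

variable {U : Set RSphere} {F : RSphere → RSphere} {p : RSphere} {φ : ℂ → ℂ}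

theorem exists_rep_of_mem_dom (hU : NearlyContains U p) (hp : p ∈ dom U F) :
    ∃ φ, FinRep F p φ ∨ PoleRep F p φ := by
  obtain ⟨G, hG, hGF⟩ := hp
  obtain ⟨φ, ha, h⟩ := hG.exists_rep
  have h1 := (eventually_nhds_iff.1 hGF).filter_mono (nhdsWithin_le_nhds (s := {coord p p}ᶜ))
  refine ⟨φ, ?_⟩
  rcases h with h | ⟨h0, h⟩
  · left
    refine ⟨ha, ?_⟩
    filter_upwards [h.filter_mono nhdsWithin_le_nhds, h1, hU.param] with z hz hz1 hz2
    rw [← hz1 hz2, hz]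
  · right
    refine ⟨ha, h0, ?_⟩
    filter_upwards [h.filter_mono nhdsWithin_le_nhds, h1, hU.param] with z hz hz1 hz2
    rw [← hz1 hz2, hz]

instance : (𝓝[≠] p).NeBot := by
  rw [nhdsNE_eq]
  infer_instance

/-- The extension is a limit along `𝓝[U] p`. This filter contains a punctured neighbourhood of `p`,
and also `p` itself when `p ∈ U`, so in that case the value at `p` has to agree with the limit. -/
theorem ext_eq_of_tendsto (hU : NearlyContains U p) {v : RSphere}
    (h : Tendsto F (𝓝[≠] p) (𝓝 v)) (hpU : p ∈ U → F p = v) : ext U F p = v := by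
  have h1 : 𝓝[≠] p ≤ 𝓝[U] p := by
    rw [nhdsWithin, nhdsWithin]
    refine le_inf inf_le_left ?_
    exact le_principal_iff.2 hU
  refine extendFrom_eq ?_ ?_
  · rw [mem_closure_iff_nhdsWithin_neBot]
    exact neBot_of_le h1
  · have h2 : 𝓝[U] p ≤ 𝓝[insert p {p}ᶜ] p ⊓ 𝓟 U :=
      le_inf (nhdsWithin_mono _ fun x _ => by
        by_cases hx : x = p <;> simp [hx]) (inf_le_right)
    rw [nhdsWithin_insert] at h2
    refine (Tendsto.mono_left ?_ h2)
    rw [inf_sup_right, tendsto_sup]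
    refine ⟨?_, h.mono_left inf_le_left⟩
    by_cases hp : p ∈ U
    · exact (tendsto_pure_nhds F p |>.mono_left inf_le_left).trans (by rw [hpU hp])
    · have : pure p ⊓ 𝓟 U = (⊥ : Filter RSphere) := by
        rw [← principal_singleton, inf_principal, singleton_inter_eq_empty.2 hp, principal_empty]
      rw [this]
      exact tendsto_bot

/-- If `F` agrees off `p` with a map that is continuous near `p`, so does its extension, and the
extension also agrees at `p`. -/
theorem ext_eventually_eq (hU : NearlyContains U p) {h : ℂ → RSphere}
    (hc : ∀ᶠ z in 𝓝 (coord p p), ContinuousAt h z)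
    (hF : ∀ᶠ z in 𝓝[≠] (coord p p), F (param p z) = h z)
    (hpU : p ∈ U → F p = h (coord p p)) :
    ∀ᶠ z in 𝓝 (coord p p), ext U F (param p z) = h z := by
  have key : ∀ᶠ q in 𝓝[≠] p, F q = h (coord p q) := by
    rw [eventually_nhdsNE_iff]
    exact hF.mono fun z hz => by rw [coord_param, hz]
  have hc' : ∀ᶠ q in 𝓝 p, ContinuousAt h (coord p q) := (tendsto_coord p).eventually hc
  have hcoord : ∀ᶠ q in 𝓝 p, ContinuousAt (coord p) q := by
    rcases eq_inf_or_coe p with rfl | ⟨a, rfl⟩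
    · have h0 : ∀ᶠ q in 𝓝 inf, q ≠ zero := isOpen_ne.mem_nhds (inf_ne_coe 0)
      refine h0.mono fun q hq => ?_
      rw [coord_inf]
      have hq' : recip q ≠ inf := fun h => hq (by
        rw [← recip_recip q, h, recip_inf])
      obtain ⟨b, hb⟩ := exists_coe_of_ne_inf hq'
      exact ContinuousAt.comp (by rw [hb]; exact continuousAt_toPlane b) continuous_recip.continuousAt
    · refine (eventually_ne_inf a).mono fun q hq => ?_
      obtain ⟨b, rfl⟩ := exists_coe_of_ne_inf hq
      rw [coord_coe]
      exact continuousAt_toPlane b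
  -- The extension is a separate limit at every nearby `q`, so each `q` needs its own punctured
  -- neighbourhood avoiding `p`, where the hypotheses say nothing.
  have main : ∀ᶠ q in 𝓝 p, ext U F q = h (coord p q) := by
    have h2 := eventually_eventually_nhds.2 (eventually_nhdsWithin_iff.1 hU)
    have h3 := eventually_eventually_nhds.2 (eventually_nhdsWithin_iff.1 key)
    filter_upwards [hc', hcoord, h2, h3] with q hq1 hq2 hq3 hq4
    have hq5 : Tendsto (fun r => h (coord p r)) (𝓝[≠] q) (𝓝 (h (coord p q))) :=
      (ContinuousAt.comp hq1 hq2).tendsto.mono_left nhdsWithin_le_nhds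
    have hne : ∀ᶠ r in 𝓝[≠] q, r ≠ p := by
      by_cases hqp : q = p
      · rw [hqp]; exact self_mem_nhdsWithin
      · exact Eventually.filter_mono nhdsWithin_le_nhds (isOpen_ne.mem_nhds hqp)
    refine ext_eq_of_tendsto ?_ (hq5.congr' ?_) ?_
    · filter_upwards [hq3.filter_mono nhdsWithin_le_nhds, hne] with r hr hr'
      exact hr hr'
    · filter_upwards [hq4.filter_mono nhdsWithin_le_nhds, hne] with r hr hr'
      exact (hr hr').symm
    · intro hqU
      by_cases hqp : q = p
      · rw [hqp]; exact hpU (hqp ▸ hqU)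
      · exact hq4.self_of_nhds hqp
  rw [eventually_nhds_iff] at main
  exact main.mono fun z hz => by rw [hz, coord_param]

theorem FinRep.ext_eq (h : FinRep F p φ) (hU : NearlyContains U p)
    (hpU : p ∈ U → F p = (φ (coord p p) : RSphere)) :
    ∀ᶠ z in 𝓝 (coord p p), ext U F (param p z) = (φ z : RSphere) :=
  ext_eventually_eq hU (h.1.eventually_continuousAt.mono fun _ hz =>
    OnePoint.continuous_coe.continuousAt.comp hz) h.2 hpU

theorem PoleRep.ext_eq (h : PoleRep F p φ) (hU : NearlyContains U p)
    (hpU : p ∈ U → F p = inf) :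
    ∀ᶠ z in 𝓝 (coord p p), ext U F (param p z) = recip (φ z : RSphere) :=
  ext_eventually_eq hU (h.1.eventually_continuousAt.mono fun _ hz =>
    (continuous_recip.comp OnePoint.continuous_coe).continuousAt.comp hz) h.2.2
    (by rw [h.2.1, recip_coe_zero]; exact hpU)

theorem FinRep.ext_self (h : FinRep F p φ) (hU : NearlyContains U p)
    (hpU : p ∈ U → F p = (φ (coord p p) : RSphere)) :
    ext U F p = (φ (coord p p) : RSphere) := by
  have := (h.ext_eq hU hpU).self_of_nhds
  rwa [param_coord_self] at this

theorem PoleRep.ext_self (h : PoleRep F p φ) (hU : NearlyContains U p)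
    (hpU : p ∈ U → F p = inf) : ext U F p = inf := by
  have := (h.ext_eq hU hpU).self_of_nhds
  rwa [param_coord_self, h.2.1, recip_coe_zero] at this

theorem FinRep.mem_dom (h : FinRep F p φ)
    (hpU : p ∈ U → F p = (φ (coord p p) : RSphere)) : p ∈ dom U F := by
  refine ⟨_, exists_isMeroAt_coe h.1, ?_⟩
  have h2 := eventually_nhdsWithin_iff.1 h.2
  rw [eventually_nhds_iff]
  filter_upwards [h2] with z hz hzU
  rw [coord_param]
  by_cases hza : z = coord p p
  · rw [hza, param_coord_self] at hzU
    rw [hza, param_coord_self, hpU hzU]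
  · exact (hz hza).symm

theorem PoleRep.mem_dom (h : PoleRep F p φ) (hpU : p ∈ U → F p = inf) : p ∈ dom U F := by
  refine ⟨_, exists_isMeroAt_recip h.1 h.2.1, ?_⟩
  have h2 := eventually_nhdsWithin_iff.1 h.2.2
  rw [eventually_nhds_iff]
  filter_upwards [h2] with z hz hzU
  rw [coord_param]
  by_cases hza : z = coord p p
  · rw [hza, param_coord_self] at hzU
    rw [hza, param_coord_self, hpU hzU, h.2.1, recip_coe_zero]
  · exact (hz hza).symm

theorem FinRep.mem_critPts_iff (h : FinRep F p φ) (hU : NearlyContains U p)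
    (hpU : p ∈ U → F p = (φ (coord p p) : RSphere)) :
    p ∈ critPts U F ↔ deriv φ (coord p p) = 0 := by
  have h1 : localRep (ext U F) p =ᶠ[𝓝 (coord p p)] φ := by
    filter_upwards [h.ext_eq hU hpU] with z hz
    rw [localRep, hz, h.ext_self hU hpU, coord_coe, toPlane_coe]
  rw [critPts, mem_ofPred_eq, h1.deriv_eq]
  exact and_iff_right (h.mem_dom hpU)

/-- The target chart at `∞` turns `1 / φ` back into `φ`, so multiple poles are the multiple zeros of
`φ`. -/
theorem PoleRep.mem_critPts_iff (h : PoleRep F p φ) (hU : NearlyContains U p)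
    (hpU : p ∈ U → F p = inf) : p ∈ critPts U F ↔ deriv φ (coord p p) = 0 := by
  have h1 : localRep (ext U F) p =ᶠ[𝓝 (coord p p)] φ := by
    filter_upwards [h.ext_eq hU hpU] with z hz
    simp only [localRep, hz, h.ext_self hU hpU, coord_inf, recip_recip, toPlane_coe]
  rw [critPts, mem_ofPred_eq, h1.deriv_eq]
  exact and_iff_right (h.mem_dom hpU)

/-- Chart changes are analytic. -/
theorem exists_transition (p : RSphere) (a : ℂ) :
    ∃ τ : ℂ → ℂ, AnalyticAt ℂ τ (coord (param p a) (param p a)) ∧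
      τ (coord (param p a) (param p a)) = a ∧
      ∀ᶠ w in 𝓝 (coord (param p a) (param p a)), param (param p a) w = param p (τ w) := by
  rcases eq_inf_or_coe p with rfl | ⟨b, rfl⟩
  · by_cases ha : a = 0
    · subst ha
      have h0 : param inf 0 = inf := by rw [param_inf]; exact recip_coe_zero
      rw [h0, coord_inf_self]
      exact ⟨id, analyticAt_id, rfl, Eventually.of_forall fun w => by rw [param_inf]; rfl⟩
    · have h0 : param inf a = ((a⁻¹ : ℂ) : RSphere) := by rw [param_inf]; exact recip_coe_of_ne ha
      rw [h0, coord_coe_self]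
      refine ⟨fun w => w⁻¹, analyticAt_inv (inv_ne_zero ha), inv_inv a, ?_⟩
      filter_upwards [isOpen_ne.mem_nhds (inv_ne_zero ha)] with w hw
      rw [param_coe, param_inf]
      dsimp only
      rw [recip_coe_of_ne (inv_ne_zero hw), inv_inv]
  · rw [param_coe, coord_coe_self]
    exact ⟨id, analyticAt_id, rfl, Eventually.of_forall fun w => by rw [param_coe]; rfl⟩

/-- The chart at `p = ∞` is not the one used at the finite points near `∞`; a transition map bridges
the two. -/
theorem isMeroAt_param_of_coe {a : ℂ} (ha : AnalyticAt ℂ φ a)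
    (h : ∀ᶠ z in 𝓝 a, F (param p z) = (φ z : RSphere)) : IsMeroAt F (param p a) := by
  obtain ⟨τ, hτ, hτa, hτp⟩ := exists_transition p a
  have hc : Tendsto τ (𝓝 (coord (param p a) (param p a))) (𝓝 a) := by
    have := hτ.continuousAt.tendsto
    rwa [hτa] at this
  refine isMeroAt_of_coe (φ := φ ∘ τ) (AnalyticAt.comp (by rwa [hτa]) hτ) ?_
  filter_upwards [hτp, hc.eventually h] with w hw hw2
  rw [hw, hw2, Function.comp_apply]

/-- Near a pole, the points with `φ a ≠ 0` have finite values and fall under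
`isMeroAt_param_of_coe`; only zeros of `φ` are poles. -/
theorem isMeroAt_param_of_recip {a : ℂ} (ha : AnalyticAt ℂ φ a)
    (h : ∀ᶠ z in 𝓝 a, F (param p z) = recip (φ z : RSphere)) : IsMeroAt F (param p a) := by
  by_cases h0 : φ a = 0
  · obtain ⟨τ, hτ, hτa, hτp⟩ := exists_transition p a
    have hc : Tendsto τ (𝓝 (coord (param p a) (param p a))) (𝓝 a) := by
      have := hτ.continuousAt.tendsto
      rwa [hτa] at this
    refine isMeroAt_of_recip (φ := φ ∘ τ) (AnalyticAt.comp (by rwa [hτa]) hτ) ?_ ?_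
    · rw [Function.comp_apply, hτa, h0]
    filter_upwards [hτp, hc.eventually h] with w hw hw2
    rw [hw, hw2, Function.comp_apply]
  · refine isMeroAt_param_of_coe (ha.inv h0) ?_
    filter_upwards [h, ha.continuousAt.eventually_ne h0] with z hz hz0
    rw [hz, recip_coe_of_ne hz0, Pi.inv_apply]

theorem IsMeroAt.eventually (h : IsMeroAt F p) : ∀ᶠ q in 𝓝 p, IsMeroAt F q := by
  obtain ⟨φ, ha, h⟩ := h.exists_rep
  rw [eventually_nhds_iff]
  rcases h with h | ⟨-, h⟩
  · filter_upwards [ha.eventually_analyticAt, eventually_eventually_nhds.2 h] with z hz hz2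
    exact isMeroAt_param_of_coe hz hz2
  · filter_upwards [ha.eventually_analyticAt, eventually_eventually_nhds.2 h] with z hz hz2
    exact isMeroAt_param_of_recip hz hz2

theorem isOpen_dom (U : Set RSphere) (F : RSphere → RSphere) : IsOpen (dom U F) := by
  rw [isOpen_iff_mem_nhds]
  rintro p ⟨G, hG, hGF⟩
  filter_upwards [hG.eventually, eventually_eventually_nhds.2 hGF] with q hq hq2
  exact ⟨G, hq, hq2⟩

/-- Asymptotic values only depend on the end of the path. -/
theorem mem_asympVals_of_path {v e : RSphere} {γ : ℝ → RSphere} {t₀ : ℝ} (ht₀ : t₀ < 1)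
    (hγ : ContinuousOn γ (Ico t₀ 1)) (hd : ∀ t ∈ Ico t₀ 1, γ t ∈ dom U F)
    (he : e ∈ ess U F) (hγe : Tendsto γ (𝓝[<] 1) (𝓝 e))
    (hv : Tendsto (fun t => ext U F (γ t)) (𝓝[<] 1) (𝓝 v)) : v ∈ asympVals U F := by
  set s : ℝ → ℝ := fun t => t₀ + (1 - t₀) * t with hs
  have hsI : ∀ t ∈ Ico (0 : ℝ) 1, s t ∈ Ico t₀ 1 := by
    rintro t ⟨h0, h1⟩
    constructor
    · have := mul_nonneg (sub_nonneg.2 ht₀.le) h0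
      simp only [hs]
      linarith
    · have := mul_lt_mul_of_pos_left h1 (sub_pos.2 ht₀)
      simp only [hs]
      linarith
  have hsc : Continuous s := by fun_prop
  have hst : Tendsto s (𝓝[<] 1) (𝓝[<] 1) := by
    refine tendsto_nhdsWithin_iff.2 ⟨?_, ?_⟩
    · have : s 1 = 1 := by simp [hs]
      have h2 := hsc.tendsto 1
      rw [this] at h2
      exact h2.mono_left nhdsWithin_le_nhds
    · filter_upwards [self_mem_nhdsWithin] with t ht
      have := mul_lt_mul_of_pos_left (mem_Iio.1 ht) (sub_pos.2 ht₀)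
      simp only [hs, mem_Iio]
      linarith
  exact ⟨γ ∘ s, hγ.comp hsc.continuousOn hsI, fun t ht => hd _ (hsI t ht), ⟨e, he, hγe.comp hst⟩,
    hv.comp hst⟩

end RSphere

/-! ### Paths through a nested sequence of connected open sets -/

/-- Infinite concatenation of paths. -/
theorem exists_concat_path {X : Type*} [TopologicalSpace X] {W : ℕ → Set X} (x : ℕ → X)
    (h : ∀ n, JoinedIn (W n) (x n) (x (n + 1))) :
    ∃ γ : ℝ → X, ContinuousOn γ (Ici 0) ∧ ∀ (n : ℕ) (t : ℝ), t ∈ Ico (n : ℝ) (n + 1) → γ t ∈ W n := by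
  choose p hp using h
  set q : ℕ → ℝ → X := fun n => (p n).extend with hq
  have hq0 : ∀ n, q n 0 = x n := fun n => (p n).extend_zero
  have hq1 : ∀ n, q n 1 = x (n + 1) := fun n => (p n).extend_one
  set γ : ℝ → X := fun t => q ⌊t⌋₊ (t - ⌊t⌋₊) with hγ
  -- The interval is closed: at its right end the floor jumps to `n + 1`, but both formulas give `x
  -- (n + 1)` there. Continuity then follows by gluing along a locally finite closed cover.
  have h1 : ∀ n : ℕ, EqOn γ (fun t => q n (t - n)) (Icc (n : ℝ) (n + 1)) := by
    rintro n t ⟨ht1, ht2⟩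
    rcases ht2.lt_or_eq with ht | ht
    · have : ⌊t⌋₊ = n := (Nat.floor_eq_iff ((Nat.cast_nonneg n).trans ht1)).2 ⟨ht1, ht⟩
      simp only [hγ, this]
    · have : ⌊t⌋₊ = n + 1 := by
        rw [ht]
        exact_mod_cast Nat.floor_natCast (R := ℝ) (n + 1)
      simp only [hγ, this]
      rw [ht]
      push_cast
      rw [sub_self, add_sub_cancel_left, hq0, hq1]
  refine ⟨γ, ?_, ?_⟩
  · have hlf : LocallyFinite fun n : ℕ => Icc (n : ℝ) (n + 1) := by
      intro t
      refine ⟨Iio (t + 1), Iio_mem_nhds (by linarith), ?_⟩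
      refine (Set.finite_Iic ⌈t + 1⌉₊).subset ?_
      rintro n ⟨s, ⟨hs1, -⟩, hs2⟩
      have h3 : (n : ℝ) ≤ ⌈t + 1⌉₊ := (hs1.trans hs2.le).trans (Nat.le_ceil _)
      exact_mod_cast h3
    have hc := hlf.continuousOn_iUnion (g := γ) (fun n => isClosed_Icc) (fun n => by
      refine ContinuousOn.congr (f := fun t => q n (t - n)) ?_ (h1 n)
      exact ((p n).continuous_extend.comp (continuous_id.sub continuous_const)).continuousOn)
    refine hc.mono fun t ht => ?_
    exact mem_iUnion.2 ⟨⌊t⌋₊, Nat.floor_le ht, (Nat.lt_floor_add_one t).le⟩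
  · intro n t ht
    rw [h1 n ⟨ht.1, ht.2.le⟩]
    simp only [hq]
    have : t - n ∈ Icc (0 : ℝ) 1 := ⟨by linarith [ht.1], by linarith [ht.2]⟩
    rw [Path.extend_apply _ this]
    exact hp n _

/-- Such a path, reparametrized by `[0, 1)`. -/
theorem exists_concat_path_Ico {X : Type*} [TopologicalSpace X] {W : ℕ → Set X}
    (hW : Antitone W) (x : ℕ → X) (h : ∀ n, JoinedIn (W n) (x n) (x (n + 1))) :
    ∃ γ : ℝ → X, ContinuousOn γ (Ico 0 1) ∧ (∀ t ∈ Ico (0 : ℝ) 1, γ t ∈ W 0) ∧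
      ∀ n, ∀ᶠ t in 𝓝[<] (1 : ℝ), γ t ∈ W n := by
  obtain ⟨γ, hγ, hγW⟩ := exists_concat_path x h
  -- This maps `[0, 1)` onto `[0, ∞)` and sends `n / (n + 1)` to `n`.
  set s : ℝ → ℝ := fun t => t / (1 - t) with hs
  have hs0 : ∀ t ∈ Ico (0 : ℝ) 1, 0 ≤ s t := fun t ht =>
    div_nonneg ht.1 (sub_nonneg.2 ht.2.le)
  have hmem : ∀ t : ℝ, 0 ≤ t → γ t ∈ W ⌊t⌋₊ := fun t ht =>
    hγW _ _ ⟨Nat.floor_le ht, Nat.lt_floor_add_one t⟩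
  refine ⟨γ ∘ s, hγ.comp ?_ hs0, fun t ht => hW (Nat.zero_le _) (hmem _ (hs0 t ht)), fun n => ?_⟩
  · refine continuousOn_id.div (continuousOn_const.sub continuousOn_id) fun t ht => ?_
    exact (sub_pos.2 ht.2).ne'
  · have hn : (n : ℝ) / (n + 1) < 1 := by
      rw [div_lt_one (by positivity)]
      linarith
    have hn0 : (0 : ℝ) ≤ n / (n + 1) := by positivity
    filter_upwards [Ioo_mem_nhdsLT hn] with t ht
    have h2 : (n : ℝ) ≤ s t := by
      simp only [hs]
      rw [le_div_iff₀ (sub_pos.2 ht.2)]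
      have := ht.1
      rw [div_lt_iff₀ (by positivity)] at this
      linarith
    exact hW (Nat.le_floor h2) (hmem _ (hs0 t ⟨hn0.trans ht.1.le, ht.2⟩))

/-! ### Asymptotic paths at an isolated singularity -/

section Iversen

variable {h : ℂ → ℂ} {a : ℂ} {ρ : ℝ}

/-- On a component of `{|h| > M}` near an isolated singularity, `h` is unbounded. -/
theorem exists_norm_gt_of_component (hd : ∀ z, z ≠ a → ‖z - a‖ ≤ ρ → AnalyticAt ℂ h z) {M : ℝ}
    (hM0 : 0 < M) (hM : ∀ z, ‖z - a‖ = ρ → ‖h z‖ ≤ M) {z₀ : ℂ}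
    (hz₀ : z₀ ∈ {z | z ≠ a ∧ ‖z - a‖ < ρ ∧ M < ‖h z‖}) (K : ℝ) :
    ∃ z ∈ connectedComponentIn {z | z ≠ a ∧ ‖z - a‖ < ρ ∧ M < ‖h z‖} z₀, K < ‖h z‖ := by
  set W := {z | z ≠ a ∧ ‖z - a‖ < ρ ∧ M < ‖h z‖} with hW
  set D := connectedComponentIn W z₀ with hD
  by_contra! hcon
  have hWo : IsOpen W := by
    rw [isOpen_iff_mem_nhds]
    rintro z ⟨h1, h2, h3⟩
    filter_upwards [isOpen_ne.mem_nhds h1,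
      (continuous_id.sub continuous_const).norm.continuousAt.eventually_lt
        (continuousAt_const (y := ρ)) h2,
      (continuousAt_const (y := M)).eventually_lt (hd z h1 h2.le).continuousAt.norm h3]
      with w hw1 hw2 hw3
    exact ⟨hw1, hw2, hw3⟩
  have hDo : IsOpen D := hWo.connectedComponentIn
  have hDW : D ⊆ W := connectedComponentIn_subset _ _
  have hz₀D : z₀ ∈ D := mem_connectedComponentIn hz₀
  have hρ : 0 ≤ ρ := (norm_nonneg _).trans hz₀.2.1.le
  have hDb : D ⊆ Metric.closedBall a ρ := fun z hz => by
    rw [Metric.mem_closedBall, dist_eq_norm]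
    exact (hDW hz).2.1.le
  have hclb : closure D ⊆ Metric.closedBall a ρ :=
    closure_minimal hDb Metric.isClosed_closedBall
  have hclne : ∀ z ∈ closure D, ‖z - a‖ ≤ ρ := fun z hz => by
    have := hclb hz
    rwa [Metric.mem_closedBall, dist_eq_norm] at this
  have hclK : ∀ z ∈ closure D, z ≠ a → ‖h z‖ ≤ K := by
    intro z hz hza
    have hc := (hd z hza (hclne z hz)).continuousAt.norm.continuousWithinAt (s := D)
    have : (𝓝[D] z).NeBot := mem_closure_iff_nhdsWithin_neBot.1 hz
    exact le_of_tendsto hc (eventually_nhdsWithin_of_forall hcon)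
  have hfr : ∀ z ∈ frontier D, z ≠ a → ‖h z‖ ≤ M := by
    intro z hz hza
    have hzc := frontier_subset_closure hz
    rcases (hclne z hzc).lt_or_eq with hlt | heq
    · by_contra! hlt2
      have hzW : z ∈ W := ⟨hza, hlt, hlt2⟩
      have hzD : z ∈ D := by
        -- A boundary point lying in `W` could be added to the component, which is open and so
        -- contains none of its boundary points.
        have h1 : IsPreconnected (insert z D) :=
          (isPreconnected_connectedComponentIn).subset_closure (subset_insert z D)
            (insert_subset hzc subset_closure)
        exact h1.subset_connectedComponentIn (mem_insert_of_mem z hz₀D)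
          (insert_subset hzW hDW) (mem_insert z D)
      rw [hDo.frontier_eq] at hz
      exact hz.2 hzD
    · exact hM z heq
  -- Maximum principle for `h ^ n * (z - a)`: the factor `z - a` makes the function continuous with
  -- value `0` at `a`, where `h` is only known to be bounded. Letting `n → ∞` removes this factor
  -- and contradicts `M < ‖h z₀‖`.
  have key : ∀ n : ℕ, ‖h z₀‖ ^ n * ‖z₀ - a‖ ≤ M ^ n * ρ := by
    intro n
    set k : ℂ → ℂ := fun z => h z ^ n * (z - a) with hk
    have hkd : DiffContOnCl ℂ k D := by
      refine ⟨fun z hz => ?_, fun z hz => ?_⟩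
      · have := (hd z (hDW hz).1 (hDW hz).2.1.le).differentiableAt
        exact ((this.pow n).mul (differentiableAt_id.sub_const a)).differentiableWithinAt
      · by_cases hza : z = a
        · subst hza
          have hk0 : k z = 0 := by simp [hk]
          rw [ContinuousWithinAt, hk0]
          have hb : Tendsto (fun w : ℂ => |K| ^ n * ‖w - z‖) (𝓝[closure D] z) (𝓝 0) := by
            have : Continuous fun w : ℂ => |K| ^ n * ‖w - z‖ := by fun_prop
            have h2 := this.tendsto z
            simp only [sub_self, norm_zero, mul_zero] at h2
            exact h2.mono_left nhdsWithin_le_nhds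
          refine squeeze_zero_norm' ?_ hb
          filter_upwards [self_mem_nhdsWithin] with w hw
          by_cases hwz : w = z
          · simp [hk, hwz]
          · rw [hk, norm_mul, norm_pow]
            gcongr
            exact (hclK w hw hwz).trans (le_abs_self K)
        · have := (hd z hza (hclne z hz)).continuousAt
          exact ((this.pow n).mul (continuousAt_id.sub continuousAt_const)).continuousWithinAt
    have hle := Complex.norm_le_of_forall_mem_frontier_norm_le
      (Metric.isBounded_closedBall.subset hDb) hkd (C := M ^ n * ρ) (fun z hz => ?_)
      (subset_closure hz₀D)
    · rwa [hk, norm_mul, norm_pow] at hle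
    · rw [hk, norm_mul, norm_pow]
      by_cases hza : z = a
      · subst hza
        simp only [sub_self, norm_zero, mul_zero]
        positivity
      · have h1 := hfr z hz hza
        have h2 := hclne z (frontier_subset_closure hz)
        gcongr
  have hpos : 0 < ‖z₀ - a‖ := norm_pos_iff.2 (sub_ne_zero.2 hz₀.1)
  have hr : 1 < ‖h z₀‖ / M := (one_lt_div hM0).2 hz₀.2.2
  obtain ⟨n, hn⟩ := (tendsto_pow_atTop_atTop_of_one_lt hr).eventually_gt_atTop (ρ / ‖z₀ - a‖) |>.exists
  rw [div_pow, div_lt_div_iff₀ hpos (by positivity)] at hn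
  linarith [key n]

/-- A holomorphic function that is unbounded near an isolated singularity tends to `∞` along some
path to the singularity. -/
theorem exists_path_tendsto_of_unbounded (hρ : 0 < ρ)
    (hd : ∀ z, z ≠ a → ‖z - a‖ ≤ ρ → AnalyticAt ℂ h z)
    (hu : ∀ M, ∃ z, z ≠ a ∧ ‖z - a‖ < ρ ∧ M < ‖h z‖) :
    ∃ γ : ℝ → ℂ, ContinuousOn γ (Ico 0 1) ∧ (∀ t ∈ Ico (0 : ℝ) 1, γ t ≠ a ∧ ‖γ t - a‖ < ρ) ∧
      Tendsto γ (𝓝[<] 1) (𝓝 a) ∧ Tendsto (fun t => ‖h (γ t)‖) (𝓝[<] 1) atTop := by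
  have hbdd : ∀ ε > 0, ∃ M, ∀ z, ε ≤ ‖z - a‖ → ‖z - a‖ ≤ ρ → ‖h z‖ ≤ M := by
    intro ε hε
    have hK : IsCompact (Metric.closedBall a ρ \ Metric.ball a ε) :=
      (isCompact_closedBall a ρ).diff Metric.isOpen_ball
    have hc : ContinuousOn h (Metric.closedBall a ρ \ Metric.ball a ε) := by
      rintro z ⟨h1, h2⟩
      rw [Metric.mem_closedBall, dist_eq_norm] at h1
      refine (hd z ?_ h1).continuousAt.continuousWithinAt
      rintro rfl
      exact h2 (Metric.mem_ball_self hε)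
    obtain ⟨M, hM⟩ := hK.exists_bound_of_continuousOn hc
    refine ⟨M, fun z h1 h2 => hM z ⟨?_, ?_⟩⟩
    · rwa [Metric.mem_closedBall, dist_eq_norm]
    · rw [Metric.mem_ball, dist_eq_norm]
      exact not_lt.2 h1
  obtain ⟨M₁, hM₁⟩ := hbdd ρ hρ
  -- All levels exceed the bound of `h` on the outer circle, as the component argument requires, and
  -- they tend to infinity.
  set M : ℕ → ℝ := fun n => max M₁ 1 + n with hM
  set W : ℕ → Set ℂ := fun n => {z | z ≠ a ∧ ‖z - a‖ < ρ ∧ M n < ‖h z‖} with hWdef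
  have hMpos : ∀ n, 0 < M n := fun n => by
    have : (1 : ℝ) ≤ max M₁ 1 := le_max_right _ _
    simp only [hM]
    positivity
  have hMcirc : ∀ n z, ‖z - a‖ = ρ → ‖h z‖ ≤ M n := fun n z hz => by
    have h1 := hM₁ z hz.ge hz.le
    have h2 : M₁ ≤ max M₁ 1 := le_max_left _ _
    simp only [hM]
    have : (0 : ℝ) ≤ n := Nat.cast_nonneg n
    linarith
  have hMmono : Monotone M := fun m n hmn => by
    simp only [hM]
    have : (m : ℝ) ≤ n := by exact_mod_cast hmn
    linarith
  have hWanti : Antitone W := fun m n hmn z hz => ⟨hz.1, hz.2.1, (hMmono hmn).trans_lt hz.2.2⟩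
  have hWo : ∀ n, IsOpen (W n) := fun n => by
    rw [isOpen_iff_mem_nhds]
    rintro z ⟨h1, h2, h3⟩
    filter_upwards [isOpen_ne.mem_nhds h1,
      (continuous_id.sub continuous_const).norm.continuousAt.eventually_lt
        (continuousAt_const (y := ρ)) h2,
      (continuousAt_const (y := M n)).eventually_lt (hd z h1 h2.le).continuousAt.norm h3]
      with w hw1 hw2 hw3
    exact ⟨hw1, hw2, hw3⟩
  have step : ∀ n (z : ℂ), z ∈ W n → ∃ z' ∈ W (n + 1), JoinedIn (W n) z z' := by
    intro n z hz
    obtain ⟨z', hz', hlt⟩ := exists_norm_gt_of_component hd (hMpos n) (hMcirc n) hz (M (n + 1))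
    have hzW : z' ∈ W n := connectedComponentIn_subset _ _ hz'
    refine ⟨z', ⟨hzW.1, hzW.2.1, hlt⟩, ?_⟩
    have hconn : IsConnected (connectedComponentIn (W n) z) :=
      isConnected_connectedComponentIn_iff.2 hz
    have hpath := ((hWo n).connectedComponentIn.isConnected_iff_isPathConnected).1 hconn
    exact (hpath.joinedIn z (mem_connectedComponentIn hz) z' hz').mono
      (connectedComponentIn_subset _ _)
  obtain ⟨z₀, hz₀⟩ := hu (M 0)
  choose! nxt hnxt1 hnxt2 using step
  let x : (n : ℕ) → ℂ := fun n => Nat.rec z₀ (fun k z => nxt k z) n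
  have hx : ∀ n, x n ∈ W n := by
    intro n
    induction n with
    | zero => exact hz₀
    | succ k ih => exact hnxt1 k _ ih
  obtain ⟨γ, hγc, hγ0, hγn⟩ := exists_concat_path_Ico hWanti x fun n => hnxt2 n _ (hx n)
  have hlim : Tendsto (fun t => ‖h (γ t)‖) (𝓝[<] 1) atTop := by
    refine tendsto_atTop.2 fun b => ?_
    obtain ⟨n, hn⟩ := exists_nat_ge b
    filter_upwards [hγn n] with t ht
    have h1 := ht.2.2
    have h2 : (1 : ℝ) ≤ max M₁ 1 := le_max_right _ _
    simp only [hM] at h1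
    linarith
  refine ⟨γ, hγc, fun t ht => ⟨(hγ0 t ht).1, (hγ0 t ht).2.1⟩, ?_, hlim⟩
  -- Away from `a` the function is bounded on compact annuli, so the growth of `‖h‖` pushes the path
  -- into `a`.
  rw [Metric.tendsto_nhds]
  intro ε hε
  obtain ⟨K, hK⟩ := hbdd ε hε
  filter_upwards [hγn 0, hlim.eventually_gt_atTop K] with t ht1 ht2
  rw [dist_eq_norm]
  by_contra! hle
  exact absurd (hK _ hle ht1.2.1.le) (not_le.2 ht2)

end Iversen

/-! ### Extending a logarithm of a meromorphic function -/

/-- The punctured disc is the image of a half-plane under `ζ ↦ a + exp ζ`. -/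
theorem isPreconnected_punctured_ball (a : ℂ) {r : ℝ} (hr : 0 < r) :
    IsPreconnected {z : ℂ | z ≠ a ∧ ‖z - a‖ < r} := by
  have h1 : IsPreconnected {ζ : ℂ | ζ.re < Real.log r} := (convex_halfSpace_re_lt _).isPreconnected
  have h2 := h1.image (fun ζ => a + Complex.exp ζ) (by fun_prop)
  convert h2 using 1
  ext z
  constructor
  · rintro ⟨hz, hzr⟩
    have hne : z - a ≠ 0 := sub_ne_zero.2 hz
    refine ⟨Complex.log (z - a), ?_, ?_⟩
    · change (Complex.log (z - a)).re < Real.log r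
      rw [Complex.log_re]
      exact Real.log_lt_log (norm_pos_iff.2 hne) hzr
    · change a + Complex.exp (Complex.log (z - a)) = z
      rw [Complex.exp_log hne]
      ring
  · rintro ⟨ζ, hζ, rfl⟩
    refine ⟨?_, ?_⟩
    · simp [Complex.exp_ne_zero]
    · change ζ.re < Real.log r at hζ
      rw [add_sub_cancel_left, Complex.norm_exp]
      rwa [Real.lt_log_iff_exp_lt hr] at hζ

theorem AnalyticAt.exists_log {u : ℂ → ℂ} {a : ℂ} (hu : AnalyticAt ℂ u a) (h0 : u a ≠ 0) :
    ∃ v : ℂ → ℂ, AnalyticAt ℂ v a ∧ ∀ᶠ z in 𝓝 a, Complex.exp (v z) = u z := by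
  -- Normalizing the value at `a` to `1` keeps the principal logarithm away from its cut.
  refine ⟨fun z => Complex.log (u z / u a) + Complex.log (u a), ?_, ?_⟩
  · refine AnalyticAt.add (AnalyticAt.clog (hu.div analyticAt_const h0) ?_) analyticAt_const
    rw [div_self h0]
    exact Complex.one_mem_slitPlane
  · filter_upwards [hu.continuousAt.eventually_ne h0] with z hz
    rw [Complex.exp_add, Complex.exp_log (div_ne_zero hz h0), Complex.exp_log h0,
      div_mul_cancel₀ _ h0]

/-- If `exp φ` is meromorphic at an isolated singularity of `φ`, the singularity is removable. -/
theorem exists_analyticAt_of_meromorphicAt_exp {φ : ℂ → ℂ} {a : ℂ}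
    (hφ : ∀ᶠ z in 𝓝[≠] a, AnalyticAt ℂ φ z)
    (hm : MeromorphicAt (fun z => Complex.exp (φ z)) a) :
    ∃ ψ : ℂ → ℂ, AnalyticAt ℂ ψ a ∧ ∀ᶠ z in 𝓝[≠] a, φ z = ψ z := by
  have hne : meromorphicOrderAt (fun z => Complex.exp (φ z)) a ≠ ⊤ := by
    rw [Ne, meromorphicOrderAt_eq_top_iff]
    intro h
    obtain ⟨z, hz⟩ := h.exists
    exact Complex.exp_ne_zero _ hz
  obtain ⟨u, hu, hu0, heq⟩ := (meromorphicOrderAt_ne_top_iff hm).1 hne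
  set k : ℤ := (meromorphicOrderAt (fun z => Complex.exp (φ z)) a).untop₀ with hk
  obtain ⟨v, hv, hvu⟩ := hu.exists_log hu0
  have hall : ∀ᶠ z in 𝓝[≠] a, AnalyticAt ℂ φ z ∧ AnalyticAt ℂ v z ∧
      Complex.exp (φ z - v z) = (z - a) ^ k := by
    filter_upwards [hφ, hv.eventually_analyticAt.filter_mono nhdsWithin_le_nhds,
      hvu.filter_mono nhdsWithin_le_nhds, heq] with z h1 h2 h3 h4
    refine ⟨h1, h2, ?_⟩
    rw [Complex.exp_sub, h4, h3, smul_eq_mul, mul_div_assoc, div_self, mul_one]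
    rw [← h3]
    exact Complex.exp_ne_zero _
  obtain ⟨r, hr, hball⟩ := Metric.mem_nhdsWithin_iff.1 hall
  have hB : ∀ z, z ≠ a → ‖z - a‖ < r → AnalyticAt ℂ φ z ∧ AnalyticAt ℂ v z ∧
      Complex.exp (φ z - v z) = (z - a) ^ k := fun z hza hz =>
    hball ⟨by rwa [Metric.mem_ball, dist_eq_norm], hza⟩
  have hopen : IsOpen {z : ℂ | z ≠ a ∧ ‖z - a‖ < r} :=
    isOpen_ne.inter (isOpen_lt (continuous_id.sub continuous_const).norm continuous_const)
  -- Logarithmic differentiation of `exp (φ - v) = (z - a) ^ k`.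
  have hder : ∀ z, z ≠ a → ‖z - a‖ < r →
      HasDerivAt (fun z => φ z - v z) (k * (z - a)⁻¹) z := by
    intro z hza hz
    obtain ⟨h1, h2, h3⟩ := hB z hza hz
    have hd : HasDerivAt (fun z => φ z - v z) (deriv φ z - deriv v z) z :=
      h1.differentiableAt.hasDerivAt.sub h2.differentiableAt.hasDerivAt
    have hd2 := hd.cexp
    have hza' : z - a ≠ 0 := sub_ne_zero.2 hza
    have hd3 : HasDerivAt (fun z => (z - a) ^ k) (k * (z - a) ^ (k - 1) * 1) z :=
      ((hasDerivAt_zpow k (z - a) (Or.inl hza')).comp_sub_const z a).congr_deriv (mul_one _).symm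
    have hev : (fun z => Complex.exp (φ z - v z)) =ᶠ[𝓝 z] fun z => (z - a) ^ k := by
      filter_upwards [hopen.mem_nhds ⟨hza, hz⟩] with w hw
      exact (hB w hw.1 hw.2).2.2
    have hd4 := (hd3.congr_of_eventuallyEq hev).unique hd2
    rw [h3, zpow_sub_one₀ hza'] at hd4
    have h5 : (z - a) ^ k ≠ 0 := zpow_ne_zero _ hza'
    have h6 : deriv φ z - deriv v z = k * (z - a)⁻¹ := by
      apply mul_left_cancel₀ h5
      rw [← hd4]
      ring
    rwa [h6] at hd
  -- The derivative `k / (z - a)` has a primitive on the punctured disc, so its integral `2πik`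
  -- around a circle vanishes. Thus `φ - v` is constant.
  have hk0 : (k : ℂ) = 0 := by
    have h1 := circleIntegral.integral_eq_zero_of_hasDerivWithinAt (c := a) (R := r / 2)
      (f := fun z => φ z - v z) (f' := fun z => k * (z - a)⁻¹) (by positivity) (fun z hz => by
        rw [mem_sphere_iff_norm] at hz
        refine (hder z ?_ (by linarith)).hasDerivWithinAt
        rintro rfl
        simp at hz
        linarith)
    rw [circleIntegral.integral_const_mul, circleIntegral.integral_sub_center_inv _ (by positivity)] at h1
    have := Complex.two_pi_I_ne_zero
    exact (mul_eq_zero.1 h1).resolve_right this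
  have hconst : ∃ c : ℂ, ∀ z, z ≠ a → ‖z - a‖ < r → φ z - v z = c := by
    have hpre := isPreconnected_punctured_ball a hr
    obtain ⟨c, hc⟩ := hopen.exists_is_const_of_deriv_eq_zero (f := fun z => φ z - v z) hpre
      (fun z hz => (hder z hz.1 hz.2).differentiableAt.differentiableWithinAt)
      (fun z hz => by
        rw [(hder z hz.1 hz.2).deriv, hk0, zero_mul]
        rfl)
    exact ⟨c, fun z h1 h2 => hc z ⟨h1, h2⟩⟩
  obtain ⟨c, hc⟩ := hconst
  refine ⟨fun z => v z + c, hv.add analyticAt_const, ?_⟩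
  have : {z : ℂ | ‖z - a‖ < r} ∈ 𝓝 a :=
    (isOpen_lt (continuous_id.sub continuous_const).norm continuous_const).mem_nhds (by simpa using hr)
  filter_upwards [self_mem_nhdsWithin, mem_nhdsWithin_of_mem_nhds this] with z h1 h2
  rw [← hc z h1 h2]
  ring

/-! ### Ends of paths -/

theorem eventually_notMem_of_not_mapClusterPt {ι X : Type*} [TopologicalSpace X] {l : Filter ι}
    {w : ι → X} {K : Set X} (hK : IsCompact K) (h : ∀ x ∈ K, ¬ MapClusterPt x l w) :
    ∀ᶠ t in l, w t ∉ K := by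
  by_contra hcon
  have hf : ∃ᶠ t in l, w t ∈ K := fun h' => hcon h'
  obtain ⟨x, hx, hxc⟩ := hK.exists_mapClusterPt_of_frequently hf
  exact h x hx hxc

/-- Intermediate value theorem: a continuous function that avoids `ε` on a final interval stays on
one side of it. -/
theorem eventually_lt_or_eventually_gt {d : ℝ → ℝ} {t₀ : ℝ} (ht₀ : t₀ < 1)
    (hd : ContinuousOn d (Ioo t₀ 1)) {ε : ℝ} (hε : ∀ᶠ t in 𝓝[<] (1 : ℝ), d t ≠ ε) :
    (∀ᶠ t in 𝓝[<] (1 : ℝ), d t < ε) ∨ ∀ᶠ t in 𝓝[<] (1 : ℝ), ε < d t := by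
  obtain ⟨t₁, ht₁, hsub⟩ := (mem_nhdsLT_iff_exists_Ioo_subset' (a := (1 : ℝ)) ht₀).1 hε
  set t₂ := max t₀ t₁
  have ht₂ : t₂ < 1 := max_lt ht₀ ht₁
  have hc : ContinuousOn d (Ioo t₂ 1) := hd.mono (Ioo_subset_Ioo_left (le_max_left _ _))
  have hne : ∀ t ∈ Ioo t₂ 1, d t ≠ ε := fun t ht =>
    hsub ⟨(le_max_right _ _).trans_lt ht.1, ht.2⟩
  have hpre : IsPreconnected (d '' Ioo t₂ 1) := isPreconnected_Ioo.image d hc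
  have hmem : Ioo t₂ 1 ∈ 𝓝[<] (1 : ℝ) := Ioo_mem_nhdsLT ht₂
  by_cases h : ∃ s ∈ Ioo t₂ 1, d s < ε
  · left
    obtain ⟨s, hs, hsε⟩ := h
    filter_upwards [hmem] with t ht
    by_contra! hle
    obtain ⟨x, hx, hxe⟩ := hpre.ordConnected.out (mem_image_of_mem d hs) (mem_image_of_mem d ht)
      ⟨hsε.le, hle⟩
    exact hne x hx hxe
  · right
    push Not at h
    filter_upwards [hmem] with t ht
    exact lt_of_le_of_ne (h t ht) (hne t ht).symm

/-- A path in the punctured plane whose cluster points are isolated from each other converges, or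
tends to `0` or to `∞`. -/
theorem tendsto_of_isolated_clusterPts {w : ℝ → ℂ} {t₀ : ℝ} (ht₀ : t₀ < 1)
    (hw : ContinuousOn w (Ioo t₀ 1))
    (h : ∀ w₀ : ℂ, w₀ ≠ 0 → MapClusterPt w₀ (𝓝[<] 1) w →
      ∀ᶠ w' in 𝓝[≠] w₀, ¬ MapClusterPt w' (𝓝[<] 1) w) :
    (∃ w₀, Tendsto w (𝓝[<] 1) (𝓝 w₀)) ∨ Tendsto (fun t => ‖w t‖) (𝓝[<] 1) atTop := by
  by_cases hex : ∃ w₀ : ℂ, w₀ ≠ 0 ∧ MapClusterPt w₀ (𝓝[<] 1) w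
  · left
    obtain ⟨w₀, hw₀, hcl⟩ := hex
    refine ⟨w₀, ?_⟩
    obtain ⟨ρ, hρ, hρs⟩ := Metric.mem_nhdsWithin_iff.1 (h w₀ hw₀ hcl)
    rw [Metric.tendsto_nhds]
    intro ε₀ hε₀
    obtain ⟨ε, hε, hεlt⟩ := exists_between (lt_min hε₀ hρ)
    -- Small circles about `w₀` carry no cluster points, so the path finally stays inside or
    -- outside; the cluster point `w₀` excludes the outside.
    have hsph : ∀ᶠ t in 𝓝[<] (1 : ℝ), w t ∉ Metric.sphere w₀ ε := by
      refine eventually_notMem_of_not_mapClusterPt (isCompact_sphere w₀ ε) fun x hx => ?_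
      rw [Metric.mem_sphere] at hx
      refine hρs ⟨?_, ?_⟩
      · rw [Metric.mem_ball, hx]
        exact hεlt.trans_le (min_le_right _ _)
      · rintro rfl
        rw [dist_self] at hx
        exact hε.ne hx
    have hd : ContinuousOn (fun t => dist (w t) w₀) (Ioo t₀ 1) := by
      simp only [dist_eq_norm]
      exact (hw.sub continuousOn_const).norm
    rcases eventually_lt_or_eventually_gt ht₀ hd hsph with hlt | hgt
    · exact hlt.mono fun t ht => ht.trans (hεlt.trans_le (min_le_left _ _))
    · have hfr := hcl.frequently (Metric.ball_mem_nhds w₀ hε)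
      obtain ⟨t, ht1, ht2⟩ := (hfr.and_eventually hgt).exists
      exact absurd ht1 (not_lt.2 ht2.le)
  · push Not at hex
    -- Without nonzero cluster points the path finally leaves every compact annulus; its side of the
    -- unit circle decides between `0` and `∞`.
    have hann : ∀ r > 0, ∀ R, ∀ᶠ t in 𝓝[<] (1 : ℝ),
        w t ∉ Metric.closedBall (0 : ℂ) R \ Metric.ball 0 r := by
      intro r hr R
      refine eventually_notMem_of_not_mapClusterPt
        ((isCompact_closedBall 0 R).diff Metric.isOpen_ball) fun x hx => hex x ?_
      rintro rfl
      exact hx.2 (Metric.mem_ball_self hr)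
    have h1 : ∀ᶠ t in 𝓝[<] (1 : ℝ), ‖w t‖ ≠ 1 := by
      filter_upwards [hann 1 one_pos 1] with t ht h1
      exact ht ⟨by simp [h1], by simp [h1]⟩
    rcases eventually_lt_or_eventually_gt ht₀ hw.norm h1 with hlt | hgt
    · left
      refine ⟨0, ?_⟩
      rw [Metric.tendsto_nhds]
      intro ε hε
      filter_upwards [hlt, hann ε hε 1] with t ht1 ht2
      by_contra! hle
      exact ht2 ⟨by simpa using ht1.le, by simpa using hle⟩
    · right
      refine tendsto_atTop.2 fun b => ?_
      filter_upwards [hgt, hann 1 one_pos b] with t ht1 ht2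
      by_contra! hle
      exact ht2 ⟨by simpa using hle.le, by simpa using ht1.le⟩

namespace RSphere

/-! ### The exponential of period one -/

theorem exp₁_add (z w : ℂ) : exp₁ (z + w) = exp₁ z * exp₁ w := by
  rw [exp₁, exp₁, exp₁, ← Complex.exp_add]
  ring_nf

theorem exp₁_neg (z : ℂ) : exp₁ (-z) = (exp₁ z)⁻¹ := by
  rw [exp₁, exp₁, ← Complex.exp_neg]
  ring_nf

theorem exp₁_ne_zero (z : ℂ) : exp₁ z ≠ 0 := Complex.exp_ne_zero _

theorem exp₁_int_mul (n : ℤ) (z : ℂ) : exp₁ (n * z) = exp₁ z ^ n := by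
  rw [exp₁, exp₁, ← Complex.exp_int_mul]
  ring_nf

theorem exp₁_eq_iff {z w : ℂ} : exp₁ z = exp₁ w ↔ ∃ n : ℤ, z = w + n := by
  rw [exp₁, exp₁, Complex.exp_eq_exp_iff_exists_int]
  refine exists_congr fun n => ?_
  have h : (2 * Real.pi * Complex.I : ℂ) ≠ 0 := Complex.two_pi_I_ne_zero
  constructor
  · intro h1
    apply mul_left_cancel₀ h
    rw [h1]
    ring
  · intro h1
    rw [h1]
    ring

theorem exp₁_add_int (z : ℂ) (n : ℤ) : exp₁ (z + n) = exp₁ z := exp₁_eq_iff.2 ⟨n, rfl⟩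

theorem exp₁_add_one (z : ℂ) : exp₁ (z + 1) = exp₁ z := by
  have := exp₁_add_int z 1
  rwa [Int.cast_one] at this

theorem continuous_exp₁ : Continuous exp₁ := by
  unfold exp₁
  fun_prop

theorem hasDerivAt_exp₁ (z : ℂ) : HasDerivAt exp₁ (2 * Real.pi * Complex.I * exp₁ z) z := by
  have h1 : HasDerivAt (fun z : ℂ => 2 * Real.pi * Complex.I * z) (2 * Real.pi * Complex.I) z := by
    simpa using (hasDerivAt_id z).const_mul (2 * Real.pi * Complex.I : ℂ)
  exact h1.cexp.congr_deriv (mul_comm _ _)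

theorem analyticAt_exp₁ (z : ℂ) : AnalyticAt ℂ exp₁ z := by
  unfold exp₁
  fun_prop

theorem norm_exp₁ (z : ℂ) : ‖exp₁ z‖ = Real.exp (-(2 * Real.pi * z.im)) := by
  rw [exp₁, Complex.norm_exp]
  congr 1
  simp

theorem exists_exp₁_eq {w : ℂ} (hw : w ≠ 0) : ∃ z, exp₁ z = w := by
  refine ⟨Complex.log w / (2 * Real.pi * Complex.I), ?_⟩
  rw [exp₁, mul_div_cancel₀ _ Complex.two_pi_I_ne_zero, Complex.exp_log hw]

/-- A local inverse of `exp₁`. -/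
theorem exists_exp₁_inverse (u : ℂ) :
    ∃ L : ℂ → ℂ, AnalyticAt ℂ L (exp₁ u) ∧ L (exp₁ u) = u ∧ ∀ᶠ w in 𝓝 (exp₁ u), exp₁ (L w) = w := by
  refine ⟨fun w => u + Complex.log (w / exp₁ u) / (2 * Real.pi * Complex.I), ?_, ?_, ?_⟩
  · have h1 : AnalyticAt ℂ (fun w => Complex.log (w / exp₁ u)) (exp₁ u) := by
      refine AnalyticAt.clog (analyticAt_id.div analyticAt_const (exp₁_ne_zero u)) ?_
      rw [div_self (exp₁_ne_zero u)]
      exact Complex.one_mem_slitPlane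
    exact analyticAt_const.add (h1.div analyticAt_const Complex.two_pi_I_ne_zero)
  · simp [div_self (exp₁_ne_zero u)]
  · filter_upwards [isOpen_ne.mem_nhds (exp₁_ne_zero u)] with w hw
    rw [exp₁_add, exp₁.eq_1 (_ / _), mul_div_cancel₀ _ Complex.two_pi_I_ne_zero,
      Complex.exp_log (div_ne_zero hw (exp₁_ne_zero u)), mul_div_cancel₀ _ (exp₁_ne_zero u)]

theorem nhds_exp₁ (u : ℂ) : 𝓝 (exp₁ u) = map exp₁ (𝓝 u) := by
  refine le_antisymm ?_ (continuous_exp₁.tendsto u)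
  obtain ⟨L, hL, hLu, hLe⟩ := exists_exp₁_inverse u
  intro s hs
  have h1 : Tendsto L (𝓝 (exp₁ u)) (𝓝 u) := by
    have := hL.continuousAt.tendsto
    rwa [hLu] at this
  filter_upwards [h1 hs, hLe] with w hw hw2
  rw [← hw2]
  exact hw

theorem eventually_nhdsNE_exp₁ (u : ℂ) : Tendsto exp₁ (𝓝[≠] u) (𝓝[≠] (exp₁ u)) := by
  refine tendsto_nhdsWithin_iff.2 ⟨(continuous_exp₁.tendsto u).mono_left nhdsWithin_le_nhds, ?_⟩
  have h1 : ∀ᶠ z in 𝓝 u, ‖z - u‖ < 1 := by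
    filter_upwards [Metric.ball_mem_nhds u one_pos] with z hz
    rwa [Metric.mem_ball, dist_eq_norm] at hz
  filter_upwards [h1.filter_mono nhdsWithin_le_nhds, self_mem_nhdsWithin] with z hz hne heq
  obtain ⟨n, rfl⟩ := exp₁_eq_iff.1 heq
  rw [add_sub_cancel_left, Complex.norm_intCast] at hz
  have : n = 0 := by
    have h3 : |n| < 1 := by exact_mod_cast hz
    exact Int.abs_lt_one_iff.1 h3
  exact hne (by simp [this])

theorem exists_lift_exp₁ {w : ℝ → ℂ} {t₀ : ℝ} (ht₀ : t₀ < 1) (hw : ContinuousOn w (Ioo t₀ 1))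
    (h0 : ∀ t ∈ Ioo t₀ 1, w t ≠ 0) :
    ∃ ζ : ℝ → ℂ, ContinuousOn ζ (Ioo t₀ 1) ∧ ∀ t ∈ Ioo t₀ 1, exp₁ (ζ t) = w t := by
  have hsc : IsSimplyConnected (Ioo t₀ 1) := by
    have := (convex_Ioo t₀ 1).contractibleSpace (nonempty_Ioo.2 ht₀)
    exact SimplyConnectedSpace.ofContractible _
  obtain ⟨f, hf, hfe⟩ := Complex.exists_continuousOn_eqOn_exp_comp hsc isOpen_Ioo hw
    (by rintro ⟨t, ht, h⟩; exact h0 t ht h)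
  refine ⟨fun t => f t / (2 * Real.pi * Complex.I), hf.div_const _, fun t ht => ?_⟩
  rw [exp₁, mul_div_cancel₀ _ Complex.two_pi_I_ne_zero]
  exact hfe ht

/-- If `exp₁ ∘ ζ` converges in the punctured plane along a path, then so does `ζ`. -/
theorem exists_tendsto_of_tendsto_exp₁ {ζ : ℝ → ℂ} {t₀ : ℝ} (ht₀ : t₀ < 1)
    (hζ : ContinuousOn ζ (Ioo t₀ 1)) {u₀ : ℂ}
    (h : Tendsto (fun t => exp₁ (ζ t)) (𝓝[<] 1) (𝓝 (exp₁ u₀))) :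
    ∃ u, exp₁ u = exp₁ u₀ ∧ Tendsto ζ (𝓝[<] 1) (𝓝 u) := by
  obtain ⟨L, hL, hLu, hLe⟩ := exists_exp₁_inverse u₀
  have h1 := h.eventually (hLe.and hL.eventually_continuousAt)
  obtain ⟨t₁, ht₁, hsub⟩ := (mem_nhdsLT_iff_exists_Ioo_subset' (a := (1 : ℝ)) ht₀).1 h1
  set t₂ := max t₀ t₁
  have ht₂ : t₂ < 1 := max_lt ht₀ ht₁
  have hc : ContinuousOn ζ (Ioo t₂ 1) := hζ.mono (Ioo_subset_Ioo_left (le_max_left _ _))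
  have hP : ∀ t ∈ Ioo t₂ 1, exp₁ (L (exp₁ (ζ t))) = exp₁ (ζ t) ∧ ContinuousAt L (exp₁ (ζ t)) :=
    fun t ht => hsub ⟨(le_max_right _ _).trans_lt ht.1, ht.2⟩
  -- The path and the local logarithm of its image differ by an integer, which is constant by
  -- continuity.
  set d : ℝ → ℂ := fun t => ζ t - L (exp₁ (ζ t)) with hd
  have hdc : ContinuousOn d (Ioo t₂ 1) := by
    refine hc.sub fun t ht => ?_
    exact ContinuousAt.comp_continuousWithinAt (f := fun t => exp₁ (ζ t)) (hP t ht).2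
      (continuous_exp₁.continuousAt.comp_continuousWithinAt (hc t ht))
  have hdm : MapsTo d (Ioo t₂ 1) (range ((↑) : ℤ → ℂ)) := by
    intro t ht
    obtain ⟨n, hn⟩ := exp₁_eq_iff.1 (hP t ht).1.symm
    exact ⟨n, by simp only [hd]; linear_combination -hn⟩
  obtain ⟨s, hs⟩ : (Ioo t₂ 1).Nonempty := nonempty_Ioo.2 ht₂
  have hdisc : IsDiscrete (range ((↑) : ℤ → ℂ)) :=
    ⟨Complex.isClosedEmbedding_intCast.isEmbedding.toHomeomorph.discreteTopology⟩
  have hconst : ∀ t ∈ Ioo t₂ 1, d t = d s := fun t ht =>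
    isPreconnected_Ioo.constant_of_mapsTo hdisc hdc hdm ht hs
  obtain ⟨n, hn⟩ := hdm hs
  refine ⟨u₀ + n, exp₁_add_int _ _, ?_⟩
  have h2 : Tendsto (fun t => L (exp₁ (ζ t)) + n) (𝓝[<] 1) (𝓝 (u₀ + n)) := by
    have h3 := hL.continuousAt.tendsto.comp h
    rw [hLu] at h3
    exact h3.add_const _
  refine h2.congr' ?_
  filter_upwards [Ioo_mem_nhdsLT ht₂] with t ht
  have h4 := hconst t ht
  rw [← hn] at h4
  rw [← h4]
  simp only [hd]
  ring

/-! ### The identity theorem -/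

variable {U : Set RSphere} {F : RSphere → RSphere} {p : RSphere} {φ : ℂ → ℂ}

theorem eventually_ne_nhdsNE (p x : RSphere) : ∀ᶠ q in 𝓝[≠] p, q ≠ x := by
  by_cases h : p = x
  · rw [← h]
    exact self_mem_nhdsWithin
  · exact Eventually.filter_mono nhdsWithin_le_nhds (isOpen_ne.mem_nhds h)

theorem eventually_ne_nhdsNE_complex (a b : ℂ) : ∀ᶠ z in 𝓝[≠] a, z ≠ b := by
  by_cases h : a = b
  · rw [← h]
    exact self_mem_nhdsWithin
  · exact Eventually.filter_mono nhdsWithin_le_nhds (isOpen_ne.mem_nhds h)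

theorem nearlyContains_punctured (p : RSphere) : NearlyContains punctured p := by
  filter_upwards [eventually_ne_nhdsNE p zero, eventually_ne_nhdsNE p inf] with q h1 h2
  exact ⟨h1, h2⟩

theorem nearlyContains_plane (p : RSphere) : NearlyContains plane p :=
  eventually_ne_nhdsNE p inf

/-- Near each point a meromorphic map either takes the value `v` identically, or at most at the
point itself. -/
theorem IsMeroAt.eventually_eq_or_eventually_ne (h : IsMeroAt F p) (v : RSphere) :
    (∀ᶠ q in 𝓝 p, F q = v) ∨ ∀ᶠ q in 𝓝[≠] p, F q ≠ v := by
  obtain ⟨φ, ha, h⟩ := h.exists_rep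
  have key : ∀ v : RSphere, (∀ᶠ z in 𝓝 (coord p p), (φ z : RSphere) = v) ∨
      ∀ᶠ z in 𝓝[≠] (coord p p), (φ z : RSphere) ≠ v := by
    intro v
    rcases eq_inf_or_coe v with rfl | ⟨b, rfl⟩
    · exact Or.inr (Eventually.of_forall fun z => coe_ne_inf _)
    · rcases (AnalyticAt.fun_sub ha (analyticAt_const (v := b))).eventually_eq_zero_or_eventually_ne_zero with h0 | h0
      · exact Or.inl (h0.mono fun z hz => coe_inj.2 (sub_eq_zero.1 hz))
      · exact Or.inr (h0.mono fun z hz h => hz (sub_eq_zero.2 (coe_inj.1 h)))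
  rw [eventually_nhds_iff, eventually_nhdsNE_iff]
  rcases h with h | ⟨-, h⟩
  · rcases key v with h1 | h1
    · left
      filter_upwards [h, h1] with z hz hz1
      rw [hz, hz1]
    · right
      filter_upwards [h.filter_mono nhdsWithin_le_nhds, h1] with z hz hz1
      rwa [hz]
  · rcases key (recip v) with h1 | h1
    · left
      filter_upwards [h, h1] with z hz hz1
      rw [hz, hz1, recip_recip]
    · right
      filter_upwards [h.filter_mono nhdsWithin_le_nhds, h1] with z hz hz1
      rw [hz]
      intro h2
      exact hz1 (by rw [← h2, recip_recip])

/-- A meromorphic function on the plane that is locally constant near one point is constant. -/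
theorem eq_of_eventually_eq {h : ℂ → RSphere} (hm : ∀ z : ℂ, IsMeroAt (onSphere h) (z : RSphere))
    {v : RSphere} {z₀ : ℂ} (h0 : ∀ᶠ z in 𝓝 z₀, h z = v) (z : ℂ) : h z = v := by
  set S : Set ℂ := {z | ∀ᶠ y in 𝓝 z, h y = v} with hS
  have hopen : IsOpen S := isOpen_iff_mem_nhds.2 fun z hz => eventually_eventually_nhds.2 hz
  have hclosed : IsClosed S := by
    rw [← isOpen_compl_iff, isOpen_iff_mem_nhds]
    intro z hz
    have h2 : (∀ᶠ y in 𝓝 z, h y = v) ∨ ∀ᶠ y in 𝓝[≠] z, h y ≠ v := by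
      have h1 := (hm z).eventually_eq_or_eventually_ne v
      rwa [eventually_nhds_iff, eventually_nhdsNE_iff, coord_coe_self, param_coe] at h1
    rcases h2 with h2 | h2
    · exact absurd h2 hz
    · rw [eventually_nhdsWithin_iff] at h2
      filter_upwards [eventually_eventually_nhds.2 h2] with y hy hyS
      by_cases hyz : y = z
      · exact hz (hyz ▸ hyS)
      · exact hy.self_of_nhds hyz hyS.self_of_nhds
  have huniv : S = univ := IsClopen.eq_univ ⟨hclosed, hopen⟩ ⟨z₀, h0⟩
  have hz : ∀ᶠ y in 𝓝 z, h y = v := (huniv ▸ mem_univ z : z ∈ S)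
  exact hz.self_of_nhds

theorem exists_transition_symm (p : RSphere) (a : ℂ) :
    ∃ σ : ℂ → ℂ, AnalyticAt ℂ σ a ∧ σ a = coord (param p a) (param p a) ∧
      ∀ᶠ z in 𝓝 a, param (param p a) (σ z) = param p z := by
  rcases eq_inf_or_coe p with rfl | ⟨b, rfl⟩
  · by_cases ha : a = 0
    · subst ha
      have h0 : param inf 0 = inf := by rw [param_inf]; exact recip_coe_zero
      rw [h0, coord_inf_self]
      exact ⟨id, analyticAt_id, rfl, Eventually.of_forall fun w => rfl⟩
    · have h0 : param inf a = ((a⁻¹ : ℂ) : RSphere) := by rw [param_inf]; exact recip_coe_of_ne ha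
      rw [h0, coord_coe_self]
      refine ⟨fun w => w⁻¹, analyticAt_inv ha, rfl, ?_⟩
      filter_upwards [isOpen_ne.mem_nhds ha] with w hw
      rw [param_coe, param_inf]
      dsimp only
      rw [recip_coe_of_ne hw]
  · rw [param_coe, coord_coe_self]
    exact ⟨id, analyticAt_id, rfl, Eventually.of_forall fun w => by rw [param_coe]; rfl⟩

theorem IsMeroAt.analyticAt_toPlane {a : ℂ} (h : IsMeroAt F (param p a))
    (hne : F (param p a) ≠ inf) : AnalyticAt ℂ (fun z => toPlane (F (param p z))) a := by
  obtain ⟨φ, ha, hφ⟩ := h.exists_rep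
  obtain ⟨σ, hσ, hσa, hσp⟩ := exists_transition_symm p a
  rcases hφ with hφ | ⟨h0, hφ⟩
  · have hc : Tendsto σ (𝓝 a) (𝓝 (coord (param p a) (param p a))) := by
      have := hσ.continuousAt.tendsto
      rwa [hσa] at this
    have h2 : AnalyticAt ℂ (φ ∘ σ) a := AnalyticAt.comp (by rwa [hσa]) hσ
    refine h2.congr ?_
    filter_upwards [hσp, hc.eventually hφ] with z hz1 hz2
    rw [← hz1, hz2]
    rfl
  · have := hφ.self_of_nhds
    rw [param_coord_self, h0, recip_coe_zero] at this
    exact absurd this hne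

/-! ### The exponential projection -/

theorem mem_punctured_iff : p ∈ punctured ↔ ∃ z : ℂ, p = (exp₁ z : RSphere) := by
  constructor
  · rintro ⟨h1, h2⟩
    obtain ⟨w, rfl⟩ := exists_coe_of_ne_inf h2
    have hw : w ≠ 0 := fun h => h1 (by rw [h]; rfl)
    obtain ⟨z, hz⟩ := exists_exp₁_eq hw
    exact ⟨z, by rw [hz]⟩
  · rintro ⟨z, rfl⟩
    exact ⟨fun h => exp₁_ne_zero z (coe_inj.1 h), coe_ne_inf _⟩

theorem coe_exp₁_mem_punctured (z : ℂ) : (exp₁ z : RSphere) ∈ punctured :=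
  mem_punctured_iff.2 ⟨z, rfl⟩

theorem coe_mem_punctured {w : ℂ} (hw : w ≠ 0) : (w : RSphere) ∈ punctured :=
  ⟨fun h => hw (coe_inj.1 h), coe_ne_inf _⟩

theorem param_mem_punctured {z : ℂ} (p : RSphere) (hz : z ≠ 0) : param p z ∈ punctured := by
  rcases eq_inf_or_coe p with rfl | ⟨a, rfl⟩
  · rw [param_inf]
    dsimp only
    rw [recip_coe_of_ne hz]
    exact coe_mem_punctured (inv_ne_zero hz)
  · rw [param_coe]
    exact coe_mem_punctured hz

open Classical in
/-- The exponent of `w ↦ w ^ ℓ` in the chart at `p`. -/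
noncomputable def chartExp (ℓ : ℤ) (p : RSphere) : ℤ := if p = inf then -ℓ else ℓ

theorem chartExp_inf (ℓ : ℤ) : chartExp ℓ inf = -ℓ := if_pos rfl

theorem chartExp_coe (ℓ : ℤ) (a : ℂ) : chartExp ℓ (a : RSphere) = ℓ := if_neg (coe_ne_inf a)

/-- The data of a projectable function `f z = ℓ z + Φ (exp₁ z)` and its projection `g`. -/
structure IsProjection (f : ℂ → RSphere) (g : RSphere → RSphere) (ℓ : ℤ)
    (Φ : RSphere → RSphere) : Prop where
  proj : IsProjectableWith f g
  mero : ∀ p ∈ punctured, IsMeroAt Φ p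
  eq_map : ∀ z : ℂ, f z = OnePoint.map (fun u : ℂ => (ℓ : ℂ) * z + u) (Φ (exp₁ z : RSphere))

namespace IsProjection

variable {f : ℂ → RSphere} {g : RSphere → RSphere} {ℓ : ℤ} {Φ : RSphere → RSphere}

theorem isMeroAt (H : IsProjection f g ℓ Φ) (z : ℂ) : IsMeroAt (onSphere f) (z : RSphere) :=
  H.proj.1.1.1 z

theorem not_rational (H : IsProjection f g ℓ Φ) : ¬ IsRationalOnPlane f := H.proj.1.2

/-- The form in which transcendence of `f` enters: every later contradiction produces an affine `f`.
-/
theorem not_affine (H : IsProjection f g ℓ Φ) (a b : ℂ) :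
    ¬ ∀ z : ℂ, f z = ((a * z + b : ℂ) : RSphere) := fun h =>
  H.not_rational ⟨Polynomial.C a * Polynomial.X + Polynomial.C b, 1, one_ne_zero, fun z _ => by
    rw [h z]
    simp⟩

theorem eq_inf_iff (H : IsProjection f g ℓ Φ) (z : ℂ) :
    f z = inf ↔ Φ (exp₁ z : RSphere) = inf := by
  rw [H.eq_map]
  rcases eq_inf_or_coe (Φ (exp₁ z : RSphere)) with h | ⟨c, h⟩
  · rw [h, map_inf]
  · rw [h, map_coe]
    exact iff_of_false (coe_ne_inf _) (coe_ne_inf _)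

theorem eq_coe_of (H : IsProjection f g ℓ Φ) {z c : ℂ} (h : Φ (exp₁ z : RSphere) = (c : RSphere)) :
    f z = ((ℓ * z + c : ℂ) : RSphere) := by
  rw [H.eq_map, h, map_coe]

theorem not_eventually_inf (H : IsProjection f g ℓ Φ) (z₀ : ℂ) :
    ¬ ∀ᶠ z in 𝓝 z₀, f z = inf := by
  intro h
  obtain ⟨z, hz⟩ := H.proj.1.1.2
  exact hz (eq_of_eventually_eq H.isMeroAt h z)

theorem mem_projDom_iff (H : IsProjection f g ℓ Φ) :
    p ∈ projDom f ↔ p ∈ punctured ∧ Φ p ≠ inf := by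
  constructor
  · rintro ⟨z, hz, rfl⟩
    exact ⟨coe_exp₁_mem_punctured z, fun h => hz ((H.eq_inf_iff z).2 h)⟩
  · rintro ⟨hp, hne⟩
    obtain ⟨z, rfl⟩ := mem_punctured_iff.1 hp
    exact ⟨z, fun h => hne ((H.eq_inf_iff z).1 h), rfl⟩

/-- A non-isolated pole of `Φ` in `ℂ*` would make `f` identically `∞` by the identity theorem. At
the punctures, poles may accumulate. -/
theorem nearlyContains_projDom (H : IsProjection f g ℓ Φ) (hp : p ∈ punctured) :
    NearlyContains (projDom f) p := by
  rcases (H.mero p hp).eventually_eq_or_eventually_ne inf with h | h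
  · exfalso
    obtain ⟨z, rfl⟩ := mem_punctured_iff.1 hp
    refine H.not_eventually_inf z ?_
    have hc : Tendsto (fun z => (exp₁ z : RSphere)) (𝓝 z) (𝓝 (exp₁ z : RSphere)) :=
      (OnePoint.continuous_coe.comp continuous_exp₁).tendsto z
    exact (hc.eventually h).mono fun y hy => (H.eq_inf_iff y).2 hy
  · filter_upwards [h, nearlyContains_punctured p] with q h1 h2
    exact H.mem_projDom_iff.2 ⟨h2, h1⟩

/-- For `w = exp₁ z` one has `exp₁ (ℓ * z + c) = w ^ ℓ * exp₁ c`; the choice of `z` disappears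
because `ℓ` is an integer. -/
theorem proj_coe (H : IsProjection f g ℓ Φ) {w c : ℂ} (hw : w ≠ 0)
    (h : Φ (w : RSphere) = (c : RSphere)) : g (w : RSphere) = ((w ^ ℓ * exp₁ c : ℂ) : RSphere) := by
  obtain ⟨z, rfl⟩ := exists_exp₁_eq hw
  rw [H.proj.2 z _ (H.eq_coe_of h), exp₁_add, exp₁_int_mul]

theorem proj_param (H : IsProjection f g ℓ Φ) {z c : ℂ} (hz : z ≠ 0)
    (h : Φ (param p z) = (c : RSphere)) :
    g (param p z) = ((z ^ chartExp ℓ p * exp₁ c : ℂ) : RSphere) := by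
  rcases eq_inf_or_coe p with rfl | ⟨a, rfl⟩
  · rw [param_inf] at h ⊢
    dsimp only at h ⊢
    rw [recip_coe_of_ne hz] at h ⊢
    rw [H.proj_coe (inv_ne_zero hz) h, chartExp_inf, inv_zpow']
  · rw [param_coe] at h ⊢
    rw [H.proj_coe hz h, chartExp_coe]

/-- A representation only concerns points off `p`; continuity of `Φ` on the punctured plane supplies
the value at `p`. -/
theorem finRep_self (H : IsProjection f g ℓ Φ) (hp : p ∈ punctured) (h : FinRep Φ p φ) :
    Φ p = (φ (coord p p) : RSphere) :=
  tendsto_nhds_unique ((H.mero p hp).1.tendsto.mono_left nhdsWithin_le_nhds) h.continuousAt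

theorem poleRep_self (H : IsProjection f g ℓ Φ) (hp : p ∈ punctured) (h : PoleRep Φ p φ) :
    Φ p = inf :=
  tendsto_nhds_unique ((H.mero p hp).1.tendsto.mono_left nhdsWithin_le_nhds) h.continuousAt

theorem exists_finRep (H : IsProjection f g ℓ Φ) (hp : p ∈ projDom f) : ∃ φ, FinRep Φ p φ := by
  obtain ⟨hp1, hp2⟩ := H.mem_projDom_iff.1 hp
  obtain ⟨φ, ha, h⟩ := (H.mero p hp1).exists_rep
  rcases h with h | ⟨h0, h⟩
  · exact ⟨φ, ha, h.filter_mono nhdsWithin_le_nhds⟩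
  · have := h.self_of_nhds
    rw [param_coord_self, h0, recip_coe_zero] at this
    exact absurd this hp2

theorem nearlyContains_of_finRep (H : IsProjection f g ℓ Φ) (h : FinRep Φ p φ) :
    NearlyContains (projDom f) p := by
  rw [NearlyContains, eventually_nhdsNE_iff]
  filter_upwards [h.2, eventually_ne_nhdsNE_complex (coord p p) 0] with z hz hz0
  rw [H.mem_projDom_iff, hz]
  exact ⟨param_mem_punctured p hz0, coe_ne_inf _⟩

theorem coord_ne_zero (hp : p ∈ punctured) : coord p p ≠ 0 := by
  obtain ⟨z, rfl⟩ := mem_punctured_iff.1 hp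
  rw [coord_coe_self]
  exact exp₁_ne_zero z

theorem mem_punctured_of_coord_ne_zero (h : coord p p ≠ 0) : p ∈ punctured := by
  rcases eq_inf_or_coe p with rfl | ⟨a, rfl⟩
  · exact absurd coord_inf_self h
  · rw [coord_coe_self] at h
    exact coe_mem_punctured h

/-- The projection near a point of its domain, if the exponent of `w ^ ℓ` is non-negative. -/
theorem finRep_proj (H : IsProjection f g ℓ Φ) (h : FinRep Φ p φ)
    (hk : p ∈ punctured ∨ 0 ≤ chartExp ℓ p) :
    FinRep g p (fun z => z ^ chartExp ℓ p * exp₁ (φ z)) := by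
  refine ⟨?_, ?_⟩
  · refine AnalyticAt.mul ?_ ((analyticAt_exp₁ _).comp h.1)
    rcases hk with hk | hk
    · exact analyticAt_id.zpow (coord_ne_zero hk)
    · obtain ⟨n, hn⟩ := Int.eq_ofNat_of_zero_le hk
      rw [hn]
      simp only [zpow_natCast]
      exact analyticAt_id.pow n
  · filter_upwards [h.2, eventually_ne_nhdsNE_complex (coord p p) 0] with z hz hz0
    exact H.proj_param hz0 hz

theorem finRep_proj_self (H : IsProjection f g ℓ Φ) (h : FinRep Φ p φ) (hp : p ∈ projDom f) :
    g p = (((coord p p) ^ chartExp ℓ p * exp₁ (φ (coord p p)) : ℂ) : RSphere) := by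
  have hp1 := (H.mem_projDom_iff.1 hp).1
  have := H.proj_param (p := p) (coord_ne_zero hp1) (c := φ (coord p p))
    (by rw [param_coord_self]; exact H.finRep_self hp1 h)
  rwa [param_coord_self] at this

/-- The projection near a puncture where the exponent of `w ^ ℓ` is negative. -/
theorem poleRep_proj (H : IsProjection f g ℓ Φ) (h : FinRep Φ p φ)
    (hp : p ∉ punctured) (hk : chartExp ℓ p < 0) :
    PoleRep g p (fun z => z ^ (-chartExp ℓ p) * exp₁ (-φ z)) := by
  have hp0 : coord p p = 0 := by
    by_contra hne
    exact hp (mem_punctured_of_coord_ne_zero hne)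
  refine ⟨?_, ?_, ?_⟩
  · refine AnalyticAt.mul ?_ ((analyticAt_exp₁ _).comp h.1.neg)
    obtain ⟨n, hn⟩ := Int.eq_ofNat_of_zero_le (neg_nonneg.2 hk.le)
    rw [hn]
    simp only [zpow_natCast]
    exact analyticAt_id.pow n
  · dsimp only
    rw [hp0, zero_zpow _ (neg_pos.2 hk).ne', zero_mul]
  · filter_upwards [h.2, eventually_ne_nhdsNE_complex (coord p p) 0] with z hz hz0
    rw [H.proj_param hz0 hz, recip_coe_of_ne (mul_ne_zero (zpow_ne_zero _ hz0) (exp₁_ne_zero _)),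
      mul_inv, exp₁_neg, inv_inv, zpow_neg, inv_inv]

theorem mem_dom_of_finRep (H : IsProjection f g ℓ Φ) (h : FinRep Φ p φ) :
    p ∈ dom (projDom f) g := by
  by_cases hk : p ∈ punctured ∨ 0 ≤ chartExp ℓ p
  · exact (H.finRep_proj h hk).mem_dom (H.finRep_proj_self h)
  · push Not at hk
    exact (H.poleRep_proj h hk.1 hk.2).mem_dom fun hp => absurd (H.mem_projDom_iff.1 hp).1 hk.1

/-- Dividing `g` by the power of the coordinate leaves `exp₁ ∘ Φ`, which is therefore meromorphic at
`p`; its logarithm `Φ` then has a removable singularity. In particular a pole of `Φ` cannot be in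
the domain of `g`. -/
theorem exists_finRep_of_isolated (H : IsProjection f g ℓ Φ) (hp : NearlyContains (projDom f) p)
    (hd : p ∈ dom (projDom f) g) : ∃ φ, FinRep Φ p φ := by
  set a := coord p p with ha
  set φ₀ : ℂ → ℂ := fun z => toPlane (Φ (param p z)) with hφ₀
  have hΦ : ∀ᶠ z in 𝓝[≠] a, z ≠ 0 ∧ AnalyticAt ℂ φ₀ z ∧ Φ (param p z) = (φ₀ z : RSphere) := by
    filter_upwards [hp.param, eventually_ne_nhdsNE_complex a 0] with z hz hz0
    obtain ⟨h1, h2⟩ := H.mem_projDom_iff.1 hz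
    exact ⟨hz0, (H.mero _ h1).analyticAt_toPlane h2, (coe_toPlane h2).symm⟩
  have hm : MeromorphicAt (fun z => Complex.exp (2 * Real.pi * Complex.I * φ₀ z)) a := by
    obtain ⟨ψ, h⟩ := exists_rep_of_mem_dom hp hd
    have hz : MeromorphicAt (fun z : ℂ => z ^ (-chartExp ℓ p)) a :=
      (analyticAt_id.meromorphicAt).zpow _
    rcases h with h | h
    · refine (hz.mul h.1.meromorphicAt).congr ?_
      filter_upwards [hΦ, h.2] with z hz1 hz2
      rw [H.proj_param hz1.1 hz1.2.2, coe_inj] at hz2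
      rw [Pi.mul_apply, ← hz2, ← mul_assoc, ← zpow_add₀ hz1.1, neg_add_cancel, zpow_zero, one_mul]
      rfl
    · refine (hz.mul h.1.meromorphicAt.inv).congr ?_
      filter_upwards [hΦ, h.2.2] with z hz1 hz2
      rw [H.proj_param hz1.1 hz1.2.2] at hz2
      have h3 := congrArg toPlane hz2
      rw [toPlane_coe, toPlane_recip_coe] at h3
      rw [Pi.mul_apply, Pi.inv_apply, ← h3, ← mul_assoc, ← zpow_add₀ hz1.1, neg_add_cancel,
        zpow_zero, one_mul]
      rfl
  obtain ⟨ψ, hψ, hψe⟩ := exists_analyticAt_of_meromorphicAt_exp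
    (hΦ.mono fun z hz => analyticAt_const.fun_mul hz.2.1) hm
  refine ⟨fun z => ψ z / (2 * Real.pi * Complex.I),
    hψ.div analyticAt_const Complex.two_pi_I_ne_zero, ?_⟩
  filter_upwards [hΦ, hψe] with z hz1 hz2
  rw [hz1.2.2, ← hz2, mul_div_cancel_left₀ _ Complex.two_pi_I_ne_zero]

theorem mem_projDom_of_mem_dom (H : IsProjection f g ℓ Φ) (hp : p ∈ punctured)
    (hd : p ∈ dom (projDom f) g) : p ∈ projDom f := by
  obtain ⟨φ, hφ⟩ := H.exists_finRep_of_isolated (H.nearlyContains_projDom hp) hd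
  rw [H.mem_projDom_iff, H.finRep_self hp hφ]
  exact ⟨hp, coe_ne_inf _⟩

/-- Poles of `Φ` cannot accumulate at a point of the domain: the domain is open, and its points in
`ℂ*` are not poles. This makes isolation automatic in `mem_dom_iff`. -/
theorem nearlyContains_of_mem_dom (H : IsProjection f g ℓ Φ) (hd : p ∈ dom (projDom f) g) :
    NearlyContains (projDom f) p := by
  have h1 : ∀ᶠ q in 𝓝[≠] p, q ∈ dom (projDom f) g :=
    Eventually.filter_mono nhdsWithin_le_nhds ((isOpen_dom _ _).mem_nhds hd)
  filter_upwards [h1, nearlyContains_punctured p] with q hq1 hq2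
  exact H.mem_projDom_of_mem_dom hq2 hq1

/-- The projection extends meromorphically exactly to the points where `Φ` has a finite value. -/
theorem mem_dom_iff (H : IsProjection f g ℓ Φ) : p ∈ dom (projDom f) g ↔ ∃ φ, FinRep Φ p φ :=
  ⟨fun h => H.exists_finRep_of_isolated (H.nearlyContains_of_mem_dom h) h,
    fun ⟨_, h⟩ => H.mem_dom_of_finRep h⟩

theorem projDom_subset_dom (H : IsProjection f g ℓ Φ) : projDom f ⊆ dom (projDom f) g :=
  fun _ hp => H.mem_dom_iff.2 (H.exists_finRep hp)

theorem ext_proj (H : IsProjection f g ℓ Φ) (hp : p ∈ projDom f) : ext (projDom f) g p = g p := by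
  obtain ⟨φ, hφ⟩ := H.exists_finRep hp
  have hp1 := (H.mem_projDom_iff.1 hp).1
  rw [(H.finRep_proj hφ (Or.inl hp1)).ext_self (H.nearlyContains_of_finRep hφ)
    (H.finRep_proj_self hφ), H.finRep_proj_self hφ hp]

theorem punctured_subset_dom (H : IsProjection f g ℓ Φ) : punctured ⊆ dom punctured Φ :=
  fun p hp => ⟨Φ, H.mero p hp, Eventually.of_forall fun _ _ => rfl⟩

theorem ext_outer (H : IsProjection f g ℓ Φ) (hp : p ∈ punctured) : ext punctured Φ p = Φ p :=
  ext_eq_of_tendsto (nearlyContains_punctured p)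
    ((H.mero p hp).1.tendsto.mono_left nhdsWithin_le_nhds) fun _ => rfl

/-- The points where `Φ` extends with a finite value. -/
theorem exists_finRep_iff (H : IsProjection f g ℓ Φ) :
    (∃ φ, FinRep Φ p φ) ↔ p ∉ ess punctured Φ ∪ fiber punctured Φ inf := by
  constructor
  · rintro ⟨φ, h⟩ (h1 | ⟨-, h1⟩)
    · exact h1 (h.mem_dom fun hp => H.finRep_self hp h)
    · rw [h.ext_self (nearlyContains_punctured p) fun hp => H.finRep_self hp h] at h1
      exact coe_ne_inf _ h1
  · intro h
    rw [mem_union, not_or] at h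
    have hd : p ∈ dom punctured Φ := not_not.1 h.1
    obtain ⟨φ, hφ | hφ⟩ := exists_rep_of_mem_dom (nearlyContains_punctured p) hd
    · exact ⟨φ, hφ⟩
    · exact absurd ⟨hd, hφ.ext_self (nearlyContains_punctured p) fun hp => H.poleRep_self hp hφ⟩ h.2

end IsProjection

end RSphere

/-- A holomorphic function that is bounded near an isolated singularity extends to it. -/
theorem exists_analyticAt_of_bounded {h : ℂ → ℂ} {a : ℂ} {ρ M : ℝ} (hρ : 0 < ρ)
    (hd : ∀ z, z ≠ a → ‖z - a‖ ≤ ρ → AnalyticAt ℂ h z)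
    (hM : ∀ z, z ≠ a → ‖z - a‖ < ρ → ‖h z‖ ≤ M) :
    ∃ ψ : ℂ → ℂ, AnalyticAt ℂ ψ a ∧ ∀ᶠ z in 𝓝[≠] a, h z = ψ z := by
  have hs : Metric.ball a ρ ∈ 𝓝 a := Metric.ball_mem_nhds a hρ
  have h1 := Complex.differentiableOn_update_limUnder_of_bddAbove (f := h) hs (fun z hz => by
    have h2 := hz.1
    rw [Metric.mem_ball, dist_eq_norm] at h2
    exact (hd z hz.2 h2.le).differentiableAt.differentiableWithinAt) ⟨M, by
    rintro _ ⟨z, hz, rfl⟩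
    have h2 := hz.1
    rw [Metric.mem_ball, dist_eq_norm] at h2
    exact hM z hz.2 h2⟩
  refine ⟨_, h1.analyticAt hs, ?_⟩
  filter_upwards [self_mem_nhdsWithin] with z hz
  exact (Function.update_of_ne hz _ _).symm

/-- The order of vanishing at `0` is exactly `k`, since `E` does not vanish there. -/
theorem deriv_zpow_mul_zero_iff {E : ℂ → ℂ} (hE : AnalyticAt ℂ E 0) (h0 : E 0 ≠ 0) {k : ℤ}
    (hk : 1 ≤ k) : deriv (fun z => z ^ k * E z) 0 = 0 ↔ 2 ≤ k := by
  obtain ⟨n, rfl⟩ := Int.eq_ofNat_of_zero_le (zero_le_one.trans hk)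
  simp only [zpow_natCast]
  have h1 : HasDerivAt (fun z : ℂ => z ^ n * E z) (n * 0 ^ (n - 1) * E 0 + 0 ^ n * deriv E 0) 0 :=
    (hasDerivAt_pow n 0).mul hE.differentiableAt.hasDerivAt
  rw [h1.deriv]
  have hn : 1 ≤ n := by exact_mod_cast hk
  rcases hn.eq_or_lt with rfl | hlt
  · simp [h0]
  · rw [zero_pow (by omega), zero_pow (by omega)]
    have : (2 : ℤ) ≤ (n : ℤ) := by exact_mod_cast hlt
    simp [this]

/-! ### Limits at infinity and local forms at the punctures -/

namespace RSphere

theorem tendsto_coe_inf {ι : Type*} {l : Filter ι} {h : ι → ℂ}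
    (hh : Tendsto (fun t => ‖h t‖) l atTop) : Tendsto (fun t => (h t : RSphere)) l (𝓝 inf) := by
  have h1 : Tendsto h l (coclosedCompact ℂ) := by
    rw [coclosedCompact_eq_cocompact]
    exact tendsto_norm_atTop_iff_cobounded.1 hh |>.mono_right
      (Metric.cobounded_eq_cocompact (α := ℂ)).le
  exact (OnePoint.tendsto_coe_infty (X := ℂ)).comp h1

theorem tendsto_norm_of_tendsto_coe_inf {ι : Type*} {l : Filter ι} {h : ι → ℂ}
    (hh : Tendsto (fun t => (h t : RSphere)) l (𝓝 inf)) : Tendsto (fun t => ‖h t‖) l atTop := by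
  rw [tendsto_norm_atTop_iff_cobounded, Metric.cobounded_eq_cocompact,
    ← coclosedCompact_eq_cocompact, ← OnePoint.comap_coe_nhds_infty, tendsto_comap_iff]
  exact hh

theorem chartExp_zero (ℓ : ℤ) : chartExp ℓ zero = ℓ := chartExp_coe ℓ 0

theorem coord_of_notMem_punctured {p : RSphere} (hp : p ∉ punctured) : coord p p = 0 := by
  by_contra hne
  exact hp (IsProjection.mem_punctured_of_coord_ne_zero hne)

theorem notMem_punctured_iff {p : RSphere} : p ∉ punctured ↔ p = zero ∨ p = inf := by
  change ¬ (p ≠ zero ∧ p ≠ inf) ↔ _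
  tauto

theorem IsMeroAt.comp_exp₁ {F : RSphere → RSphere} {z : ℂ}
    (h : IsMeroAt F (exp₁ z : RSphere)) :
    IsMeroAt (onSphere fun y => F (exp₁ y : RSphere)) (z : RSphere) := by
  obtain ⟨φ, ha, h⟩ := h.exists_rep
  rw [coord_coe_self, param_coe] at h
  rw [coord_coe_self] at ha
  have h1 : AnalyticAt ℂ (fun y => φ (exp₁ y)) z := AnalyticAt.comp ha (analyticAt_exp₁ z)
  have hc := continuous_exp₁.tendsto z
  rcases h with h | ⟨h0, h⟩
  · refine isMeroAt_of_coe (φ := fun y => φ (exp₁ y)) ?_ ?_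
    · rwa [coord_coe_self]
    · rw [coord_coe_self, param_coe]
      exact hc.eventually h
  · refine isMeroAt_of_recip (φ := fun y => φ (exp₁ y)) ?_ ?_ ?_
    · rwa [coord_coe_self]
    · rwa [coord_coe_self]
    · rw [coord_coe_self, param_coe]
      exact hc.eventually h

namespace IsProjection

variable {f : ℂ → RSphere} {g : RSphere → RSphere} {ℓ : ℤ} {Φ : RSphere → RSphere} {p : RSphere}
  {φ : ℂ → ℂ}

/-! ### The asymptotic values `0` and `∞` -/

/-- `Φ ∘ exp₁` is not constant. -/
theorem outer_not_const (H : IsProjection f g ℓ Φ) (b : RSphere) :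
    ¬ ∀ z, Φ (exp₁ z : RSphere) = b := by
  intro h
  rcases eq_inf_or_coe b with rfl | ⟨b, rfl⟩
  · obtain ⟨z, hz⟩ := H.proj.1.1.2
    exact hz ((H.eq_inf_iff z).2 (h z))
  · exact H.not_affine ℓ b fun z => H.eq_coe_of (h z)

theorem outer_not_eventually_const (H : IsProjection f g ℓ Φ) (b : RSphere) (z₀ : ℂ) :
    ¬ ∀ᶠ z in 𝓝 z₀, Φ (exp₁ z : RSphere) = b := fun h =>
  H.outer_not_const b (eq_of_eventually_eq
    (h := fun z => Φ (exp₁ z : RSphere)) (fun z => (H.mero _ (coe_exp₁_mem_punctured z)).comp_exp₁) h)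

/-- On a punctured disc `g` is given by a holomorphic function `G` without zeros. If `G` or `1 / G`
were bounded, `g` would extend meromorphically; so both are unbounded, and
`exists_path_tendsto_of_unbounded` applies to each. -/
theorem zero_inf_mem_asympVals_of_isolated (H : IsProjection f g ℓ Φ)
    (hp : NearlyContains (projDom f) p) (hd : p ∉ dom (projDom f) g) :
    zero ∈ asympVals (projDom f) g ∧ inf ∈ asympVals (projDom f) g := by
  set a := coord p p with ha
  set φ₀ : ℂ → ℂ := fun z => toPlane (Φ (param p z)) with hφ₀
  set G : ℂ → ℂ := fun z => z ^ chartExp ℓ p * exp₁ (φ₀ z) with hG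
  have hgood : ∀ᶠ z in 𝓝[≠] a, param p z ∈ projDom f ∧ AnalyticAt ℂ G z ∧ G z ≠ 0 ∧
      g (param p z) = (G z : RSphere) := by
    filter_upwards [hp.param, eventually_ne_nhdsNE_complex a 0] with z hz hz0
    obtain ⟨h1, h2⟩ := H.mem_projDom_iff.1 hz
    have h3 : AnalyticAt ℂ φ₀ z := (H.mero _ h1).analyticAt_toPlane h2
    exact ⟨hz, (analyticAt_id.zpow hz0).mul ((analyticAt_exp₁ _).comp h3),
      mul_ne_zero (zpow_ne_zero _ hz0) (exp₁_ne_zero _), H.proj_param hz0 (coe_toPlane h2).symm⟩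
  obtain ⟨r, hr, hball⟩ := Metric.mem_nhdsWithin_iff.1 hgood
  obtain ⟨ρ, hρ, hρr⟩ := exists_between hr
  have hB : ∀ z, z ≠ a → ‖z - a‖ ≤ ρ → param p z ∈ projDom f ∧ AnalyticAt ℂ G z ∧ G z ≠ 0 ∧
      g (param p z) = (G z : RSphere) := fun z hza hz =>
    hball ⟨by rw [Metric.mem_ball, dist_eq_norm]; exact hz.trans_lt hρr, hza⟩
  have hpU : p ∉ projDom f := fun h => hd (H.projDom_subset_dom h)
  have hu1 : ∀ M, ∃ z, z ≠ a ∧ ‖z - a‖ < ρ ∧ M < ‖G z‖ := by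
    by_contra! hcon
    obtain ⟨M, hM⟩ := hcon
    obtain ⟨ψ, hψ, hψe⟩ := exists_analyticAt_of_bounded hρ (fun z h1 h2 => (hB z h1 h2).2.1) hM
    refine hd (FinRep.mem_dom (φ := ψ) ⟨hψ, ?_⟩ fun h => absurd h hpU)
    filter_upwards [hgood, hψe] with z hz1 hz2
    rw [hz1.2.2.2, hz2]
  have hu2 : ∀ M, ∃ z, z ≠ a ∧ ‖z - a‖ < ρ ∧ M < ‖(G z)⁻¹‖ := by
    by_contra! hcon
    obtain ⟨M, hM⟩ := hcon
    obtain ⟨ψ, hψ, hψe⟩ := exists_analyticAt_of_bounded hρ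
      (fun z h1 h2 => (hB z h1 h2).2.1.fun_inv (hB z h1 h2).2.2.1) hM
    -- The bounded extension of `1 / G` either vanishes, giving `g` a pole, or does not, giving a
    -- finite value.
    by_cases h0 : ψ a = 0
    · refine hd (PoleRep.mem_dom (φ := ψ) ⟨hψ, h0, ?_⟩ fun h => absurd h hpU)
      filter_upwards [hgood, hψe] with z hz1 hz2
      rw [hz1.2.2.2, ← hz2, recip_coe_of_ne (inv_ne_zero hz1.2.2.1), inv_inv]
    · refine hd (FinRep.mem_dom (φ := fun z => (ψ z)⁻¹) ⟨hψ.fun_inv h0, ?_⟩ fun h => absurd h hpU)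
      filter_upwards [hgood, hψe] with z hz1 hz2
      rw [hz1.2.2.2, ← hz2, inv_inv]
  have main : ∀ (γ : ℝ → ℂ) (v : RSphere), ContinuousOn γ (Ico 0 1) →
      (∀ t ∈ Ico (0 : ℝ) 1, γ t ≠ a ∧ ‖γ t - a‖ < ρ) → Tendsto γ (𝓝[<] 1) (𝓝 a) →
      Tendsto (fun t => (G (γ t) : RSphere)) (𝓝[<] 1) (𝓝 v) → v ∈ asympVals (projDom f) g := by
    intro γ v hγ hγB hγa hγv
    have hmem : ∀ t ∈ Ico (0 : ℝ) 1, param p (γ t) ∈ projDom f := fun t ht =>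
      (hB _ (hγB t ht).1 (hγB t ht).2.le).1
    refine ⟨fun t => param p (γ t), (continuous_param p).comp_continuousOn hγ,
      fun t ht => H.projDom_subset_dom (hmem t ht), ⟨p, hd, (tendsto_param p).comp hγa⟩,
      hγv.congr' ?_⟩
    filter_upwards [Ico_mem_nhdsLT one_pos] with t ht
    rw [H.ext_proj (hmem t ht)]
    exact (hB _ (hγB t ht).1 (hγB t ht).2.le).2.2.2.symm
  constructor
  · obtain ⟨γ, h1, h2, h3, h4⟩ := exists_path_tendsto_of_unbounded hρ
      (fun z h1 h2 => (hB z h1 h2).2.1.fun_inv (hB z h1 h2).2.2.1) hu2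
    refine main γ zero h1 h2 h3 ?_
    have h5 : Tendsto (fun t => G (γ t)) (𝓝[<] 1) (𝓝 0) := by
      have h6 := (tendsto_norm_atTop_iff_cobounded.1 h4)
      have h7 := (Filter.tendsto_inv₀_cobounded (α := ℂ)).comp h6
      refine h7.congr fun t => ?_
      simp
    exact (OnePoint.continuous_coe.tendsto (0 : ℂ)).comp h5
  · obtain ⟨γ, h1, h2, h3, h4⟩ := exists_path_tendsto_of_unbounded hρ
      (fun z h1 h2 => (hB z h1 h2).2.1) hu1
    exact main γ inf h1 h2 h3 (tendsto_coe_inf h4)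

/-- The projection has an essential singularity that is isolated from other singularities. -/
theorem exists_isolated_ess (H : IsProjection f g ℓ Φ) :
    ∃ p, NearlyContains (projDom f) p ∧ p ∉ dom (projDom f) g := by
  by_contra! hcon
  -- Poles of `Φ` in `ℂ*` are isolated essential singularities of `g`, so there are none; then the
  -- punctures are isolated as well, and `Φ` is finite on the whole sphere.
  have hfin : ∀ p ∈ punctured, p ∈ projDom f := fun p hp =>
    H.mem_projDom_of_mem_dom hp (hcon p (H.nearlyContains_projDom hp))
  have hrep : ∀ p, ∃ φ, FinRep Φ p φ := fun p => H.mem_dom_iff.1 <| hcon p <| by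
    filter_upwards [nearlyContains_punctured p] with q hq
    exact hfin q hq
  -- Local bounds are patched by compactness of the sphere; Liouville's theorem for `Φ ∘ exp₁`
  -- finishes the argument.
  have hbdd : ∃ M : ℝ, ∀ q ∈ (univ : Set RSphere), q ∈ punctured → ‖toPlane (Φ q)‖ ≤ M := by
    refine isCompact_univ.induction_on
      (p := fun s => ∃ M : ℝ, ∀ q ∈ s, q ∈ punctured → ‖toPlane (Φ q)‖ ≤ M) ?_ ?_ ?_ ?_
    · exact ⟨0, fun q hq => absurd hq (notMem_empty q)⟩
    · rintro s t hst ⟨M, hM⟩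
      exact ⟨M, fun q hq => hM q (hst hq)⟩
    · rintro s t ⟨M, hM⟩ ⟨N, hN⟩
      refine ⟨max M N, fun q hq hqp => ?_⟩
      rcases hq with hq | hq
      · exact (hM q hq hqp).trans (le_max_left _ _)
      · exact (hN q hq hqp).trans (le_max_right _ _)
    · intro q _
      obtain ⟨φ, hφ⟩ := hrep q
      have h1 : Tendsto (fun r => ‖toPlane (Φ r)‖) (𝓝[≠] q) (𝓝 ‖φ (coord q q)‖) :=
        ((continuousAt_toPlane _).tendsto.comp hφ.continuousAt).norm
      have h2 := h1.eventually (Iio_mem_nhds (lt_add_one ‖φ (coord q q)‖))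
      rw [eventually_nhdsWithin_iff] at h2
      rw [nhdsWithin_univ]
      refine ⟨_, h2, max (‖φ (coord q q)‖ + 1) ‖toPlane (Φ q)‖, fun r hr _ => ?_⟩
      by_cases hrq : r = q
      · rw [hrq]
        exact le_max_right _ _
      · exact (le_of_lt (hr hrq)).trans (le_max_left _ _)
  obtain ⟨M, hM⟩ := hbdd
  set P : ℂ → ℂ := fun z => toPlane (Φ (exp₁ z : RSphere)) with hP
  have hPd : Differentiable ℂ P := by
    intro z
    have h1 := (H.mem_projDom_iff.1 (hfin _ (coe_exp₁_mem_punctured z)))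
    have h2 : AnalyticAt ℂ (fun w => toPlane (Φ (param (exp₁ z : RSphere) w))) (exp₁ z) := by
      refine IsMeroAt.analyticAt_toPlane ?_ ?_ <;> rw [param_coe]
      exacts [H.mero _ h1.1, h1.2]
    rw [param_coe] at h2
    exact (AnalyticAt.fun_comp h2 (analyticAt_exp₁ z)).differentiableAt
  have hPb : Bornology.IsBounded (range P) := by
    rw [isBounded_iff_forall_norm_le]
    refine ⟨M, ?_⟩
    rintro _ ⟨z, rfl⟩
    exact hM _ (mem_univ _) (coe_exp₁_mem_punctured z)
  refine H.outer_not_const (P 0 : RSphere) fun z => ?_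
  rw [← hPd.apply_eq_apply_of_bounded hPb z 0]
  exact (coe_toPlane (H.mem_projDom_iff.1 (hfin _ (coe_exp₁_mem_punctured z))).2).symm

theorem zero_inf_mem_asympVals (H : IsProjection f g ℓ Φ) :
    zero ∈ asympVals (projDom f) g ∧ inf ∈ asympVals (projDom f) g := by
  obtain ⟨p, h1, h2⟩ := H.exists_isolated_ess
  exact H.zero_inf_mem_asympVals_of_isolated h1 h2

/-! ### The critical values `0` and `∞` -/

theorem ext_proj_punctured (H : IsProjection f g ℓ Φ) (hp : p ∈ punctured)
    (hd : p ∈ dom (projDom f) g) : ext (projDom f) g p ∈ punctured := by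
  have h1 := H.mem_projDom_of_mem_dom hp hd
  obtain ⟨φ, hφ⟩ := H.exists_finRep h1
  rw [H.ext_proj h1, H.finRep_proj_self hφ h1]
  exact coe_mem_punctured (mul_ne_zero (zpow_ne_zero _ (coord_ne_zero hp)) (exp₁_ne_zero _))

theorem projDom_subset_punctured (H : IsProjection f g ℓ Φ) : projDom f ⊆ punctured :=
  fun _ hp => (H.mem_projDom_iff.1 hp).1

/-- At a puncture the factor `exp₁ (φ z)` is finite and nonzero, so the sign of the exponent in the
chart decides the value. -/
theorem ext_eq_zero_iff (H : IsProjection f g ℓ Φ) (h : FinRep Φ p φ) (hp : p ∉ punctured) :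
    (ext (projDom f) g p = zero ↔ 0 < chartExp ℓ p) ∧
      (ext (projDom f) g p = inf ↔ chartExp ℓ p < 0) := by
  have hU := H.nearlyContains_of_finRep h
  by_cases hk : 0 ≤ chartExp ℓ p
  · rw [(H.finRep_proj h (Or.inr hk)).ext_self hU (H.finRep_proj_self h),
      coord_of_notMem_punctured hp]
    refine ⟨?_, iff_of_false (coe_ne_inf _) (not_lt.2 hk)⟩
    rw [zero, coe_inj]
    rcases hk.eq_or_lt with h0 | h0
    · rw [← h0]
      simp [exp₁_ne_zero]
    · rw [zero_zpow _ h0.ne']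
      simp [h0]
  · push Not at hk
    rw [(H.poleRep_proj h hp hk).ext_self hU fun h => absurd (H.projDom_subset_punctured h) hp]
    exact ⟨iff_of_false (inf_ne_coe _) (not_lt.2 hk.le), iff_of_true rfl hk⟩

theorem mem_critPts_iff_of_puncture (H : IsProjection f g ℓ Φ) (h : FinRep Φ p φ)
    (hp : p ∉ punctured) (hk : chartExp ℓ p ≠ 0) :
    p ∈ critPts (projDom f) g ↔ 2 ≤ |chartExp ℓ p| := by
  have hU := H.nearlyContains_of_finRep h
  have hφ := h.1
  have hp0 := coord_of_notMem_punctured hp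
  rw [hp0] at hφ
  rcases lt_or_gt_of_ne hk with hk | hk
  · rw [(H.poleRep_proj h hp hk).mem_critPts_iff hU
      fun h => absurd (H.projDom_subset_punctured h) hp, hp0, abs_of_neg hk]
    exact deriv_zpow_mul_zero_iff ((analyticAt_exp₁ _).comp hφ.neg) (exp₁_ne_zero _) (by omega)
  · rw [(H.finRep_proj h (Or.inr hk.le)).mem_critPts_iff hU (H.finRep_proj_self h), hp0,
      abs_of_pos hk]
    exact deriv_zpow_mul_zero_iff ((analyticAt_exp₁ _).comp hφ) (exp₁_ne_zero _) (by omega)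

/-- The value `0` is omitted on `ℂ*`, so it can only be taken at the puncture where `w ^ ℓ`
vanishes, and there its multiplicity is `|ℓ|`. -/
theorem zero_mem_critVals_iff (H : IsProjection f g ℓ Φ) :
    zero ∈ critVals (projDom f) g ↔ 2 ≤ |ℓ| ∧ ∃ φ, FinRep Φ (zeroEnd ℓ) φ := by
  constructor
  · rintro ⟨c, hc, hc0⟩
    obtain ⟨φ, hφ⟩ := H.mem_dom_iff.1 hc.1
    have hp : c ∉ punctured := fun hp => (H.ext_proj_punctured hp hc.1).1 hc0
    have hk := (H.ext_eq_zero_iff hφ hp).1.1 hc0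
    have h2 := (H.mem_critPts_iff_of_puncture hφ hp hk.ne').1 hc
    rcases notMem_punctured_iff.1 hp with rfl | rfl
    · rw [chartExp_zero] at hk h2
      exact ⟨h2, φ, by rwa [zeroEnd, if_pos hk]⟩
    · rw [chartExp_inf] at hk h2
      exact ⟨by rwa [abs_neg] at h2, φ, by rwa [zeroEnd, if_neg (by omega)]⟩
  · rintro ⟨h2, φ, hφ⟩
    have key : zeroEnd ℓ ∉ punctured ∧ chartExp ℓ (zeroEnd ℓ) = |ℓ| := by
      by_cases h : 0 < ℓ
      · rw [zeroEnd, if_pos h, chartExp_zero, abs_of_pos h]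
        exact ⟨notMem_punctured_iff.2 (Or.inl rfl), rfl⟩
      · rw [zeroEnd, if_neg h, chartExp_inf, abs_of_nonpos (not_lt.1 h)]
        exact ⟨notMem_punctured_iff.2 (Or.inr rfl), rfl⟩
    have hk : 0 < chartExp ℓ (zeroEnd ℓ) := by omega
    refine ⟨zeroEnd ℓ, (H.mem_critPts_iff_of_puncture hφ key.1 hk.ne').2 ?_,
      (H.ext_eq_zero_iff hφ key.1).1.2 hk⟩
    rwa [key.2, abs_abs]

theorem inf_mem_critVals_iff (H : IsProjection f g ℓ Φ) :
    inf ∈ critVals (projDom f) g ↔ 2 ≤ |ℓ| ∧ ∃ φ, FinRep Φ (poleEnd ℓ) φ := by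
  constructor
  · rintro ⟨c, hc, hc0⟩
    obtain ⟨φ, hφ⟩ := H.mem_dom_iff.1 hc.1
    have hp : c ∉ punctured := fun hp => (H.ext_proj_punctured hp hc.1).2 hc0
    have hk := (H.ext_eq_zero_iff hφ hp).2.1 hc0
    have h2 := (H.mem_critPts_iff_of_puncture hφ hp hk.ne).1 hc
    rcases notMem_punctured_iff.1 hp with rfl | rfl
    · rw [chartExp_zero] at hk h2
      exact ⟨h2, φ, by rwa [poleEnd, if_neg (by omega)]⟩
    · rw [chartExp_inf] at hk h2
      exact ⟨by rwa [abs_neg] at h2, φ, by rwa [poleEnd, if_pos (by omega)]⟩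
  · rintro ⟨h2, φ, hφ⟩
    have key : poleEnd ℓ ∉ punctured ∧ chartExp ℓ (poleEnd ℓ) = -|ℓ| := by
      by_cases h : 0 < ℓ
      · rw [poleEnd, if_pos h, chartExp_inf, abs_of_pos h]
        exact ⟨notMem_punctured_iff.2 (Or.inr rfl), rfl⟩
      · rw [poleEnd, if_neg h, chartExp_zero, abs_of_nonpos (not_lt.1 h), neg_neg]
        exact ⟨notMem_punctured_iff.2 (Or.inl rfl), rfl⟩
    have hk : chartExp ℓ (poleEnd ℓ) < 0 := by omega
    refine ⟨poleEnd ℓ, (H.mem_critPts_iff_of_puncture hφ key.1 hk.ne).2 ?_,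
      (H.ext_eq_zero_iff hφ key.1).2.2 hk⟩
    rwa [key.2, abs_neg, abs_abs]

end IsProjection

/-! ### Simple pseudoperiodicity -/

/-- Since `‖exp₁ z‖ = exp (-2π Im z)`, the upper end of the plane corresponds to the puncture `0`,
and the lower end to `∞`. -/
theorem tendsto_exp₁_atTop :
    Tendsto (fun z => (exp₁ z : RSphere)) (comap Complex.im atTop) (𝓝[≠] zero) := by
  refine tendsto_nhdsWithin_iff.2 ⟨?_, Eventually.of_forall fun z => (coe_exp₁_mem_punctured z).1⟩
  refine (OnePoint.continuous_coe.tendsto (0 : ℂ)).comp ?_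
  rw [tendsto_zero_iff_norm_tendsto_zero]
  simp only [norm_exp₁]
  refine (Real.tendsto_exp_neg_atTop_nhds_zero).comp ?_
  exact (tendsto_id.const_mul_atTop (by positivity : 0 < 2 * Real.pi)).comp tendsto_comap

theorem tendsto_exp₁_atBot :
    Tendsto (fun z => (exp₁ z : RSphere)) (comap Complex.im atBot) (𝓝[≠] inf) := by
  refine tendsto_nhdsWithin_iff.2 ⟨?_, Eventually.of_forall fun z => (coe_exp₁_mem_punctured z).2⟩
  refine tendsto_coe_inf ?_
  simp only [norm_exp₁]
  refine Real.tendsto_exp_atTop.comp (tendsto_neg_atBot_atTop.comp ?_)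
  exact (tendsto_id.const_mul_atBot (by positivity : 0 < 2 * Real.pi)).comp tendsto_comap

/-- The end of the plane that `exp₁` maps to the puncture `c`. -/
theorem exists_end_filter {c : RSphere} (hc : c ∉ punctured) :
    ∃ l : Filter ℂ, l.NeBot ∧ Tendsto (fun z => (exp₁ z : RSphere)) l (𝓝[≠] c) ∧
      (∀ τ : ℂ, Tendsto (fun z => z + τ) l l) ∧
      ∀ τ : ℂ, τ.im ≠ 0 → ∃ s : ℤ, ∀ z : ℂ, Tendsto (fun n : ℕ => z + (n * s : ℤ) * τ) atTop l := by
  have him : Function.Surjective Complex.im := fun y => ⟨⟨0, y⟩, rfl⟩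
  have hlin : ∀ (s : ℤ) (τ z : ℂ) (n : ℕ),
      (z + ((n * s : ℤ) : ℂ) * τ).im = z.im + (s * τ.im) * n := by
    intro s τ z n
    rw [Complex.add_im, ← Complex.ofReal_intCast, Complex.im_ofReal_mul]
    push_cast
    ring
  rcases notMem_punctured_iff.1 hc with rfl | rfl
  · refine ⟨comap Complex.im atTop, comap_neBot_iff_frequently.2 ?_, tendsto_exp₁_atTop, ?_, ?_⟩
    · exact (Eventually.of_forall fun y => him y).frequently
    · intro τ
      rw [tendsto_comap_iff]
      exact tendsto_atTop_add_const_right _ τ.im tendsto_comap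
    · intro τ hτ
      -- The sign is chosen so that repeated translation by `s * τ` moves upwards.
      have hs : ∃ s : ℤ, 0 < s * τ.im := by
        rcases lt_or_gt_of_ne hτ with h | h
        · exact ⟨-1, by push_cast; linarith⟩
        · exact ⟨1, by push_cast; linarith⟩
      obtain ⟨s, hs⟩ := hs
      refine ⟨s, fun z => ?_⟩
      rw [tendsto_comap_iff]
      have h1 : Tendsto (fun n : ℕ => z.im + (s * τ.im) * n) atTop atTop :=
        tendsto_atTop_add_const_left _ _ (tendsto_natCast_atTop_atTop.const_mul_atTop hs)
      exact h1.congr fun n => (hlin s τ z n).symm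
  · refine ⟨comap Complex.im atBot, comap_neBot_iff_frequently.2 ?_, tendsto_exp₁_atBot, ?_, ?_⟩
    · exact (Eventually.of_forall fun y => him y).frequently
    · intro τ
      rw [tendsto_comap_iff]
      exact tendsto_atBot_add_const_right _ τ.im tendsto_comap
    · intro τ hτ
      have hs : ∃ s : ℤ, s * τ.im < 0 := by
        rcases lt_or_gt_of_ne hτ with h | h
        · exact ⟨1, by push_cast; linarith⟩
        · exact ⟨-1, by push_cast; linarith⟩
      obtain ⟨s, hs⟩ := hs
      refine ⟨s, fun z => ?_⟩
      rw [tendsto_comap_iff]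
      have h1 : Tendsto (fun n : ℕ => z.im + (s * τ.im) * n) atTop atBot :=
        tendsto_atBot_add_const_left _ _ (tendsto_natCast_atTop_atTop.const_mul_atTop_of_neg hs)
      exact h1.congr fun n => (hlin s τ z n).symm

namespace IsProjection

variable {f : ℂ → RSphere} {g : RSphere → RSphere} {ℓ : ℤ} {Φ : RSphere → RSphere} {p : RSphere}
  {φ : ℂ → ℂ}

theorem continuous_outer (H : IsProjection f g ℓ Φ) :
    Continuous fun z => Φ (exp₁ z : RSphere) := by
  refine continuous_iff_continuousAt.2 fun z => ?_
  exact ContinuousAt.comp (f := fun z => (exp₁ z : RSphere))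
    (H.mero _ (coe_exp₁_mem_punctured z)).1
    (OnePoint.continuous_coe.comp continuous_exp₁).continuousAt

theorem hasPseudoperiod_of_period (H : IsProjection f g ℓ Φ) {τ : ℂ}
    (h : ∀ z, Φ (exp₁ (z + τ) : RSphere) = Φ (exp₁ z : RSphere)) :
    HasPseudoperiod f τ (ℓ * τ) := by
  intro z
  rw [H.eq_map, H.eq_map, h z]
  rcases eq_inf_or_coe (Φ (exp₁ z : RSphere)) with h | ⟨c, h⟩
  · rw [h]
    rfl
  · rw [h, map_coe, map_coe, map_coe]
    congr 1
    ring

theorem period_of_hasPseudoperiod (H : IsProjection f g ℓ Φ) {τ : ℂ}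
    (h : HasPseudoperiod f τ (ℓ * τ)) (z : ℂ) :
    Φ (exp₁ (z + τ) : RSphere) = Φ (exp₁ z : RSphere) := by
  have h1 := h z
  rw [H.eq_map, H.eq_map] at h1
  rcases eq_inf_or_coe (Φ (exp₁ z : RSphere)) with h2 | ⟨c, h2⟩
  · rcases eq_inf_or_coe (Φ (exp₁ (z + τ) : RSphere)) with h3 | ⟨d, h3⟩
    · rw [h2, h3]
    · rw [h2, h3, map_coe, map_inf, map_inf] at h1
      exact absurd h1 (coe_ne_inf _)
  · rcases eq_inf_or_coe (Φ (exp₁ (z + τ) : RSphere)) with h3 | ⟨d, h3⟩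
    · rw [h2, h3, map_coe, map_coe, map_inf] at h1
      exact absurd h1 (inf_ne_coe _)
    · rw [h2, h3, map_coe, map_coe, map_coe, coe_inj] at h1
      rw [h2, h3, coe_inj]
      linear_combination h1

/-- If `Φ` has a finite value at a puncture, all pseudoperiods of `f` are periods of
`Φ ∘ exp₁`. -/
theorem hasPseudoperiod_eq (H : IsProjection f g ℓ Φ) (h : FinRep Φ p φ) (hp : p ∉ punctured)
    {τ η : ℂ} (hτ : HasPseudoperiod f τ η) : η = ℓ * τ := by
  obtain ⟨l, hl, hle, hlτ, -⟩ := exists_end_filter hp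
  have h1 : Tendsto (fun z => Φ (exp₁ z : RSphere)) l (𝓝 (φ (coord p p) : RSphere)) :=
    h.continuousAt.comp hle
  have h2 := h1.comp (hlτ τ)
  -- Along the end, `Φ (exp₁ (z + τ)) - Φ (exp₁ z)` tends to `0`, but it equals the constant `η - ℓ
  -- * τ`.
  have h3 := ((continuousAt_toPlane (φ (coord p p))).tendsto.comp h2).sub
    ((continuousAt_toPlane (φ (coord p p))).tendsto.comp h1)
  rw [sub_self] at h3
  have h4 : ∀ᶠ z in l, toPlane (Φ (exp₁ (z + τ) : RSphere)) - toPlane (Φ (exp₁ z : RSphere)) =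
      η - ℓ * τ := by
    filter_upwards [h1.eventually (eventually_ne_inf _), h2.eventually (eventually_ne_inf _)]
      with z hz1 hz2
    obtain ⟨c, hc⟩ := exists_coe_of_ne_inf hz1
    obtain ⟨d, hd⟩ := exists_coe_of_ne_inf hz2
    simp only [Function.comp_apply] at hd
    have h5 := hτ z
    rw [H.eq_coe_of hc, H.eq_coe_of hd, map_coe, coe_inj] at h5
    rw [hc, hd, toPlane_coe, toPlane_coe]
    linear_combination h5
  have h6 := tendsto_nhds_unique (h3.congr' h4) tendsto_const_nhds
  linear_combination -h6

/-- The periods of `Φ ∘ exp₁`. -/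
def periods (Φ : RSphere → RSphere) : AddSubgroup ℂ where
  carrier := {τ | ∀ z, Φ (exp₁ (z + τ) : RSphere) = Φ (exp₁ z : RSphere)}
  zero_mem' z := by rw [add_zero]
  add_mem' {a b} ha hb z := by rw [← add_assoc, hb, ha]
  neg_mem' {a} ha z := by rw [← ha (z + -a), neg_add_cancel_right]

/-- Multiples of a non-real period carry every point into the end of the plane where `Φ ∘ exp₁`
tends to its finite limit, so `Φ ∘ exp₁` would equal that limit everywhere. -/
theorem im_eq_zero_of_period (H : IsProjection f g ℓ Φ) (h : FinRep Φ p φ) (hp : p ∉ punctured)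
    {τ : ℂ} (hτ : τ ∈ periods Φ) : τ.im = 0 := by
  by_contra hne
  obtain ⟨l, hl, hle, -, hlτ⟩ := exists_end_filter hp
  obtain ⟨s, hs⟩ := hlτ τ hne
  refine H.outer_not_const (φ (coord p p) : RSphere) fun z => ?_
  have h1 := (h.continuousAt.comp hle).comp (hs z)
  refine tendsto_nhds_unique ?_ h1
  refine tendsto_const_nhds.congr fun n => ?_
  have h2 : ((n * s : ℤ) : ℂ) * τ ∈ periods Φ := by
    rw [← zsmul_eq_mul]
    exact (periods Φ).zsmul_mem hτ _
  exact (h2 z).symm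

/-- Otherwise `Φ ∘ exp₁` would be constant on the real line, whose points accumulate at `0`,
contradicting the identity theorem. -/
theorem not_all_real_periods (H : IsProjection f g ℓ Φ) :
    ∃ t : ℝ, (t : ℂ) ∉ periods Φ := by
  by_contra! hcon
  obtain ⟨v, hv⟩ : ∃ v, v = Φ (exp₁ 0 : RSphere) := ⟨_, rfl⟩
  have h1 := ((H.mero _ (coe_exp₁_mem_punctured 0)).comp_exp₁).eventually_eq_or_eventually_ne v
  rw [eventually_nhds_iff, eventually_nhdsNE_iff, coord_coe_self, param_coe] at h1
  rcases h1 with h1 | h1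
  · exact H.outer_not_eventually_const v 0 h1
  · have h2 : Tendsto (fun t : ℝ => (t : ℂ)) (𝓝[≠] 0) (𝓝[≠] 0) := by
      refine tendsto_nhdsWithin_iff.2 ⟨?_, ?_⟩
      · have := Complex.continuous_ofReal.tendsto 0
        rw [Complex.ofReal_zero] at this
        exact this.mono_left nhdsWithin_le_nhds
      · filter_upwards [self_mem_nhdsWithin] with t ht
        exact fun h => ht (Complex.ofReal_eq_zero.1 h)
    obtain ⟨t, ht⟩ := (h2.eventually h1).exists
    refine ht ?_
    have h3 := hcon t 0
    rw [zero_add] at h3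
    rw [hv]
    exact h3

/-- If `Φ` has a finite value at a puncture, then `f` is simply pseudoperiodic. -/
theorem isSimplyPseudoperiodic (H : IsProjection f g ℓ Φ) (h : FinRep Φ p φ)
    (hp : p ∉ punctured) : IsSimplyPseudoperiodic f := by
  have hset : {τ : ℂ | ∃ η, HasPseudoperiod f τ η} = periods Φ := by
    ext τ
    constructor
    · rintro ⟨η, hη⟩
      rw [H.hasPseudoperiod_eq h hp hη] at hη
      exact H.period_of_hasPseudoperiod hη
    · intro hτ
      exact ⟨_, H.hasPseudoperiod_of_period hτ⟩
  set S : AddSubgroup ℝ := (periods Φ).comap Complex.ofRealHom.toAddMonoidHom with hS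
  have hSmem : ∀ t : ℝ, t ∈ S ↔ (t : ℂ) ∈ periods Φ := fun t => Iff.rfl
  -- A dense group of periods would, by continuity, consist of all reals. In the cyclic case the
  -- generator is nonzero because `1` is a period.
  rcases S.dense_or_cyclic with hd | ⟨a, ha⟩
  · exfalso
    obtain ⟨t, ht⟩ := H.not_all_real_periods
    refine ht fun z => ?_
    have hcl : IsClosed {t : ℝ | Φ (exp₁ (z + t) : RSphere) = Φ (exp₁ z : RSphere)} :=
      isClosed_eq (H.continuous_outer.comp (by fun_prop : Continuous fun t : ℝ => z + (t : ℂ)))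
        continuous_const
    have hsub : (S : Set ℝ) ⊆ {t : ℝ | Φ (exp₁ (z + t) : RSphere) = Φ (exp₁ z : RSphere)} :=
      fun t ht => ht z
    have := hcl.closure_subset_iff.2 hsub
    exact this (hd t)
  · have hmem : ∀ t : ℝ, (t : ℂ) ∈ periods Φ ↔ ∃ m : ℤ, t = m * a := by
      intro t
      rw [← hSmem, ha, ← AddSubgroup.zmultiples_eq_closure, AddSubgroup.mem_zmultiples_iff]
      simp only [zsmul_eq_mul, eq_comm]
    refine ⟨a, ?_, ?_⟩
    · intro h0
      rw [Complex.ofReal_eq_zero] at h0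
      have h1 : ((1 : ℝ) : ℂ) ∈ periods Φ := fun z => by rw [Complex.ofReal_one, exp₁_add_one]
      obtain ⟨m, hm⟩ := (hmem 1).1 h1
      rw [h0, mul_zero] at hm
      exact one_ne_zero hm
    · rw [hset]
      ext τ
      constructor
      · intro hτ
        have h0 := H.im_eq_zero_of_period h hp hτ
        have h1 : τ = (τ.re : ℂ) := Complex.ext rfl (by simpa using h0)
        have hτ' : ((τ.re : ℝ) : ℂ) ∈ periods Φ := h1 ▸ hτ
        obtain ⟨m, hm⟩ := (hmem _).1 hτ'
        refine ⟨m, ?_⟩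
        rw [h1, hm]
        push_cast
        rfl
      · rintro ⟨m, rfl⟩
        have := (hmem (m * a)).2 ⟨m, rfl⟩
        push_cast at this
        exact this

theorem zeroEnd_notMem_punctured (ℓ : ℤ) : zeroEnd ℓ ∉ punctured := by
  rw [notMem_punctured_iff, zeroEnd]
  split_ifs <;> simp

theorem poleEnd_notMem_punctured (ℓ : ℤ) : poleEnd ℓ ∉ punctured := by
  rw [notMem_punctured_iff, poleEnd]
  split_ifs <;> simp

end IsProjection

/-- The points `z + n`, along which `f` grows by exactly `ℓ * n`, seen in the chart at `∞`. -/
theorem tendsto_inv_add_nat (z : ℂ) : Tendsto (fun n : ℕ => (z + n)⁻¹) atTop (𝓝[≠] 0) := by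
  have h1 : Tendsto (fun n : ℕ => z + (n : ℂ)) atTop (Bornology.cobounded ℂ) := by
    have h2 : Tendsto (fun n : ℕ => (n : ℂ)) atTop (Bornology.cobounded ℂ) := by
      rw [← tendsto_norm_atTop_iff_cobounded]
      simpa using tendsto_natCast_atTop_atTop (R := ℝ)
    rw [← tendsto_norm_atTop_iff_cobounded] at h2 ⊢
    refine tendsto_atTop_mono (fun n => ?_) (tendsto_atTop_add_const_right _ (-‖z‖) h2)
    have := norm_sub_le (z + n) z
    rw [add_sub_cancel_left] at this
    linarith
  refine tendsto_nhdsWithin_iff.2 ⟨Filter.tendsto_inv₀_cobounded.comp h1, ?_⟩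
  have h3 : ∀ᶠ x in Bornology.cobounded ℂ, x ≠ 0 := by
    exact (Bornology.isBounded_def.1 (Bornology.isBounded_singleton (x := (0 : ℂ))))
  exact (h1.eventually h3).mono fun n hn => inv_ne_zero hn

namespace IsProjection

variable {f : ℂ → RSphere} {g : RSphere → RSphere} {ℓ : ℤ} {Φ : RSphere → RSphere} {p : RSphere}
  {φ : ℂ → ℂ}

/-! ### The singular values of `f` -/

theorem hasPseudoperiod_int (H : IsProjection f g ℓ Φ) (m : ℤ) : HasPseudoperiod f m (ℓ * m) :=
  H.hasPseudoperiod_of_period fun z => by rw [exp₁_add_int]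

theorem _root_.RSphere.HasPseudoperiod.eq_coe {τ η : ℂ} (h : HasPseudoperiod f τ η) {z u : ℂ}
    (hz : f z = (u : RSphere)) : f (z + τ) = ((u + η : ℂ) : RSphere) := by
  rw [h z, hz, map_coe]

theorem _root_.RSphere.HasPseudoperiod.neg {τ η : ℂ} (h : HasPseudoperiod f τ η) :
    HasPseudoperiod f (-τ) (-η) := by
  intro z
  have h1 := h (z + -τ)
  rw [neg_add_cancel_right] at h1
  rw [h1]
  rcases eq_inf_or_coe (f (z + -τ)) with h2 | ⟨c, h2⟩
  · rw [h2]
    rfl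
  · rw [h2, map_coe, map_coe, add_neg_cancel_right]

/-- The extension at `∞` is tested along `z + n`, where `f (z + n) = f z + ℓ * n`. If `ℓ = 0`, then
`f z` equals the limit for every `z`. If `ℓ ≠ 0`, the limit must be `∞`, and the expansion of `f` at
this pole to second order forces `f z - ℓ * z` to be independent of `z`. Each case contradicts
transcendence or the existence of a finite value. -/
theorem inf_notMem_dom (H : IsProjection f g ℓ Φ) : inf ∉ dom plane (onSphere f) := by
  intro hd
  obtain ⟨z₀, hz₀⟩ := H.proj.1.1.2
  obtain ⟨u₀, hu₀⟩ := exists_coe_of_ne_inf hz₀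
  have hshift : ∀ (z : ℂ) (u : ℂ), f z = (u : RSphere) → ∀ n : ℕ,
      f (z + n) = ((u + ℓ * n : ℂ) : RSphere) := fun z u h n => by
    have := (H.hasPseudoperiod_int n).eq_coe h
    push_cast at this
    exact this
  have hshift_inf : ∀ z : ℂ, f z = inf → ∀ n : ℕ, f (z + n) = inf := fun z h n => by
    have := H.hasPseudoperiod_int n z
    rw [h, map_inf] at this
    push_cast at this
    exact this
  have hparam : ∀ z : ℂ, ∀ᶠ n : ℕ in atTop, param inf (z + n)⁻¹ = ((z + n : ℂ) : RSphere) := by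
    intro z
    have h1 := (tendsto_inv_add_nat z).eventually (self_mem_nhdsWithin)
    filter_upwards [h1] with n hn
    rw [param_inf]
    dsimp only
    rw [recip_coe_of_ne hn, inv_inv]
  have hseq : ∀ z : ℂ, Tendsto (fun n : ℕ => ((z + n : ℂ) : RSphere)) atTop (𝓝[≠] inf) := by
    intro z
    have h1 : Tendsto (fun n : ℕ => param inf (z + n)⁻¹) atTop (𝓝[≠] inf) := by
      rw [nhdsNE_eq, coord_inf_self]
      exact tendsto_map.comp (tendsto_inv_add_nat z)
    exact h1.congr' (hparam z)
  have hper : ℓ = 0 → ∀ (z : ℂ) (n : ℕ), f (z + n) = f z := by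
    intro h0 z n
    rcases eq_inf_or_coe (f z) with h | ⟨u, h⟩
    · rw [h, hshift_inf z h]
    · rw [hshift z u h, h, h0]
      simp
  obtain ⟨φ, hφ | hφ⟩ := exists_rep_of_mem_dom (nearlyContains_plane inf) hd
  · have hlim : ∀ z, Tendsto (fun n : ℕ => f (z + n)) atTop (𝓝 (φ (coord inf inf) : RSphere)) :=
      fun z => hφ.continuousAt.comp (hseq z)
    by_cases h0 : ℓ = 0
    · refine H.not_affine 0 (φ (coord inf inf)) fun z => ?_
      have h1 := (hlim z).congr (hper h0 z)
      rw [tendsto_nhds_unique tendsto_const_nhds h1]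
      simp
    · have h1 := (hlim z₀).congr (hshift z₀ u₀ hu₀)
      have h2 : Tendsto (fun n : ℕ => ((u₀ + ℓ * n : ℂ) : RSphere)) atTop (𝓝 inf) := by
        refine tendsto_coe_inf ?_
        have h3 : Tendsto (fun n : ℕ => ‖(ℓ : ℂ)‖ * n + -‖u₀‖) atTop atTop :=
          tendsto_atTop_add_const_right _ _ (tendsto_natCast_atTop_atTop.const_mul_atTop
            (norm_pos_iff.2 (Int.cast_ne_zero.2 h0)))
        refine tendsto_atTop_mono (fun n => ?_) h3
        have := norm_sub_le (u₀ + ℓ * n : ℂ) u₀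
        rw [add_sub_cancel_left, norm_mul, Complex.norm_natCast] at this
        linarith
      exact inf_ne_coe _ (tendsto_nhds_unique h2 h1)
  · have hlim : ∀ z, Tendsto (fun n : ℕ => f (z + n)) atTop (𝓝 inf) :=
      fun z => hφ.continuousAt.comp (hseq z)
    by_cases h0 : ℓ = 0
    · exact hz₀ (tendsto_nhds_unique tendsto_const_nhds ((hlim z₀).congr (hper h0 z₀)))
    · obtain ⟨hφa, hφ0, hφe⟩ := hφ
      rw [coord_inf_self] at hφa hφ0 hφe
      have hval : ∀ z, ∀ᶠ n : ℕ in atTop, f (z + n) = recip (φ (z + n)⁻¹ : RSphere) := by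
        intro z
        filter_upwards [(tendsto_inv_add_nat z).eventually hφe, hparam z] with n h1 h2
        rw [h2, onSphere_coe] at h1
        exact h1
      have hφne : ∀ᶠ x in 𝓝[≠] 0, φ x ≠ 0 := by
        rcases hφa.eventually_eq_zero_or_eventually_ne_zero with h | h
        · exfalso
          obtain ⟨n, h1, h2⟩ := ((hval z₀).and ((tendsto_inv_add_nat z₀).eventually
            (h.filter_mono nhdsWithin_le_nhds))).exists
          rw [h2, recip_coe_zero, hshift z₀ u₀ hu₀] at h1
          exact coe_ne_inf _ h1
        · exact h
      have hfin : ∀ z, ∃ u : ℂ, f z = (u : RSphere) := by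
        intro z
        rcases eq_inf_or_coe (f z) with h | h
        · exfalso
          obtain ⟨n, h1, h2⟩ := ((hval z).and ((tendsto_inv_add_nat z).eventually hφne)).exists
          rw [hshift_inf z h, recip_coe_of_ne h2] at h1
          exact inf_ne_coe _ h1
        · exact h
      have hmul : ∀ z u : ℂ, f z = (u : RSphere) → ∀ᶠ n : ℕ in atTop,
          (u + ℓ * n) * φ (z + n)⁻¹ = 1 := by
        intro z u hu
        filter_upwards [hval z, (tendsto_inv_add_nat z).eventually hφne] with n h1 h2
        rw [hshift z u hu, recip_coe_of_ne h2, coe_inj] at h1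
        rw [h1, inv_mul_cancel₀ h2]
      have hslope : Tendsto (fun x => φ x / x) (𝓝[≠] 0) (𝓝 (deriv φ 0)) := by
        have := hφa.differentiableAt.hasDerivAt.tendsto_slope
        refine this.congr fun x => ?_
        rw [slope_def_field, hφ0, sub_zero, sub_zero]
      -- With `x = (z₀ + n)⁻¹`, the identity `(u₀ + ℓ * n) * φ x = 1` is rewritten as `(ℓ + (u₀ - ℓ
      -- * z₀) * x) * (φ x / x) = 1`, and `x → 0`.
      have hder : (ℓ : ℂ) * deriv φ 0 = 1 := by
        have h1 := (tendsto_inv_add_nat z₀).mono_right nhdsWithin_le_nhds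
        have h2 : Tendsto (fun n : ℕ => ((ℓ : ℂ) + (u₀ - ℓ * z₀) * (z₀ + n)⁻¹) *
            (φ (z₀ + n)⁻¹ / (z₀ + n)⁻¹)) atTop (𝓝 ((ℓ + (u₀ - ℓ * z₀) * 0) * deriv φ 0)) :=
          ((h1.const_mul _).const_add _).mul (hslope.comp (tendsto_inv_add_nat z₀))
        rw [mul_zero, add_zero] at h2
        refine tendsto_nhds_unique h2 (tendsto_const_nhds.congr' ?_)
        filter_upwards [hmul z₀ u₀ hu₀,
          (tendsto_inv_add_nat z₀).eventually self_mem_nhdsWithin] with n h3 h4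
        have h5 : (z₀ + n : ℂ) ≠ 0 := fun h => h4 (by rw [h, inv_zero]; rfl)
        rw [← h3]
        field_simp
        ring
      -- This is the analytic continuation of `x * f (1 / x)` to `x = 0`, with value `ℓ` there.
      set K : ℂ → ℂ := fun x => (dslope φ 0 x)⁻¹ with hK
      have hd0 : dslope φ 0 0 = deriv φ 0 := dslope_same φ 0
      have hdne : deriv φ 0 ≠ 0 := fun h => by
        rw [h, mul_zero] at hder
        exact zero_ne_one hder
      have hds : AnalyticAt ℂ (dslope φ 0) 0 := by
        obtain ⟨P, hP⟩ := hφa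
        exact (hP.has_fpower_series_dslope_fslope).analyticAt
      have hKa : AnalyticAt ℂ K 0 := hds.fun_inv (by rwa [hd0])
      have hK0 : K 0 = ℓ := by
        simp only [hK, hd0]
        exact (eq_inv_of_mul_eq_one_left hder).symm
      have hKs : Tendsto (slope K 0) (𝓝[≠] 0) (𝓝 (deriv K 0)) :=
        hKa.differentiableAt.hasDerivAt.tendsto_slope
      refine H.not_affine ℓ (deriv K 0) fun z => ?_
      obtain ⟨u, hu⟩ := hfin z
      rw [hu, coe_inj]
      -- The difference quotient of `K` at `x = (z + n)⁻¹` is `(x * (u + ℓ * n) - ℓ) / x = u - ℓ *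
      -- z`, for every large `n`.
      have h6 : u - ℓ * z = deriv K 0 := by
        refine tendsto_nhds_unique (tendsto_const_nhds.congr' ?_)
          (hKs.comp (tendsto_inv_add_nat z))
        filter_upwards [hmul z u hu,
          (tendsto_inv_add_nat z).eventually self_mem_nhdsWithin] with n h3 h4
        have h4' : (z + n : ℂ)⁻¹ ≠ 0 := h4
        have h5 : (z + n : ℂ) ≠ 0 := fun h => h4 (by rw [h, inv_zero]; rfl)
        have h7 : K (z + n)⁻¹ = (z + n)⁻¹ * (u + ℓ * n) := by
          simp only [hK]
          rw [dslope_of_ne _ h4', slope_def_field, hφ0, sub_zero, sub_zero, inv_div,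
            div_eq_mul_inv, ← eq_inv_of_mul_eq_one_left h3]
        rw [Function.comp_apply, slope_def_field, hK0, h7, sub_zero]
        field_simp
        ring
      linear_combination h6

theorem mem_dom_plane_iff (H : IsProjection f g ℓ Φ) : p ∈ dom plane (onSphere f) ↔ p ≠ inf := by
  constructor
  · rintro hp rfl
    exact H.inf_notMem_dom hp
  · intro hp
    obtain ⟨z, rfl⟩ := exists_coe_of_ne_inf hp
    exact ⟨onSphere f, H.isMeroAt z, Eventually.of_forall fun _ _ => rfl⟩

theorem ext_plane (H : IsProjection f g ℓ Φ) (z : ℂ) :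
    ext plane (onSphere f) (z : RSphere) = f z :=
  ext_eq_of_tendsto (nearlyContains_plane _)
    ((H.isMeroAt z).1.tendsto.mono_left nhdsWithin_le_nhds) fun _ => rfl

theorem finRep_plane (H : IsProjection f g ℓ Φ) {z : ℂ} (h : FinRep Φ (exp₁ z : RSphere) φ) :
    FinRep (onSphere f) (z : RSphere) fun y => ℓ * y + φ (exp₁ y) := by
  obtain ⟨ha, hφ⟩ := h
  rw [coord_coe_self] at ha
  rw [coord_coe_self, param_coe] at hφ
  rw [FinRep, coord_coe_self, param_coe]
  refine ⟨(analyticAt_const.mul analyticAt_id).add (AnalyticAt.fun_comp ha (analyticAt_exp₁ z)), ?_⟩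
  filter_upwards [(eventually_nhdsNE_exp₁ z).eventually hφ] with y hy
  exact H.eq_coe_of hy

theorem finRep_plane_self (H : IsProjection f g ℓ Φ) {z : ℂ} {ψ : ℂ → ℂ}
    (h : FinRep (onSphere f) (z : RSphere) ψ) : f z = (ψ z : RSphere) := by
  have h1 := h.continuousAt
  rw [coord_coe_self] at h1
  exact tendsto_nhds_unique ((H.isMeroAt z).1.tendsto.mono_left nhdsWithin_le_nhds) h1

theorem mem_critPts_plane_iff (H : IsProjection f g ℓ Φ) {z : ℂ} {ψ : ℂ → ℂ}
    (h : FinRep (onSphere f) (z : RSphere) ψ) :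
    (z : RSphere) ∈ critPts plane (onSphere f) ↔ deriv ψ z = 0 := by
  have := h.mem_critPts_iff (nearlyContains_plane _) fun _ => by
    rw [coord_coe_self]
    exact H.finRep_plane_self h
  rwa [coord_coe_self] at this

theorem exists_finRep_of_eq_coe (H : IsProjection f g ℓ Φ) {z u : ℂ} (h : f z = (u : RSphere)) :
    ∃ φ, FinRep Φ (exp₁ z : RSphere) φ :=
  H.exists_finRep ⟨z, by rw [h]; exact coe_ne_inf u, rfl⟩

/-- `exp₁` maps the critical points of `f` with finite value to those of the projection. -/
theorem mem_critPts_plane_iff_proj (H : IsProjection f g ℓ Φ) {z u : ℂ} (h : f z = (u : RSphere)) :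
    (z : RSphere) ∈ critPts plane (onSphere f) ↔ (exp₁ z : RSphere) ∈ critPts (projDom f) g := by
  obtain ⟨φ, hφ⟩ := H.exists_finRep_of_eq_coe h
  rw [H.mem_critPts_plane_iff (H.finRep_plane hφ),
    (H.finRep_proj hφ (Or.inl (coe_exp₁_mem_punctured z))).mem_critPts_iff
      (H.nearlyContains_of_finRep hφ) (H.finRep_proj_self hφ), chartExp_coe, coord_coe_self]
  have hφa := hφ.1
  rw [coord_coe_self] at hφa
  have h1 := hφa.differentiableAt.hasDerivAt
  have hw := exp₁_ne_zero z
  have h2 : HasDerivAt (fun y => ℓ * y + φ (exp₁ y))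
      (ℓ + deriv φ (exp₁ z) * (2 * Real.pi * Complex.I * exp₁ z)) z :=
    ((hasDerivAt_id z).const_mul (ℓ : ℂ)).congr_deriv (mul_one _) |>.add
      (HasDerivAt.comp z h1 (hasDerivAt_exp₁ z))
  have h3 : HasDerivAt (fun w => w ^ ℓ * exp₁ (φ w))
      (ℓ * exp₁ z ^ (ℓ - 1) * exp₁ (φ (exp₁ z)) + exp₁ z ^ ℓ *
        (2 * Real.pi * Complex.I * exp₁ (φ (exp₁ z)) * deriv φ (exp₁ z))) (exp₁ z) :=
    (hasDerivAt_zpow ℓ (exp₁ z) (Or.inl hw)).mul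
      (HasDerivAt.comp (h₂ := exp₁) (exp₁ z) (hasDerivAt_exp₁ (φ (exp₁ z))) h1)
  rw [h2.deriv, h3.deriv]
  -- The derivative of `w ^ ℓ * exp₁ (φ w)` is a nonzero multiple of the derivative of `f` at `z`.
  have h4 : ℓ * exp₁ z ^ (ℓ - 1) * exp₁ (φ (exp₁ z)) + exp₁ z ^ ℓ *
        (2 * Real.pi * Complex.I * exp₁ (φ (exp₁ z)) * deriv φ (exp₁ z)) =
      (exp₁ z ^ (ℓ - 1) * exp₁ (φ (exp₁ z))) *
        (ℓ + deriv φ (exp₁ z) * (2 * Real.pi * Complex.I * exp₁ z)) := by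
    have : exp₁ z ^ ℓ = exp₁ z ^ (ℓ - 1) * exp₁ z := by
      rw [← zpow_add_one₀ hw, sub_add_cancel]
    rw [this]
    ring
  rw [h4, mul_eq_zero]
  exact (or_iff_right (mul_ne_zero (zpow_ne_zero _ hw) (exp₁_ne_zero _))).symm

/-- Finite asymptotic values of `f`, in terms of paths in the plane. -/
theorem coe_mem_asympVals_plane_iff (H : IsProjection f g ℓ Φ) {u : ℂ} :
    (u : RSphere) ∈ asympVals plane (onSphere f) ↔ ∃ (ζ : ℝ → ℂ) (t₀ : ℝ), t₀ < 1 ∧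
      ContinuousOn ζ (Ico t₀ 1) ∧ Tendsto (fun t => ‖ζ t‖) (𝓝[<] 1) atTop ∧
      Tendsto (fun t => f (ζ t)) (𝓝[<] 1) (𝓝 (u : RSphere)) := by
  constructor
  · rintro ⟨γ, hγ, hd, ⟨e, he, hγe⟩, hv⟩
    have he' : e = inf := by
      by_contra hne
      exact he (H.mem_dom_plane_iff.2 hne)
    subst he'
    have hcoe : ∀ t ∈ Ico (0 : ℝ) 1, ((toPlane (γ t) : ℂ) : RSphere) = γ t := fun t ht =>
      coe_toPlane (H.mem_dom_plane_iff.1 (hd t ht))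
    have hIco : Ico (0 : ℝ) 1 ∈ 𝓝[<] (1 : ℝ) := Ico_mem_nhdsLT one_pos
    refine ⟨fun t => toPlane (γ t), 0, one_pos, ?_, ?_, ?_⟩
    · intro t ht
      have h1 := continuousAt_toPlane (toPlane (γ t))
      rw [hcoe t ht] at h1
      exact h1.comp_continuousWithinAt (hγ t ht)
    · refine tendsto_norm_of_tendsto_coe_inf (hγe.congr' ?_)
      filter_upwards [hIco] with t ht
      exact (hcoe t ht).symm
    · refine hv.congr' ?_
      filter_upwards [hIco] with t ht
      rw [← hcoe t ht, H.ext_plane]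
      rfl
  · rintro ⟨ζ, t₀, ht₀, hζ, hinf, hv⟩
    refine mem_asympVals_of_path (γ := fun t => (ζ t : RSphere)) (e := inf) ht₀
      (OnePoint.continuous_coe.comp_continuousOn hζ)
      (fun t _ => H.mem_dom_plane_iff.2 (coe_ne_inf _)) H.inf_notMem_dom (tendsto_coe_inf hinf) ?_
    exact hv.congr fun t => (H.ext_plane (ζ t)).symm

theorem coe_mem_critVals_plane_iff (H : IsProjection f g ℓ Φ) {u : ℂ} :
    (u : RSphere) ∈ critVals plane (onSphere f) ↔
      ∃ z : ℂ, (z : RSphere) ∈ critPts plane (onSphere f) ∧ f z = (u : RSphere) := by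
  constructor
  · rintro ⟨c, hc, hcu⟩
    obtain ⟨z, rfl⟩ := exists_coe_of_ne_inf (H.mem_dom_plane_iff.1 hc.1)
    exact ⟨z, hc, by rw [← H.ext_plane, hcu]⟩
  · rintro ⟨z, hz, hu⟩
    exact ⟨z, hz, by rw [H.ext_plane, hu]⟩

theorem add_mem_critVals_plane (H : IsProjection f g ℓ Φ) {τ η : ℂ} (h : HasPseudoperiod f τ η)
    {u : ℂ} (hu : (u : RSphere) ∈ critVals plane (onSphere f)) :
    ((u + η : ℂ) : RSphere) ∈ critVals plane (onSphere f) := by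
  rw [H.coe_mem_critVals_plane_iff] at hu ⊢
  obtain ⟨z, hz, hzu⟩ := hu
  refine ⟨z + τ, ?_, h.eq_coe hzu⟩
  obtain ⟨φ, hφ⟩ := H.exists_finRep_of_eq_coe hzu
  set ψ : ℂ → ℂ := fun y => ℓ * y + φ (exp₁ y)
  have hψ : FinRep (onSphere f) (z : RSphere) ψ := H.finRep_plane hφ
  have hψ' : FinRep (onSphere f) ((z + τ : ℂ) : RSphere) fun y => ψ (y - τ) + η := by
    obtain ⟨h1, h2⟩ := hψ
    rw [coord_coe_self] at h1
    rw [coord_coe_self, param_coe] at h2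
    rw [FinRep, coord_coe_self, param_coe]
    refine ⟨?_, ?_⟩
    · refine AnalyticAt.add (AnalyticAt.fun_comp ?_ (by fun_prop)) analyticAt_const
      rwa [add_sub_cancel_right]
    · have h3 : Tendsto (fun y => y - τ) (𝓝[≠] (z + τ)) (𝓝[≠] z) := by
        refine tendsto_nhdsWithin_iff.2 ⟨?_, ?_⟩
        · have : Continuous fun y : ℂ => y - τ := by fun_prop
          have h4 := this.tendsto (z + τ)
          rw [add_sub_cancel_right] at h4
          exact h4.mono_left nhdsWithin_le_nhds
        · filter_upwards [self_mem_nhdsWithin] with y hy heq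
          exact hy (sub_eq_iff_eq_add.1 heq)
      filter_upwards [h3.eventually h2] with y hy
      rw [onSphere_coe] at hy ⊢
      have := h.eq_coe hy
      rwa [sub_add_cancel] at this
  rw [H.mem_critPts_plane_iff hψ] at hz
  rw [H.mem_critPts_plane_iff hψ', deriv_add_const, deriv_comp_sub_const, add_sub_cancel_right, hz]

theorem add_mem_asympVals_plane (H : IsProjection f g ℓ Φ) {τ η : ℂ} (h : HasPseudoperiod f τ η)
    {u : ℂ} (hu : (u : RSphere) ∈ asympVals plane (onSphere f)) :
    ((u + η : ℂ) : RSphere) ∈ asympVals plane (onSphere f) := by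
  rw [H.coe_mem_asympVals_plane_iff] at hu ⊢
  obtain ⟨ζ, t₀, ht₀, hζ, hinf, hv⟩ := hu
  refine ⟨fun t => ζ t + τ, t₀, ht₀, hζ.add continuousOn_const, ?_, ?_⟩
  · refine tendsto_atTop_mono (fun t => ?_) (tendsto_atTop_add_const_right _ (-‖τ‖) hinf)
    have := norm_sub_le (ζ t + τ) τ
    rw [add_sub_cancel_right] at this
    linarith
  · have h1 : Tendsto (fun t => toPlane (f (ζ t)) + η) (𝓝[<] 1) (𝓝 (u + η)) :=
      ((continuousAt_toPlane u).tendsto.comp hv).add_const η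
    refine ((OnePoint.continuous_coe.tendsto (u + η)).comp h1).congr' ?_
    filter_upwards [hv.eventually (eventually_ne_inf u)] with t ht
    exact (h.eq_coe (coe_toPlane ht).symm).symm

end IsProjection

namespace IsProjection

variable {f : ℂ → RSphere} {g : RSphere → RSphere} {ℓ : ℤ} {Φ : RSphere → RSphere} {p : RSphere}
  {φ : ℂ → ℂ}

/-! ### Critical values of the projection -/

theorem proj_exp₁ (H : IsProjection f g ℓ Φ) {z u : ℂ} (h : f z = (u : RSphere)) :
    g (exp₁ z : RSphere) = (exp₁ u : RSphere) := H.proj.2 z u h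

theorem exp₁_mem_projDom (_H : IsProjection f g ℓ Φ) {z u : ℂ} (h : f z = (u : RSphere)) :
    (exp₁ z : RSphere) ∈ projDom f := ⟨z, by rw [h]; exact coe_ne_inf u, rfl⟩

/-- For `ℓ ≠ 0` the punctures can only contribute the values `0` and `∞`, so a critical point with
value in `ℂ*` lies in `ℂ*` and lifts through `exp₁`. -/
theorem critVals_proj_inter (H : IsProjection f g ℓ Φ) (hℓ : ℓ ≠ 0) :
    critVals (projDom f) g ∩ punctured = exp₁Image (critVals plane (onSphere f)) := by
  ext v
  constructor
  · rintro ⟨⟨c, hc, hcv⟩, hv⟩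
    obtain ⟨φ, hφ⟩ := H.mem_dom_iff.1 hc.1
    have hcp : c ∈ punctured := by
      by_contra hcp
      have h1 := H.ext_eq_zero_iff hφ hcp
      have hk : chartExp ℓ c ≠ 0 := by
        rw [chartExp]
        split_ifs <;> omega
      rcases lt_or_gt_of_ne hk with hk | hk
      · exact hv.2 (by rw [← hcv, h1.2.2 hk])
      · exact hv.1 (by rw [← hcv, h1.1.2 hk])
    have hcd := H.mem_projDom_of_mem_dom hcp hc.1
    obtain ⟨z, hz, rfl⟩ := hcd
    obtain ⟨u, hu⟩ := exists_coe_of_ne_inf hz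
    refine ⟨u, H.coe_mem_critVals_plane_iff.2 ⟨z, (H.mem_critPts_plane_iff_proj hu).2 hc, hu⟩, ?_⟩
    rw [← hcv, H.ext_proj (H.exp₁_mem_projDom hu), H.proj_exp₁ hu]
  · rintro ⟨u, hu, rfl⟩
    obtain ⟨z, hz, hzu⟩ := H.coe_mem_critVals_plane_iff.1 hu
    refine ⟨⟨(exp₁ z : RSphere), (H.mem_critPts_plane_iff_proj hzu).1 hz, ?_⟩,
      coe_exp₁_mem_punctured u⟩
    rw [H.ext_proj (H.exp₁_mem_projDom hzu), H.proj_exp₁ hzu]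

theorem chartExp_eq_zero (h : ℓ = 0) (p : RSphere) : chartExp ℓ p = 0 := by
  rw [chartExp, h]
  simp

/-- For `ℓ = 0` the relation `g = exp₁ ∘ Φ` persists at the punctures, and `exp₁` has no critical
points. -/
theorem ext_proj_of_periodic (H : IsProjection f g ℓ Φ) (hℓ : ℓ = 0) (h : FinRep Φ p φ) :
    ext punctured Φ p = (φ (coord p p) : RSphere) ∧
      ext (projDom f) g p = (exp₁ (φ (coord p p)) : RSphere) ∧
      (p ∈ critPts (projDom f) g ↔ p ∈ critPts punctured Φ) := by
  have hk := chartExp_eq_zero hℓ p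
  have h1 := H.finRep_proj h (Or.inr hk.ge)
  have hU := H.nearlyContains_of_finRep h
  have h2 := H.finRep_proj_self h
  refine ⟨h.ext_self (nearlyContains_punctured p) fun hp => H.finRep_self hp h, ?_, ?_⟩
  · rw [h1.ext_self hU h2, hk, zpow_zero, one_mul]
  · rw [h1.mem_critPts_iff hU h2,
      h.mem_critPts_iff (nearlyContains_punctured p) fun hp => H.finRep_self hp h]
    simp only [hk, zpow_zero, one_mul]
    have h3 : HasDerivAt (fun z => exp₁ (φ z))
        (2 * Real.pi * Complex.I * exp₁ (φ (coord p p)) * deriv φ (coord p p)) (coord p p) :=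
      HasDerivAt.comp (h₂ := exp₁) (coord p p) (hasDerivAt_exp₁ _) h.1.differentiableAt.hasDerivAt
    rw [h3.deriv, mul_eq_zero]
    exact or_iff_right (mul_ne_zero Complex.two_pi_I_ne_zero (exp₁_ne_zero _))

theorem critVals_proj_inter_of_periodic (H : IsProjection f g ℓ Φ) (hℓ : ℓ = 0) :
    critVals (projDom f) g ∩ punctured = exp₁Image (critVals punctured Φ) := by
  ext v
  constructor
  · rintro ⟨⟨c, hc, rfl⟩, -⟩
    obtain ⟨φ, hφ⟩ := H.mem_dom_iff.1 hc.1
    obtain ⟨h1, h2, h3⟩ := H.ext_proj_of_periodic hℓ hφ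
    exact ⟨φ (coord c c), ⟨c, h3.1 hc, h1⟩, h2⟩
  · rintro ⟨u, ⟨c, hc, hcu⟩, rfl⟩
    refine ⟨?_, coe_exp₁_mem_punctured u⟩
    obtain ⟨φ, hφ⟩ : ∃ φ, FinRep Φ c φ := by
      rw [H.exists_finRep_iff, mem_union, not_or]
      refine ⟨not_not.2 hc.1, fun h => ?_⟩
      rw [h.2] at hcu
      exact inf_ne_coe _ hcu
    obtain ⟨h1, h2, h3⟩ := H.ext_proj_of_periodic hℓ hφ
    rw [h1, coe_inj] at hcu
    exact ⟨c, h3.2 hc, by rw [h2, hcu]⟩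

/-! ### Asymptotic values of the projection -/

theorem eventually_mem_punctured {ι : Type*} {l : Filter ι} {γ : ι → RSphere} {e : RSphere}
    (hγ : Tendsto γ l (𝓝 e)) (hne : ∀ᶠ t in l, γ t ≠ e) : ∀ᶠ t in l, γ t ∈ punctured :=
  (tendsto_nhdsWithin_iff.2 ⟨hγ, hne⟩).eventually (nearlyContains_punctured e)

theorem continuousAt_toPlane_comp (H : IsProjection f g ℓ Φ) {z : ℂ} (hz : f z ≠ inf) :
    ContinuousAt (fun y => toPlane (f y)) z := by
  obtain ⟨u, hu⟩ := exists_coe_of_ne_inf hz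
  have h1 : ContinuousAt f z := by
    have h2 := (H.isMeroAt z).1
    exact ContinuousAt.comp (f := ((↑) : ℂ → RSphere)) h2
      OnePoint.continuous_coe.continuousAt
  refine ContinuousAt.comp (g := toPlane) ?_ h1
  rw [hu]
  exact continuousAt_toPlane u

/-- A path on which the projection has a nonzero finite limit lifts to the plane. -/
theorem exists_lift_of_mem_asympVals (H : IsProjection f g ℓ Φ) {v : RSphere}
    (hv : v ∈ asympVals (projDom f) g) (hvp : v ∈ punctured) :
    ∃ (ζ : ℝ → ℂ) (t₀ : ℝ) (e : RSphere) (u : ℂ), t₀ < 1 ∧ ContinuousOn ζ (Ioo t₀ 1) ∧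
      e ∈ ess (projDom f) g ∧ e ∉ punctured ∧
      Tendsto (fun t => (exp₁ (ζ t) : RSphere)) (𝓝[<] 1) (𝓝 e) ∧
      Tendsto (fun t => f (ζ t)) (𝓝[<] 1) (𝓝 (u : RSphere)) ∧ v = (exp₁ u : RSphere) := by
  obtain ⟨γ, hγ, hd, ⟨e, he, hγe⟩, hγv⟩ := hv
  have hIco : Ico (0 : ℝ) 1 ∈ 𝓝[<] (1 : ℝ) := Ico_mem_nhdsLT one_pos
  have hne : ∀ᶠ t in 𝓝[<] (1 : ℝ), γ t ≠ e := by
    filter_upwards [hIco] with t ht heq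
    exact he (heq ▸ hd t ht)
  have hev : ∀ᶠ t in 𝓝[<] (1 : ℝ), t ∈ Ico (0 : ℝ) 1 ∧ γ t ∈ projDom f := by
    filter_upwards [hIco, eventually_mem_punctured hγe hne] with t h1 h2
    exact ⟨h1, H.mem_projDom_of_mem_dom h2 (hd t h1)⟩
  obtain ⟨t₀, ht₀, hsub⟩ := (mem_nhdsLT_iff_exists_Ioo_subset' (a := (1 : ℝ)) one_pos).1 hev
  rw [mem_Iio] at ht₀
  have hIoo : Ioo t₀ 1 ∈ 𝓝[<] (1 : ℝ) := Ioo_mem_nhdsLT ht₀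
  have hcoe : ∀ t ∈ Ioo t₀ 1, ((toPlane (γ t) : ℂ) : RSphere) = γ t := fun t ht =>
    coe_toPlane (H.projDom_subset_punctured (hsub ht).2).2
  have hwc : ContinuousOn (fun t => toPlane (γ t)) (Ioo t₀ 1) := by
    intro t ht
    have h1 := continuousAt_toPlane (toPlane (γ t))
    rw [hcoe t ht] at h1
    exact h1.comp_continuousWithinAt ((hγ t (hsub ht).1).mono fun s hs => (hsub hs).1)
  obtain ⟨ζ, hζ, hζw⟩ := exists_lift_exp₁ ht₀ hwc fun t ht h0 => by
    have h1 := H.projDom_subset_punctured (hsub ht).2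
    rw [← hcoe t ht, h0] at h1
    exact h1.1 rfl
  have hζγ : ∀ t ∈ Ioo t₀ 1, (exp₁ (ζ t) : RSphere) = γ t := fun t ht => by
    rw [hζw t ht, hcoe t ht]
  have hfin : ∀ t ∈ Ioo t₀ 1, f (ζ t) ≠ inf := fun t ht h => by
    have h1 := (H.mem_projDom_iff.1 (hsub ht).2).2
    rw [← hζγ t ht] at h1
    exact h1 ((H.eq_inf_iff _).1 h)
  set Z : ℝ → ℂ := fun t => toPlane (f (ζ t)) with hZ
  have hZc : ContinuousOn Z (Ioo t₀ 1) := fun t ht =>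
    (H.continuousAt_toPlane_comp (hfin t ht)).comp_continuousWithinAt (hζ t ht)
  have hZf : ∀ t ∈ Ioo t₀ 1, f (ζ t) = (Z t : RSphere) := fun t ht => (coe_toPlane (hfin t ht)).symm
  have hγe' : Tendsto (fun t => (exp₁ (ζ t) : RSphere)) (𝓝[<] 1) (𝓝 e) := by
    refine hγe.congr' ?_
    filter_upwards [hIoo] with t ht
    exact (hζγ t ht).symm
  obtain ⟨u₀, rfl⟩ := mem_punctured_iff.1 hvp
  have hZlim : Tendsto (fun t => exp₁ (Z t)) (𝓝[<] 1) (𝓝 (exp₁ u₀)) := by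
    refine ((continuousAt_toPlane (exp₁ u₀)).tendsto.comp hγv).congr' ?_
    filter_upwards [hIoo] with t ht
    rw [Function.comp_apply, H.ext_proj (hsub ht).2, ← hζγ t ht, H.proj_exp₁ (hZf t ht), toPlane_coe]
  obtain ⟨u, hu, hZu⟩ := exists_tendsto_of_tendsto_exp₁ ht₀ hZc hZlim
  have hfu : Tendsto (fun t => f (ζ t)) (𝓝[<] 1) (𝓝 (u : RSphere)) := by
    refine ((OnePoint.continuous_coe.tendsto u).comp hZu).congr' ?_
    filter_upwards [hIoo] with t ht
    exact (hZf t ht).symm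
  refine ⟨ζ, t₀, e, u, ht₀, hζ, he, fun hep => ?_, hγe', hfu, by rw [hu]⟩
  -- If the path ended in `ℂ*`, its lift would converge to some `z₁` with `f z₁ = u` finite, and the
  -- end would lie in the domain of `g`.
  obtain ⟨z₀, rfl⟩ := mem_punctured_iff.1 hep
  have h1 : Tendsto (fun t => exp₁ (ζ t)) (𝓝[<] 1) (𝓝 (exp₁ z₀)) :=
    ((continuousAt_toPlane (exp₁ z₀)).tendsto.comp hγe')
  obtain ⟨z₁, hz₁, hlim⟩ := exists_tendsto_of_tendsto_exp₁ ht₀ hζ h1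
  have h2 : ContinuousAt f z₁ := ContinuousAt.comp (f := ((↑) : ℂ → RSphere)) (H.isMeroAt z₁).1
    OnePoint.continuous_coe.continuousAt
  have h3 := tendsto_nhds_unique (h2.tendsto.comp hlim) hfu
  refine he (H.projDom_subset_dom ?_)
  rw [← hz₁]
  exact H.exp₁_mem_projDom h3

/-- A closed disc has compact image in `ℂ*`, which misses a neighbourhood of the puncture. -/
theorem tendsto_norm_of_tendsto_exp₁ {ι : Type*} {l : Filter ι} {ζ : ι → ℂ} {e : RSphere}
    (he : e ∉ punctured) (h : Tendsto (fun t => (exp₁ (ζ t) : RSphere)) l (𝓝 e)) :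
    Tendsto (fun t => ‖ζ t‖) l atTop := by
  refine tendsto_atTop.2 fun R => ?_
  have hK : IsCompact ((fun z => (exp₁ z : RSphere)) '' Metric.closedBall 0 R) :=
    (isCompact_closedBall (0 : ℂ) R).image (OnePoint.continuous_coe.comp continuous_exp₁)
  have hmem : ((fun z => (exp₁ z : RSphere)) '' Metric.closedBall 0 R)ᶜ ∈ 𝓝 e := by
    refine hK.isClosed.isOpen_compl.mem_nhds ?_
    rintro ⟨z, -, hz⟩
    exact he (hz ▸ coe_exp₁_mem_punctured z)
  filter_upwards [h hmem] with t ht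
  by_contra! hlt
  exact ht ⟨ζ t, by simpa using hlt.le, rfl⟩

/-- A path that tends to `∞` and on which `f` converges can only accumulate, under `exp₁`, at
poles of `Φ` and at the punctures. -/
theorem outer_eq_inf_of_mapClusterPt (H : IsProjection f g ℓ Φ) (hℓ : ℓ ≠ 0) {ι : Type*}
    {l : Filter ι} {ζ : ι → ℂ} {u w₀ : ℂ} (hinf : Tendsto (fun t => ‖ζ t‖) l atTop)
    (hu : Tendsto (fun t => f (ζ t)) l (𝓝 (u : RSphere))) (hw₀ : w₀ ≠ 0)
    (hcl : MapClusterPt w₀ l fun t => exp₁ (ζ t)) : Φ (w₀ : RSphere) = inf := by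
  obtain ⟨y₀, rfl⟩ := exists_exp₁_eq hw₀
  by_contra hne
  have hfy : f y₀ ≠ inf := fun h => hne ((H.eq_inf_iff y₀).1 h)
  have h1 : ∀ᶠ y in 𝓝 y₀, f y ≠ inf ∧ ‖toPlane (f y)‖ < ‖toPlane (f y₀)‖ + 1 ∧ ‖y‖ < ‖y₀‖ + 1 := by
    have h2 : ContinuousAt f y₀ := ContinuousAt.comp (f := ((↑) : ℂ → RSphere)) (H.isMeroAt y₀).1
      OnePoint.continuous_coe.continuousAt
    filter_upwards [h2.eventually (isOpen_ne.mem_nhds hfy),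
      (H.continuousAt_toPlane_comp hfy).norm.eventually (Iio_mem_nhds (lt_add_one _)),
      continuous_norm.continuousAt.eventually (Iio_mem_nhds (lt_add_one ‖y₀‖))] with y a b c
    exact ⟨a, b, c⟩
  have h2 := image_mem_map (m := exp₁) h1
  rw [← nhds_exp₁] at h2
  have h3 := hcl.frequently h2
  have h4 : ∀ᶠ t in l, ‖toPlane (f (ζ t))‖ < ‖u‖ + 1 :=
    ((continuousAt_toPlane u).tendsto.comp hu).norm.eventually (Iio_mem_nhds (lt_add_one ‖u‖))
  -- Near a finite value of `Φ`, write `ζ t = y + m` with `y` close to `y₀` and `m` an integer. Then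
  -- `f (ζ t) = f y + ℓ * m` being bounded bounds `m`, as `ℓ ≠ 0`; `B` is the resulting bound on `‖ζ
  -- t‖`, against `ζ → ∞`.
  set B := (‖y₀‖ + 1) + ((‖u‖ + 1) + (‖toPlane (f y₀)‖ + 1)) with hB
  obtain ⟨t, ht1, ht2, ht3⟩ := (h3.and_eventually (h4.and (hinf.eventually_gt_atTop B))).exists
  obtain ⟨y, ⟨hy1, hy2, hy3⟩, hyt⟩ := ht1
  obtain ⟨m, hm⟩ := exp₁_eq_iff.1 hyt.symm
  have h5 := (H.hasPseudoperiod_int m).eq_coe (coe_toPlane hy1).symm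
  rw [← hm] at h5
  rw [h5, toPlane_coe] at ht2
  have h6 : ‖(ℓ : ℂ) * m‖ ≤ (‖u‖ + 1) + (‖toPlane (f y₀)‖ + 1) := by
    have h7 := norm_sub_le (toPlane (f y) + ℓ * m) (toPlane (f y))
    rw [add_sub_cancel_left] at h7
    linarith
  have h8 : ‖(m : ℂ)‖ ≤ ‖(ℓ : ℂ) * m‖ := by
    rw [norm_mul]
    refine le_mul_of_one_le_left (norm_nonneg _) ?_
    rw [Complex.norm_intCast]
    have : 1 ≤ |ℓ| := Int.one_le_abs hℓ
    exact_mod_cast this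
  have h9 := norm_add_le y (m : ℂ)
  rw [← hm] at h9
  linarith

theorem exp₁_mem_asympVals (H : IsProjection f g ℓ Φ) (hℓ : ℓ ≠ 0) {u : ℂ}
    (hu : (u : RSphere) ∈ asympVals plane (onSphere f)) :
    (exp₁ u : RSphere) ∈ asympVals (projDom f) g := by
  obtain ⟨ζ, t₀, ht₀, hζ, hinf, hfu⟩ := H.coe_mem_asympVals_plane_iff.1 hu
  have hζ' : ContinuousOn (fun t => exp₁ (ζ t)) (Ico t₀ 1) := continuous_exp₁.comp_continuousOn hζ
  have hcase := tendsto_of_isolated_clusterPts ht₀ (hζ'.mono Ioo_subset_Ico_self)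
    fun w₀ hw₀ hcl => by
      have hpole : ∀ᶠ q in 𝓝[≠] (w₀ : RSphere), q ∈ projDom f :=
        H.nearlyContains_projDom (coe_mem_punctured hw₀)
      rw [eventually_nhdsNE_iff, coord_coe_self, param_coe] at hpole
      filter_upwards [hpole, eventually_ne_nhdsNE_complex w₀ 0] with w hw hw0 hcl'
      exact (H.mem_projDom_iff.1 hw).2 (H.outer_eq_inf_of_mapClusterPt hℓ hinf hfu hw0 hcl')
  have he : ∃ e : RSphere, Tendsto (fun t => (exp₁ (ζ t) : RSphere)) (𝓝[<] 1) (𝓝 e) := by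
    rcases hcase with ⟨w₀, hw₀⟩ | h
    · exact ⟨w₀, (OnePoint.continuous_coe.tendsto w₀).comp hw₀⟩
    · exact ⟨inf, tendsto_coe_inf h⟩
  obtain ⟨e, he⟩ := he
  -- In `ℂ*` the limit is a pole of `Φ`. At a puncture where `Φ` had a finite limit, `ℓ * ζ = f ∘ ζ
  -- - Φ ∘ exp₁ ∘ ζ` would converge although `ζ → ∞`.
  have hess : e ∈ ess (projDom f) g := by
    intro hd
    obtain ⟨φ, hφ⟩ := H.mem_dom_iff.1 hd
    by_cases hep : e ∈ punctured
    · obtain ⟨y₀, rfl⟩ := mem_punctured_iff.1 hep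
      have h1 : Tendsto (fun t => exp₁ (ζ t)) (𝓝[<] 1) (𝓝 (exp₁ y₀)) :=
        (continuousAt_toPlane (exp₁ y₀)).tendsto.comp he
      have h2 := H.outer_eq_inf_of_mapClusterPt hℓ hinf hfu (exp₁_ne_zero y₀) h1.mapClusterPt
      rw [H.finRep_self hep hφ] at h2
      exact coe_ne_inf _ h2
    · have h1 : Tendsto (fun t => (exp₁ (ζ t) : RSphere)) (𝓝[<] 1) (𝓝[≠] e) :=
        tendsto_nhdsWithin_iff.2 ⟨he, Eventually.of_forall fun t heq =>
          hep (heq ▸ coe_exp₁_mem_punctured (ζ t))⟩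
      have h2 := hφ.continuousAt.comp h1
      have h3 := ((continuousAt_toPlane u).tendsto.comp hfu).sub
        ((continuousAt_toPlane (φ (coord e e))).tendsto.comp h2)
      have h4 : Tendsto (fun t => (ℓ : ℂ) * ζ t) (𝓝[<] 1)
          (𝓝 (toPlane u - toPlane (φ (coord e e)))) := by
        refine h3.congr' ?_
        filter_upwards [h2.eventually (eventually_ne_inf _)] with t ht
        obtain ⟨c, hc⟩ := exists_coe_of_ne_inf ht
        simp only [Function.comp_apply] at hc ⊢
        rw [hc, H.eq_coe_of hc, toPlane_coe, toPlane_coe]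
        ring
      have h5 : Tendsto (fun t => ‖(ℓ : ℂ) * ζ t‖) (𝓝[<] 1) atTop := by
        simp only [norm_mul]
        exact hinf.const_mul_atTop (norm_pos_iff.2 (Int.cast_ne_zero.2 hℓ))
      exact not_tendsto_nhds_of_tendsto_atTop h5 _ h4.norm
  obtain ⟨t₁, ht₁, hsub⟩ := (mem_nhdsLT_iff_exists_Ioo_subset' (a := (1 : ℝ)) ht₀).1
    (hfu.eventually (eventually_ne_inf u))
  rw [mem_Iio] at ht₁
  obtain ⟨t₂, ht₂, ht₂1⟩ := exists_between (max_lt ht₀ ht₁)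
  have hfin : ∀ t ∈ Ico t₂ 1, f (ζ t) ≠ inf := fun t ht =>
    hsub ⟨(le_max_right _ _).trans_lt (ht₂.trans_le ht.1), ht.2⟩
  refine mem_asympVals_of_path (γ := fun t => (exp₁ (ζ t) : RSphere)) ht₂1
    (OnePoint.continuous_coe.comp_continuousOn (hζ'.mono (Ico_subset_Ico_left
      ((le_max_left _ _).trans ht₂.le))))
    (fun t ht => H.projDom_subset_dom ⟨ζ t, hfin t ht, rfl⟩) hess he ?_
  have h1 : Tendsto (fun t => (exp₁ (toPlane (f (ζ t))) : RSphere)) (𝓝[<] 1)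
      (𝓝 (exp₁ u : RSphere)) :=
    ((OnePoint.continuous_coe.comp continuous_exp₁).tendsto u).comp
      ((continuousAt_toPlane u).tendsto.comp hfu)
  refine h1.congr' ?_
  filter_upwards [Ico_mem_nhdsLT ht₂1] with t ht
  rw [H.ext_proj ⟨ζ t, hfin t ht, rfl⟩, H.proj_exp₁ (coe_toPlane (hfin t ht)).symm]

theorem asympVals_proj_inter (H : IsProjection f g ℓ Φ) (hℓ : ℓ ≠ 0) :
    asympVals (projDom f) g ∩ punctured = exp₁Image (asympVals plane (onSphere f)) := by
  ext v
  constructor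
  · rintro ⟨hv, hvp⟩
    obtain ⟨ζ, t₀, e, u, ht₀, hζ, -, hep, hγe, hfu, rfl⟩ := H.exists_lift_of_mem_asympVals hv hvp
    refine ⟨u, H.coe_mem_asympVals_plane_iff.2 ?_, rfl⟩
    obtain ⟨t₁, ht₁, ht₁1⟩ := exists_between ht₀
    exact ⟨ζ, t₁, ht₁1, hζ.mono fun t ht => ⟨ht₁.trans_le ht.1, ht.2⟩,
      tendsto_norm_of_tendsto_exp₁ hep hγe, hfu⟩
  · rintro ⟨u, hu, rfl⟩
    exact ⟨H.exp₁_mem_asympVals hℓ hu, coe_exp₁_mem_punctured u⟩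

theorem periodic_eq (H : IsProjection f g ℓ Φ) (hℓ : ℓ = 0) (z : ℂ) :
    f z = Φ (exp₁ z : RSphere) := by
  rcases eq_inf_or_coe (Φ (exp₁ z : RSphere)) with h | ⟨c, h⟩
  · rw [h, H.eq_inf_iff, h]
  · rw [h, H.eq_coe_of h, hℓ]
    simp

/-- The same path in the sphere serves both functions. An end that is essential for `g` could only
be a pole of `Φ` otherwise, which the finite limit `u` excludes; an end that is essential for `Φ` is
essential for `g`. -/
theorem asympVals_proj_inter_of_periodic (H : IsProjection f g ℓ Φ) (hℓ : ℓ = 0) :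
    asympVals (projDom f) g ∩ punctured = exp₁Image (asympVals punctured Φ) := by
  ext v
  constructor
  · rintro ⟨hv, hvp⟩
    obtain ⟨ζ, t₀, e, u, ht₀, hζ, he, hep, hγe, hfu, rfl⟩ := H.exists_lift_of_mem_asympVals hv hvp
    refine ⟨u, ?_, rfl⟩
    obtain ⟨t₁, ht₁, ht₁1⟩ := exists_between ht₀
    have hfu' : Tendsto (fun t => Φ (exp₁ (ζ t) : RSphere)) (𝓝[<] 1) (𝓝 (u : RSphere)) :=
      hfu.congr fun t => H.periodic_eq hℓ (ζ t)
    have h1 : Tendsto (fun t => (exp₁ (ζ t) : RSphere)) (𝓝[<] 1) (𝓝[≠] e) :=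
      tendsto_nhdsWithin_iff.2 ⟨hγe, Eventually.of_forall fun t heq =>
        hep (heq ▸ coe_exp₁_mem_punctured (ζ t))⟩
    refine mem_asympVals_of_path (γ := fun t => (exp₁ (ζ t) : RSphere)) (e := e) ht₁1 ?_
      (fun t _ => H.punctured_subset_dom (coe_exp₁_mem_punctured _)) ?_ hγe ?_
    · exact (OnePoint.continuous_coe.comp continuous_exp₁).comp_continuousOn
        (hζ.mono fun t ht => ⟨ht₁.trans_le ht.1, ht.2⟩)
    · intro hd
      obtain ⟨φ, hφ | hφ⟩ := exists_rep_of_mem_dom (nearlyContains_punctured e) hd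
      · exact he (H.mem_dom_of_finRep hφ)
      · exact inf_ne_coe _ (tendsto_nhds_unique (hφ.continuousAt.comp h1) hfu')
    · exact hfu'.congr fun t => (H.ext_outer (coe_exp₁_mem_punctured _)).symm
  · rintro ⟨u, ⟨γ, hγ, hd, ⟨e, he, hγe⟩, hγu⟩, rfl⟩
    refine ⟨?_, coe_exp₁_mem_punctured u⟩
    have hIco : Ico (0 : ℝ) 1 ∈ 𝓝[<] (1 : ℝ) := Ico_mem_nhdsLT one_pos
    have hne : ∀ᶠ t in 𝓝[<] (1 : ℝ), γ t ≠ e := by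
      filter_upwards [hIco] with t ht heq
      exact he (heq ▸ hd t ht)
    have hev : ∀ᶠ t in 𝓝[<] (1 : ℝ), t ∈ Ico (0 : ℝ) 1 ∧ γ t ∈ projDom f := by
      filter_upwards [hIco, eventually_mem_punctured hγe hne,
        hγu.eventually (eventually_ne_inf u)] with t h1 h2 h3
      rw [H.ext_outer h2] at h3
      exact ⟨h1, H.mem_projDom_iff.2 ⟨h2, h3⟩⟩
    obtain ⟨t₀, ht₀, hsub⟩ := (mem_nhdsLT_iff_exists_Ioo_subset' (a := (1 : ℝ)) one_pos).1 hev
    rw [mem_Iio] at ht₀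
    obtain ⟨t₁, ht₁, ht₁1⟩ := exists_between ht₀
    have hsub' : Ico t₁ 1 ⊆ Ioo t₀ 1 := fun t ht => ⟨ht₁.trans_le ht.1, ht.2⟩
    refine mem_asympVals_of_path (γ := γ) (e := e) ht₁1 (hγ.mono fun t ht => (hsub (hsub' ht)).1)
      (fun t ht => H.projDom_subset_dom (hsub (hsub' ht)).2) ?_ hγe ?_
    · intro hde
      obtain ⟨φ, hφ⟩ := H.mem_dom_iff.1 hde
      exact he (hφ.mem_dom fun hp => H.finRep_self hp hφ)
    · have h1 : Tendsto (fun t => (exp₁ (toPlane (ext punctured Φ (γ t))) : RSphere)) (𝓝[<] 1)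
          (𝓝 (exp₁ u : RSphere)) :=
        ((OnePoint.continuous_coe.comp continuous_exp₁).tendsto u).comp
          ((continuousAt_toPlane u).tendsto.comp hγu)
      refine h1.congr' ?_
      filter_upwards [Ico_mem_nhdsLT ht₁1] with t ht
      have h2 := (hsub (hsub' ht)).2
      obtain ⟨φ, hφ⟩ := H.exists_finRep h2
      obtain ⟨h3, h4, -⟩ := H.ext_proj_of_periodic hℓ hφ
      rw [h3, h4, toPlane_coe]

end IsProjection

/-! ### Closures -/

theorem exp₁Image_union (A B : Set RSphere) : exp₁Image (A ∪ B) = exp₁Image A ∪ exp₁Image B := by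
  ext p
  constructor
  · rintro ⟨u, hu | hu, rfl⟩
    · exact Or.inl ⟨u, hu, rfl⟩
    · exact Or.inr ⟨u, hu, rfl⟩
  · rintro (⟨u, hu, rfl⟩ | ⟨u, hu, rfl⟩)
    · exact ⟨u, Or.inl hu, rfl⟩
    · exact ⟨u, Or.inr hu, rfl⟩

theorem exp₁Image_subset_punctured (A : Set RSphere) : exp₁Image A ⊆ punctured := by
  rintro _ ⟨u, -, rfl⟩
  exact coe_exp₁_mem_punctured u

theorem coe_mem_closure_iff {A : Set RSphere} {u : ℂ} :
    (u : RSphere) ∈ closure A ↔ ∃ᶠ y : ℂ in 𝓝 u, (y : RSphere) ∈ A := by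
  rw [mem_closure_iff_frequently, OnePoint.nhds_coe_eq, frequently_map]

theorem exp₁Image_closure_subset {A B : Set RSphere} (h : exp₁Image A ⊆ B) :
    exp₁Image (closure A) ⊆ closure B := by
  rintro _ ⟨u, hu, rfl⟩
  rw [coe_mem_closure_iff] at hu ⊢
  exact (continuous_exp₁.tendsto u).frequently (hu.mono fun y hy => h ⟨y, hy, rfl⟩)

/-- Near `exp₁ u`, points of `B` are `exp₁ y` with `y` near `u` and `y + m ∈ A` for an integer `m`
depending on `y`. Invariance reduces `m` modulo `ℓ` to finitely many choices, so one choice occurs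
frequently as `y → u`, and `u + m` is in the closure of `A`. -/
theorem closure_inter_punctured {A B : Set RSphere} {ℓ : ℤ} (hℓ : ℓ ≠ 0)
    (hA : ∀ (u : ℂ) (m : ℤ), (u : RSphere) ∈ A → ((u + ℓ * m : ℂ) : RSphere) ∈ A)
    (hB : B ∩ punctured = exp₁Image A) :
    closure B ∩ punctured = exp₁Image (closure A) := by
  refine Subset.antisymm ?_ (subset_inter (exp₁Image_closure_subset ?_)
    (exp₁Image_subset_punctured _))
  · rintro v ⟨hv, hvp⟩
    obtain ⟨u, rfl⟩ := mem_punctured_iff.1 hvp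
    rw [coe_mem_closure_iff, nhds_exp₁, frequently_map] at hv
    have h1 : ∃ᶠ y in 𝓝 u, ∃ m ∈ Finset.Ico (0 : ℤ) |ℓ|, ((y + m : ℂ) : RSphere) ∈ A := by
      refine hv.mono fun y hy => ?_
      have h2 : (exp₁ y : RSphere) ∈ exp₁Image A := hB ▸ ⟨hy, coe_exp₁_mem_punctured y⟩
      obtain ⟨y', hy', heq⟩ := h2
      rw [coe_inj, eq_comm, exp₁_eq_iff] at heq
      obtain ⟨m, rfl⟩ := heq
      refine ⟨m % ℓ, Finset.mem_Ico.2 ⟨Int.emod_nonneg m hℓ, Int.emod_lt_abs m hℓ⟩, ?_⟩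
      have h3 := hA _ (-(m / ℓ)) hy'
      convert h3 using 2
      have h4 : ((m % ℓ + ℓ * (m / ℓ) : ℤ) : ℂ) = m := by rw [Int.emod_add_mul_ediv]
      push_cast at h4 ⊢
      linear_combination h4
    have h2 : ∃ m : ℤ, ∃ᶠ y in 𝓝 u, ((y + m : ℂ) : RSphere) ∈ A := by
      by_contra! hcon
      refine h1 ?_
      have h3 : ∀ᶠ y in 𝓝 u, ∀ m ∈ Finset.Ico (0 : ℤ) |ℓ|, ((y + m : ℂ) : RSphere) ∉ A :=
        (Filter.eventually_all_finset _).2 fun m _ => hcon m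
      exact h3.mono fun y hy ⟨m, hm, hmA⟩ => hy m hm hmA
    obtain ⟨m, hm⟩ := h2
    refine ⟨u + m, coe_mem_closure_iff.2 ?_, by rw [exp₁_add_int]⟩
    exact ((by fun_prop : Continuous fun y : ℂ => y + m).tendsto u).frequently hm
  · rw [← hB]
    exact inter_subset_left

theorem compl_punctured_finite : puncturedᶜ.Finite := by
  refine (Set.toFinite {zero, inf}).subset fun p hp => ?_
  exact notMem_punctured_iff.1 hp

/-- Without translation invariance, finiteness does the work: the image together with `0` and `∞` is
a closed set containing `B`. -/
theorem closure_inter_punctured_of_finite {A B : Set RSphere} (hB : B ∩ punctured = exp₁Image A)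
    (hfin : (exp₁Image (closure A)).Finite) :
    closure B ∩ punctured = exp₁Image (closure A) := by
  refine Subset.antisymm ?_ (subset_inter (exp₁Image_closure_subset ?_)
    (exp₁Image_subset_punctured _))
  · have h1 : B ⊆ exp₁Image (closure A) ∪ puncturedᶜ := by
      intro p hp
      by_cases hpp : p ∈ punctured
      · left
        have h2 : p ∈ exp₁Image A := hB ▸ ⟨hp, hpp⟩
        obtain ⟨u, hu, rfl⟩ := h2
        exact ⟨u, subset_closure hu, rfl⟩
      · exact Or.inr hpp
    have h3 := closure_minimal h1 (hfin.union compl_punctured_finite).isClosed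
    rintro p ⟨hp, hpp⟩
    exact (h3 hp).resolve_right fun h => h hpp
  · rw [← hB]
    exact inter_subset_left

theorem finite_iff_inter_punctured {A : Set RSphere} : A.Finite ↔ (A ∩ punctured).Finite := by
  refine ⟨fun h => h.subset inter_subset_left, fun h => ?_⟩
  refine (h.union compl_punctured_finite).subset fun p hp => ?_
  by_cases hpp : p ∈ punctured
  · exact Or.inl ⟨hp, hpp⟩
  · exact Or.inr hpp

/-- A set that is invariant under translation by `ℓ` is determined modulo `ℓ` by its part in the
strip of width `|ℓ|`. -/
theorem finite_inter_strip_iff {A : Set RSphere} {ℓ : ℤ} (hℓ : ℓ ≠ 0)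
    (hA : ∀ (u : ℂ) (m : ℤ), (u : RSphere) ∈ A → ((u + ℓ * m : ℂ) : RSphere) ∈ A) :
    (A ∩ strip ℓ).Finite ↔ (exp₁Image A).Finite := by
  have hℓ' : (0 : ℝ) < |(ℓ : ℝ)| := abs_pos.2 (Int.cast_ne_zero.2 hℓ)
  constructor
  · intro h
    refine (h.image fun p => (exp₁ (toPlane p) : RSphere)).subset ?_
    rintro _ ⟨u, hu, rfl⟩
    obtain ⟨m, hm, -⟩ := existsUnique_add_zsmul_mem_Ioc hℓ' u.re (-(|(ℓ : ℝ)| / 2))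
    -- The translate into the half-open strip is by a multiple of `|ℓ|`; the sign of `ℓ` is absorbed
    -- into `k`.
    obtain ⟨k, hk⟩ : ∃ k : ℤ, (ℓ : ℝ) * k = m • |(ℓ : ℝ)| := by
      rcases abs_choice (ℓ : ℝ) with h | h <;> rw [h, zsmul_eq_mul]
      · exact ⟨m, mul_comm _ _⟩
      · exact ⟨-m, by push_cast; ring⟩
    rw [← hk] at hm
    refine ⟨((u + ℓ * k : ℂ) : RSphere), ⟨hA u k hu, u + ℓ * k, rfl, ?_, ?_⟩, ?_⟩
    · have := hm.1
      simpa using this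
    · have := hm.2
      have h2 : (u + ℓ * k : ℂ).re = u.re + ℓ * k := by simp
      rw [h2]
      linarith
    · change (exp₁ (u + ℓ * k) : RSphere) = _
      have := exp₁_add_int u (ℓ * k)
      push_cast at this
      rw [this]
  · intro h
    have h1 : ∀ v ∈ exp₁Image A, {p | p ∈ strip ℓ ∧ (exp₁ (toPlane p) : RSphere) = v}.Finite := by
      rintro _ ⟨u, -, rfl⟩
      have hI : (Icc ⌊-(|(ℓ : ℝ)| / 2) - u.re⌋ ⌈|(ℓ : ℝ)| / 2 - u.re⌉).Finite := Set.finite_Icc _ _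
      refine (hI.image fun n : ℤ => ((u + n : ℂ) : RSphere)).subset ?_
      rintro p ⟨⟨z, rfl, hz1, hz2⟩, hz⟩
      rw [toPlane_coe, coe_inj, exp₁_eq_iff] at hz
      obtain ⟨n, rfl⟩ := hz
      have h2 : (u + n : ℂ).re = u.re + n := by simp
      rw [h2] at hz1 hz2
      refine ⟨n, ⟨?_, ?_⟩, rfl⟩
      · have h3 := Int.floor_le (-(|(ℓ : ℝ)| / 2) - u.re)
        have h4 : (⌊-(|(ℓ : ℝ)| / 2) - u.re⌋ : ℝ) ≤ n := by linarith
        exact_mod_cast h4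
      · have h3 := Int.le_ceil (|(ℓ : ℝ)| / 2 - u.re)
        have h4 : (n : ℝ) ≤ ⌈|(ℓ : ℝ)| / 2 - u.re⌉ := by linarith
        exact_mod_cast h4
    refine (h.biUnion h1).subset ?_
    rintro p ⟨hpA, hps⟩
    refine mem_iUnion₂.2 ⟨_, ?_, hps, rfl⟩
    obtain ⟨z, rfl, -⟩ := hps
    exact ⟨z, hpA, rfl⟩

/-! ### Doubly periodic functions -/

/-- A doubly periodic entire function is constant. -/
theorem apply_eq_of_doubly_periodic {k : ℂ → ℂ} (hk : Differentiable ℂ k) {τ : ℂ} (hτ : 0 < τ.im)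
    (h1 : ∀ z, k (z + 1) = k z) (h2 : ∀ z, k (z + τ) = k z) (z w : ℂ) : k z = k w := by
  have p1 : Function.Periodic k 1 := h1
  have p2 : Function.Periodic k τ := h2
  have hK : IsCompact ((fun q : ℝ × ℝ => (q.1 : ℂ) + q.2 * τ) '' (Icc 0 1 ×ˢ Icc 0 1)) :=
    (isCompact_Icc.prod isCompact_Icc).image (by fun_prop)
  obtain ⟨M, hM⟩ := hK.exists_bound_of_continuousOn hk.continuous.continuousOn
  refine hk.apply_eq_apply_of_bounded ?_ z w
  rw [isBounded_iff_forall_norm_le]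
  refine ⟨M, ?_⟩
  rintro _ ⟨z, rfl⟩
  set y := z.im / τ.im with hy
  set x := z.re - y * τ.re with hx
  -- Coordinates in the real basis `1, τ`; taking fractional parts moves the point into the compact
  -- period parallelogram.
  have hz : z = x + y * τ := by
    apply Complex.ext
    · simp [hx]
    · simp [hy, div_mul_cancel₀ _ hτ.ne']
  have hz' : k z = k ((Int.fract x : ℝ) + (Int.fract y : ℝ) * τ) := by
    have h3 := (p2.int_mul ⌊y⌋) ((Int.fract x : ℝ) + (Int.fract y : ℝ) * τ)
    have h4 := (p1.int_mul ⌊x⌋) ((Int.fract x : ℝ) + (Int.fract y : ℝ) * τ + ⌊y⌋ * τ)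
    rw [← h3, ← h4]
    congr 1
    rw [hz]
    have h5 : (x : ℂ) = ((⌊x⌋ : ℝ) + Int.fract x : ℝ) := by rw [Int.floor_add_fract]
    have h6 : (y : ℂ) = ((⌊y⌋ : ℝ) + Int.fract y : ℝ) := by rw [Int.floor_add_fract]
    conv_lhs => rw [h5, h6]
    push_cast
    ring
  rw [hz']
  exact hM _ ⟨(Int.fract x, Int.fract y), ⟨⟨Int.fract_nonneg _, (Int.fract_lt_one _).le⟩,
    ⟨Int.fract_nonneg _, (Int.fract_lt_one _).le⟩⟩, rfl⟩

/-- Near a zero of an analytic function `φ`, the function `1 / (1 / φ)'` is analytic and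
vanishes. -/
theorem exists_analyticAt_inv_deriv_inv {φ : ℂ → ℂ} {a : ℂ} (hφ : AnalyticAt ℂ φ a)
    (h0 : φ a = 0) (hne : ∀ᶠ z in 𝓝[≠] a, φ z ≠ 0) :
    ∃ K : ℂ → ℂ, AnalyticAt ℂ K a ∧ K a = 0 ∧
      ∀ᶠ z in 𝓝[≠] a, (deriv (fun y => (φ y)⁻¹) z)⁻¹ = K z := by
  have hnt : analyticOrderAt φ a ≠ ⊤ := by
    rw [Ne, analyticOrderAt_eq_top]
    intro h
    obtain ⟨z, h1, h2⟩ := (hne.and (h.filter_mono nhdsWithin_le_nhds)).exists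
    exact h1 h2
  obtain ⟨u, hu, hu0, heq⟩ := (hφ.analyticOrderAt_ne_top).1 hnt
  set n := analyticOrderNatAt φ a with hn
  have hn0 : n ≠ 0 := by
    intro h
    have := heq.self_of_nhds
    dsimp only at this
    rw [h, pow_zero, one_smul, h0] at this
    exact hu0 this.symm
  -- With `φ = (z - a) ^ n * u` one has `φ' = (z - a) ^ (n - 1) * D`, so `1 / (1 / φ)' = -φ ^ 2 / φ'
  -- = -φ * (z - a) * u / D`.
  set D : ℂ → ℂ := fun z => n * u z + (z - a) * deriv u z with hD
  have hDa : AnalyticAt ℂ D a :=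
    (analyticAt_const.mul hu).add ((analyticAt_id.sub analyticAt_const).mul hu.deriv)
  have hD0 : D a ≠ 0 := by
    simp only [hD, sub_self, zero_mul, add_zero]
    exact mul_ne_zero (Nat.cast_ne_zero.2 hn0) hu0
  refine ⟨fun z => -(φ z * ((z - a) * u z / D z)), ?_, by simp [h0], ?_⟩
  · exact (hφ.fun_mul (((analyticAt_id.sub analyticAt_const).mul hu).div hDa hD0)).fun_neg
  · filter_upwards [hne, self_mem_nhdsWithin,
      (eventually_eventually_nhds.2 heq).filter_mono nhdsWithin_le_nhds,
      hu.eventually_analyticAt.filter_mono nhdsWithin_le_nhds,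
      (hDa.continuousAt.eventually_ne hD0).filter_mono nhdsWithin_le_nhds] with z hz hza hz2 hz3 hz4
    have hza' : z - a ≠ 0 := sub_ne_zero.2 hza
    have h1 : HasDerivAt (fun y => (y - a) ^ n * u y)
        (n * (z - a) ^ (n - 1) * u z + (z - a) ^ n * deriv u z) z := by
      have := (((hasDerivAt_id z).sub_const a).fun_pow n).fun_mul hz3.differentiableAt.hasDerivAt
      simpa using this
    have h2 : HasDerivAt φ (n * (z - a) ^ (n - 1) * u z + (z - a) ^ n * deriv u z) z := by
      refine h1.congr_of_eventuallyEq ?_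
      filter_upwards [hz2] with y hy
      rw [hy, smul_eq_mul]
    have h3 : n * (z - a) ^ (n - 1) * u z + (z - a) ^ n * deriv u z = (z - a) ^ (n - 1) * D z := by
      have h4 : (z - a) ^ n = (z - a) ^ (n - 1) * (z - a) := by
        rw [← pow_succ, Nat.sub_one_add_one hn0]
      rw [h4]
      simp only [hD]
      ring
    rw [h3] at h2
    rw [(h2.fun_inv hz).deriv]
    have h5 : φ z = (z - a) ^ (n - 1) * (z - a) * u z := by
      rw [hz2.self_of_nhds, smul_eq_mul, ← pow_succ, Nat.sub_one_add_one hn0]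
    have h6 : (z - a) ^ (n - 1) ≠ 0 := pow_ne_zero _ hza'
    rw [inv_div, div_neg]
    congr 1
    rw [sq, mul_div_assoc]
    congr 1
    rw [h5]
    field_simp

namespace IsProjection

variable {f : ℂ → RSphere} {g : RSphere → RSphere} {ℓ : ℤ} {Φ : RSphere → RSphere} {p : RSphere}
  {φ : ℂ → ℂ}

/-- The expression of `f` near a point of the plane. -/
theorem exists_local (H : IsProjection f g ℓ Φ) (z : ℂ) :
    ∃ φ : ℂ → ℂ, AnalyticAt ℂ φ z ∧ ((∀ᶠ y in 𝓝 z, f y = (φ y : RSphere)) ∨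
      (φ z = 0 ∧ ∀ᶠ y in 𝓝 z, f y = recip (φ y : RSphere))) := by
  have := (H.isMeroAt z).exists_rep
  rwa [coord_coe_self, param_coe] at this

/-- A doubly pseudoperiodic function has a finite critical value. -/
theorem exists_critVal (H : IsProjection f g ℓ Φ) {τ η : ℂ} (hτ : 0 < τ.im)
    (h : HasPseudoperiod f τ η) : ∃ u : ℂ, (u : RSphere) ∈ critVals plane (onSphere f) := by
  classical
  by_contra! hcon
  set F : ℂ → ℂ := fun z => toPlane (f z) with hF
  -- This is `1 / f'`, with its limit `0` inserted at poles. Without finite critical values it is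
  -- entire, and it has the periods `1` and `τ`, hence is constant. The constant is nonzero, so `f`
  -- has no poles and is affine.
  set k : ℂ → ℂ := fun z => if f z = inf then 0 else (deriv F z)⁻¹ with hk
  have hd : ∀ z, f z ≠ inf → AnalyticAt ℂ F z ∧ deriv F z ≠ 0 := by
    intro z hz
    obtain ⟨φ, ha, hφ | ⟨h0, hφ⟩⟩ := H.exists_local z
    · have hFφ : F =ᶠ[𝓝 z] φ := hφ.mono fun y hy => by simp only [hF, hy, toPlane_coe]
      refine ⟨ha.congr hFφ.symm, ?_⟩
      rw [hFφ.deriv_eq]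
      intro hder
      have hrep : FinRep (onSphere f) (z : RSphere) φ := by
        rw [FinRep, coord_coe_self, param_coe]
        exact ⟨ha, hφ.filter_mono nhdsWithin_le_nhds⟩
      exact hcon (φ z) (H.coe_mem_critVals_plane_iff.2
        ⟨z, (H.mem_critPts_plane_iff hrep).2 hder, H.finRep_plane_self hrep⟩)
    · have := hφ.self_of_nhds
      rw [h0, recip_coe_zero] at this
      exact absurd this hz
  have hka : ∀ z, AnalyticAt ℂ k z := by
    intro z
    obtain ⟨φ, ha, hφ | ⟨h0, hφ⟩⟩ := H.exists_local z
    · have hz : f z ≠ inf := by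
        rw [hφ.self_of_nhds]
        exact coe_ne_inf _
      refine ((hd z hz).1.deriv.inv (hd z hz).2).congr ?_
      filter_upwards [hφ] with y hy
      simp only [hk, hy, if_neg (coe_ne_inf _)]
      rfl
    · have hz : f z = inf := by rw [hφ.self_of_nhds, h0, recip_coe_zero]
      have hne : ∀ᶠ y in 𝓝[≠] z, φ y ≠ 0 := by
        rcases ha.eventually_eq_zero_or_eventually_ne_zero with h1 | h1
        · refine absurd ?_ (H.not_eventually_inf z)
          filter_upwards [hφ, h1] with y hy hy1
          rw [hy, hy1, recip_coe_zero]
        · exact h1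
      obtain ⟨K, hK, hK0, hKe⟩ := exists_analyticAt_inv_deriv_inv ha h0 hne
      refine hK.congr ?_
      have h3 : ∀ᶠ y in 𝓝[≠] z, K y = k y := by
        filter_upwards [hne, hKe, (eventually_eventually_nhds.2 hφ).filter_mono nhdsWithin_le_nhds]
          with y hy1 hy2 hy3
        have h4 : F =ᶠ[𝓝 y] fun w => (φ w)⁻¹ :=
          hy3.mono fun w hw => by simp only [hF, hw, toPlane_recip_coe]
        have h5 : f y ≠ inf := by
          rw [hy3.self_of_nhds, recip_coe_of_ne hy1]
          exact coe_ne_inf _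
        simp only [hk]
        rw [if_neg h5, h4.deriv_eq, hy2]
      rw [eventually_nhdsWithin_iff] at h3
      filter_upwards [h3] with y hy
      by_cases hyz : y = z
      · rw [hyz, hK0]
        simp only [hk]
        rw [if_pos hz]
      · exact hy hyz
  have hper : ∀ {σ θ : ℂ}, HasPseudoperiod f σ θ → ∀ z, k (z + σ) = k z := by
    intro σ θ hσ z
    rcases eq_inf_or_coe (f z) with h1 | ⟨u, h1⟩
    · have h2 : f (z + σ) = inf := by rw [hσ z, h1, map_inf]
      simp only [hk]
      rw [if_pos h1, if_pos h2]
    · have h2 : f (z + σ) ≠ inf := by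
        rw [hσ.eq_coe h1]
        exact coe_ne_inf _
      have h3 : f z ≠ inf := by
        rw [h1]
        exact coe_ne_inf _
      simp only [hk]
      rw [if_neg h2, if_neg h3, ← deriv_comp_add_const]
      congr 1
      have h4 : (fun y => F (y + σ)) =ᶠ[𝓝 z] fun y => F y + θ := by
        obtain ⟨φ, -, hφ | ⟨h0, hφ⟩⟩ := H.exists_local z
        · filter_upwards [hφ] with y hy
          simp only [hF]
          rw [hσ.eq_coe hy, hy, toPlane_coe, toPlane_coe]
        · have := hφ.self_of_nhds
          rw [h0, recip_coe_zero] at this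
          exact absurd this h3
      rw [h4.deriv_eq, deriv_add_const]
  have hconst := apply_eq_of_doubly_periodic (fun z => (hka z).differentiableAt) hτ
    (by
      have := hper (H.hasPseudoperiod_int 1)
      simpa using this) (hper h)
  obtain ⟨z₀, hz₀⟩ := H.proj.1.1.2
  have hk0 : k z₀ ≠ 0 := by
    simp only [hk]
    rw [if_neg hz₀]
    exact inv_ne_zero (hd z₀ hz₀).2
  have hfin : ∀ z, f z ≠ inf := by
    intro z hz
    refine hk0 ?_
    rw [hconst z₀ z]
    simp only [hk]
    rw [if_pos hz]
  set c := (k z₀)⁻¹ with hc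
  have hder : ∀ z, HasDerivAt F c z := by
    intro z
    have h1 := (hd z (hfin z)).1.differentiableAt.hasDerivAt
    have h2 : deriv F z = c := by
      rw [hc, ← hconst z z₀]
      simp only [hk]
      rw [if_neg (hfin z), inv_inv]
    rwa [h2] at h1
  have hlin : ∀ z, HasDerivAt (fun y => F y - c * y) 0 z := fun z => by
    have := (hder z).fun_sub ((hasDerivAt_id z).const_mul c)
    simpa using this
  refine H.not_affine c (F 0) fun z => ?_
  have h3 := is_const_of_deriv_eq_zero (fun z => (hlin z).differentiableAt)
    (fun z => (hlin z).deriv) z 0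
  rw [← coe_toPlane (hfin z), coe_inj]
  simp only [mul_zero, sub_zero] at h3
  change F z = _
  linear_combination h3

/-- All `u + n * η` are critical values. Finitely many classes modulo `1` force two of them to
coincide, so a nonzero integer multiple of `η` is an integer. -/
theorem rational_of_finite (H : IsProjection f g ℓ Φ)
    (hfin : (exp₁Image (singVals plane (onSphere f))).Finite) {τ η : ℂ} (hτ : 0 < τ.im)
    (h : HasPseudoperiod f τ η) : ∃ q : ℚ, η = (q : ℂ) := by
  obtain ⟨u, hu⟩ := H.exists_critVal hτ h
  have h1 : ∀ n : ℕ, ((u + n * η : ℂ) : RSphere) ∈ critVals plane (onSphere f) := by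
    intro n
    induction n with
    | zero => simpa using hu
    | succ n ih =>
      have := H.add_mem_critVals_plane h ih
      convert this using 2
      push_cast
      ring
  have h2 : ∀ n : ℕ, (exp₁ (u + n * η) : RSphere) ∈ exp₁Image (singVals plane (onSphere f)) :=
    fun n => ⟨_, subset_closure (Or.inl (h1 n)), rfl⟩
  have h3 : ¬ Function.Injective fun n : ℕ => (exp₁ (u + n * η) : RSphere) := fun hinj =>
    Set.infinite_range_of_injective hinj (hfin.subset (range_subset_iff.2 h2))
  rw [Function.not_injective_iff] at h3
  obtain ⟨a, b, hab, hne⟩ := h3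
  rw [coe_inj, exp₁_eq_iff] at hab
  obtain ⟨m, hm⟩ := hab
  have h4 : ((a : ℂ) - b) ≠ 0 := sub_ne_zero.2 (Nat.cast_injective.ne hne)
  refine ⟨m / ((a : ℚ) - b), ?_⟩
  push_cast
  rw [eq_div_iff h4]
  linear_combination hm

/-! ### Singular values of the projection and finite type -/

theorem singVals_plane_invariant (H : IsProjection f g ℓ Φ) (u : ℂ) (m : ℤ)
    (hu : (u : RSphere) ∈ critVals plane (onSphere f) ∪ asympVals plane (onSphere f)) :
    ((u + ℓ * m : ℂ) : RSphere) ∈ critVals plane (onSphere f) ∪ asympVals plane (onSphere f) := by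
  rcases hu with hu | hu
  · exact Or.inl (H.add_mem_critVals_plane (H.hasPseudoperiod_int m) hu)
  · exact Or.inr (H.add_mem_asympVals_plane (H.hasPseudoperiod_int m) hu)

theorem closure_invariant {A : Set RSphere} {c : ℂ}
    (hA : ∀ u : ℂ, (u : RSphere) ∈ A → ((u + c : ℂ) : RSphere) ∈ A) {u : ℂ}
    (hu : (u : RSphere) ∈ closure A) : ((u + c : ℂ) : RSphere) ∈ closure A := by
  rw [coe_mem_closure_iff] at hu ⊢
  exact ((by fun_prop : Continuous fun y : ℂ => y + c).tendsto u).frequently (hu.mono hA)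

theorem singVals_proj_inter (H : IsProjection f g ℓ Φ) (hℓ : ℓ ≠ 0) :
    singVals (projDom f) g ∩ punctured = exp₁Image (singVals plane (onSphere f)) :=
  closure_inter_punctured hℓ H.singVals_plane_invariant (by
    rw [union_inter_distrib_right, H.critVals_proj_inter hℓ, H.asympVals_proj_inter hℓ,
      exp₁Image_union])

theorem union_proj_inter_of_periodic (H : IsProjection f g ℓ Φ) (hℓ : ℓ = 0) :
    (critVals (projDom f) g ∪ asympVals (projDom f) g) ∩ punctured =
      exp₁Image (critVals punctured Φ ∪ asympVals punctured Φ) := by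
  rw [union_inter_distrib_right, H.critVals_proj_inter_of_periodic hℓ,
    H.asympVals_proj_inter_of_periodic hℓ, exp₁Image_union]

theorem singVals_proj_inter_of_periodic (H : IsProjection f g ℓ Φ) (h : CasePeriodic Φ ℓ) :
    singVals (projDom f) g ∩ punctured = exp₁Image (singVals punctured Φ) :=
  closure_inter_punctured_of_finite (H.union_proj_inter_of_periodic h.1) h.2

/-- Only the part in `ℂ*` matters for finiteness. When `ℓ = 0`, continuity of `exp₁` already puts
the image of the closure inside the closure, so finiteness for `g` gives it for `Φ`; equality of the
two sets is needed only in the other direction. -/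
theorem singVals_proj_finite_iff (H : IsProjection f g ℓ Φ) :
    (singVals (projDom f) g).Finite ↔ CaseNonperiodic f ℓ ∨ CasePeriodic Φ ℓ := by
  rw [finite_iff_inter_punctured]
  by_cases hℓ : ℓ = 0
  · constructor
    · intro h
      refine Or.inr ⟨hℓ, h.subset (subset_inter (exp₁Image_closure_subset ?_)
        (exp₁Image_subset_punctured _))⟩
      rw [← H.union_proj_inter_of_periodic hℓ]
      exact inter_subset_left
    · rintro (h | h)
      · exact absurd hℓ h.1
      · rw [H.singVals_proj_inter_of_periodic h]
        exact h.2
  · rw [H.singVals_proj_inter hℓ]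
    have h1 := finite_inter_strip_iff hℓ (A := singVals plane (onSphere f)) fun u m hu =>
      closure_invariant (fun u => H.singVals_plane_invariant u m) hu
    constructor
    · intro h
      exact Or.inl ⟨hℓ, h1.2 h, fun τ η hτ hη => H.rational_of_finite h hτ hη⟩
    · rintro (h | h)
      · exact h1.1 h.2.1
      · exact absurd h.1 hℓ

end IsProjection

end RSphere

/-! ### The main theorem -/

theorem theoremB (f : ℂ → RSphere) (g : RSphere → RSphere)
    (hfg : RSphere.IsProjectableWith f g)
    (ℓ : ℤ) (Φ : RSphere → RSphere)
    (hΦ : ∀ p ∈ RSphere.punctured, RSphere.IsMeroAt Φ p)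
    (hfΦ : ∀ z : ℂ, f z =
      OnePoint.map (fun u : ℂ => (ℓ : ℂ) * z + u) (Φ (RSphere.exp₁ z : RSphere))) :
    ((RSphere.singVals (RSphere.projDom f) g).Finite ↔
      RSphere.CaseNonperiodic f ℓ ∨ RSphere.CasePeriodic Φ ℓ) ∧
    (ℓ ≠ 0 → RSphere.singVals (RSphere.projDom f) g ∩ RSphere.punctured =
      RSphere.exp₁Image (RSphere.singVals RSphere.plane (RSphere.onSphere f))) ∧
    (RSphere.CasePeriodic Φ ℓ → RSphere.singVals (RSphere.projDom f) g ∩ RSphere.punctured =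
      RSphere.exp₁Image (RSphere.singVals RSphere.punctured Φ)) ∧
    {RSphere.zero, RSphere.inf} ⊆ RSphere.asympVals (RSphere.projDom f) g ∧
    (RSphere.zero ∈ RSphere.critVals (RSphere.projDom f) g ↔
      RSphere.IsSimplyPseudoperiodic f ∧ 2 ≤ |ℓ| ∧
        RSphere.zeroEnd ℓ ∉
          RSphere.ess RSphere.punctured Φ ∪ RSphere.fiber RSphere.punctured Φ RSphere.inf) ∧
    (RSphere.inf ∈ RSphere.critVals (RSphere.projDom f) g ↔
      RSphere.IsSimplyPseudoperiodic f ∧ 2 ≤ |ℓ| ∧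
        RSphere.poleEnd ℓ ∉
          RSphere.ess RSphere.punctured Φ ∪ RSphere.fiber RSphere.punctured Φ RSphere.inf) := by
  have H : RSphere.IsProjection f g ℓ Φ := ⟨hfg, hΦ, hfΦ⟩
  refine ⟨H.singVals_proj_finite_iff, H.singVals_proj_inter, H.singVals_proj_inter_of_periodic,
    ?_, ?_, ?_⟩
  · rintro v (rfl | rfl)
    · exact H.zero_inf_mem_asympVals.1
    · exact H.zero_inf_mem_asympVals.2
  · rw [H.zero_mem_critVals_iff, ← H.exists_finRep_iff]
    -- Simple pseudoperiodicity is forced by the finite value of `Φ` at the puncture in question.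
    exact ⟨fun ⟨h1, φ, h2⟩ => ⟨H.isSimplyPseudoperiodic h2
      (RSphere.IsProjection.zeroEnd_notMem_punctured ℓ), h1, φ, h2⟩, fun h => h.2⟩
  · rw [H.inf_mem_critVals_iff, ← H.exists_finRep_iff]
    exact ⟨fun ⟨h1, φ, h2⟩ => ⟨H.isSimplyPseudoperiodic h2
      (RSphere.IsProjection.poleEnd_notMem_punctured ℓ), h1, φ, h2⟩, fun h => h.2⟩
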